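/- **Conventions.** Let $N$ be a positive self-adjoint operator on a complex Hilbert space $\mathcal H$. Put $\mathcal H_l=\mathrm{dom}\,(1+N)^{l/2}$, $\mathcal H_\infty=\bigcap_l\mathcal H_l$, $\delta(T)=[(1+N)^{1/2},T]$, and $\varphi_s(T)=\mathrm{Trace}\big((1+N)^{-s/4}T(1+N)^{-s/4}\big)\in[0,\infty]$ for $0\le T\in\mathcal B(\mathcal H)$. For $p\ge 0$ let $\mathcal B_2(N,p)$ be the set of $T\in\mathcal B(\mathcal H)$ with $\varphi_s(T^*T)<\infty$ and $\varphi_s(TT^*)<\infty$ for all $s>p$, with the norms $\mathcal Q_n(T)=\big(\|T\|^2+\varphi_{p+1/n}(T^*T)+\varphi_{p+1/n}(TT^*)\big)^{1/2}$, $n\ge1$. Let $\mathcal B_1(N,p)\subset\mathcal B(\mathcal H)$ be the completion of $\mathcal B_2(N,p)^2$ (the span of products) for the norms $\mathcal P_n(T)=\inf\sum_i\mathcal Q_n(S_i)\mathcal Q_n(T_i)$, the infimum over finite representations $T=\sum_iS_iT_i$ with $S_i,T_i\in\mathcal B_2(N,p)$; as a space of operators it consists of the operator norm limits of sequences in $\mathcal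 B_2(N,p)^2$ that are Cauchy for every $\mathcal P_n$. Let $\mathcal B_1^\infty(N,p)$ be the set of $T\in\mathcal B(\mathcal H)$ such that, for all $l\ge0$, $T\mathcal H_l\subset\mathcal H_l$ and $\delta^l(T)$ extends to an element of $\mathcal B_1(N,p)$. Let $\mathrm{OP}^0(N)$ be the set of $T\in\mathcal B(\mathcal H)$ such that, for all $l\geq 0$, $T\mathcal H_l\subset\mathcal H_l$ and $\delta^l(T)$ extends to a bounded operator, and let $\mathrm{OP}^r(N)=(1+N)^{r/2}\mathrm{OP}^0(N)$. Let $\mathcal A$ be a $*$-algebra represented on $\mathcal H$ by bounded operators. Say that $(\mathcal A,N)$ is *finitely summable* if for some $s>0$ all $a(1+N)^{-s/2}$, $a\in\mathcal A$, are of trace class; its *spectral dimension* is then the infimum of the $s>0$ such that $|a|(1+N)^{-s/2}$ is of trace class for all $a\in\mathcal A$. *Spectral triples.* $(\mathcal A,\mathcal H,\mathcal D)$ is a spectral triple if $\mathcal D$ is self-adjoint and, for all $a\in\mathcal A$, $a$ preserves $\mathrm{dom}\,\mathcal D$, $[\mathcal D,a]$ extends to a bounded operator, and $a(1+\mathcal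 D^2)^{-1/2}$ is compact. It is *smoothly summable* if $(\mathcal A,\mathcal D^2)$ is finitely summable, with spectral dimension $p$ say, and $\mathcal A\cup[\mathcal D,\mathcal A]\subset\mathcal B_1^\infty(\mathcal D^2,p)$. *Pseudo-Riemannian spectral triples.* Let $\mathcal D$ be a closed densely defined operator on $\mathcal H$. Let $\langle\mathcal D\rangle^2$ be the closure of $\frac12(\mathcal D\mathcal D^*+\mathcal D^*\mathcal D)$ on $\mathrm{dom}\,\mathcal D\mathcal D^*\cap\mathrm{dom}\,\mathcal D^*\mathcal D$, let $\mathcal R_{\mathcal D}=\frac i2(\mathcal D^2-\mathcal D^{*2})$ on $\mathrm{dom}\,\mathcal D^2\cap\mathrm{dom}\,\mathcal D^{*2}$, and let $\mathcal H_\infty$ be formed with $N=\langle\mathcal D\rangle^2$. Then $(\mathcal A,\mathcal H,\mathcal D)$ is a pseudo-Riemannian spectral triple if 1. $\mathrm{dom}\,\mathcal D\mathcal D^*\cap\mathrm{dom}\,\mathcal D^*\mathcal D$ is dense and $\langle\mathcal D\rangle^2$ is self-adjoint; 2. $\mathcal H_\infty\subset\mathrm{dom}\,\mathcal R_{\mathcal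 D}$ and $\mathcal R_{\mathcal D}\mathcal H_\infty\subset\mathcal H_\infty$; on $\mathcal H_\infty$ the operator $[\langle\mathcal D\rangle^2,\mathcal R_{\mathcal D}]$ is in $\mathrm{OP}^2(\langle\mathcal D\rangle^2)$; and for all $a\in\mathcal A$ the operator $a\mathcal R_{\mathcal D}(1+\langle\mathcal D\rangle^2)^{-1}$ on $\mathcal H_\infty$ extends to a compact operator; 3. every $a\in\mathcal A$ preserves $\mathrm{dom}\,\mathcal D$ and $\mathrm{dom}\,\mathcal D^*$, and $[\mathcal D,a]$, $[\mathcal D^*,a]$ extend to bounded operators; 4. $a(1+\langle\mathcal D\rangle^2)^{-1/2}$ is compact for all $a\in\mathcal A$. It is *smoothly summable* if $(\mathcal A,\langle\mathcal D\rangle^2)$ is finitely summable, with spectral dimension $p$ say, and, with $S^0=\mathcal A\cup[\mathcal D,\mathcal A]\cup[\mathcal D^*,\mathcal A]$ and $S^{n}=[\langle\mathcal D\rangle^2,S^{n-1}]\cup[\mathcal R_{\mathcal D},S^{n-1}]$ for $n\ge1$, one has, as operators on $\mathcal H_\infty$, $S^n\subset\mathcal B_1^\infty(\langle\mathcal D\rangle^2,p)\,(1+\langle\mathcal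 D\rangle^2)^{n/2}$ for all $n\ge0$. **Theorem.** Let $(\mathcal A,\mathcal H,\mathcal D)$ be a smoothly summable pseudo-Riemannian spectral triple. Let $\mathcal D_E$ be the closure of $\frac12(\mathcal D+\mathcal D^*)+\frac i2(\mathcal D-\mathcal D^*)$ with initial domain $\mathrm{dom}\,\mathcal D\cap\mathrm{dom}\,\mathcal D^*$, and suppose that $(1+\langle\mathcal D\rangle^2)(1+\mathcal D_E^2)^{-1}$ is a bounded operator on (all of) $\mathcal H$. Then $(\mathcal A,\mathcal H,\mathcal D_E)$ is a smoothly summable spectral triple, and its spectral dimension equals that of $(\mathcal A,\mathcal H,\mathcal D)$. -/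

import Mathlib

open scoped InnerProductSpace ENNReal Topology

namespace WickRotation

noncomputable section

/-! ### Unbounded operators -/

section Operators

variable {H : Type*} [NormedAddCommGroup H] [InnerProductSpace ℂ H]

/-- The product `S T` of unbounded operators on its natural domain
`{x ∈ dom T : T x ∈ dom S}`. -/
def opMul (S T : H →ₗ.[ℂ] H) : H →ₗ.[ℂ] H where
  domain :=
    { carrier := {x | ∃ h : x ∈ T.domain, T ⟨x, h⟩ ∈ S.domain}
      zero_mem' := ⟨T.domain.zero_mem, by
        have h0 : T ⟨0, T.domain.zero_mem⟩ = 0 := T.map_zero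
        rw [h0]; exact S.domain.zero_mem⟩
      add_mem' := by
        rintro x y ⟨hx, hx'⟩ ⟨hy, hy'⟩
        refine ⟨T.domain.add_mem hx hy, ?_⟩
        have h := T.map_add ⟨x, hx⟩ ⟨y, hy⟩
        rw [show (⟨x + y, T.domain.add_mem hx hy⟩ : T.domain) = ⟨x, hx⟩ + ⟨y, hy⟩ from rfl, h]
        exact S.domain.add_mem hx' hy'
      smul_mem' := by
        rintro c x ⟨hx, hx'⟩
        refine ⟨T.domain.smul_mem c hx, ?_⟩
        have h := T.map_smul c ⟨x, hx⟩
        rw [show (⟨c • x, T.domain.smul_mem c hx⟩ : T.domain) = c • ⟨x, hx⟩ from rfl, h]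
        exact S.domain.smul_mem c hx' }
  toFun :=
    { toFun := fun x => S ⟨T ⟨x.1, x.2.1⟩, x.2.2⟩
      map_add' := fun x y => by
        rw [← S.map_add]
        congr 1
        exact Subtype.ext (T.map_add ⟨x.1, x.2.1⟩ ⟨y.1, y.2.1⟩)
      map_smul' := fun c x => by
        rw [RingHom.id_apply, ← S.map_smul]
        congr 1
        exact Subtype.ext (T.map_smul c ⟨x.1, x.2.1⟩) }

/-- The commutator `[S, T] = S T - T S` on its natural domain. -/
def opComm (S T : H →ₗ.[ℂ] H) : H →ₗ.[ℂ] H := opMul S T - opMul T S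

/-- A bounded operator, viewed as an (everywhere defined) unbounded operator. -/
def ofBdd (T : H →L[ℂ] H) : H →ₗ.[ℂ] H := (T : H →ₗ[ℂ] H).toPMap ⊤

/-- The bounded operator `T` preserves `dom S`, and `C` is the bounded extension of `[S, T]`. -/
def IsBddComm (S : H →ₗ.[ℂ] H) (T C : H →L[ℂ] H) : Prop :=
  ∀ x : S.domain, ∃ h : T x ∈ S.domain, S ⟨T x, h⟩ - T (S x) = C x

/-- `B` is the (everywhere defined, bounded) inverse of `1 + N : dom N → H`. -/
def IsResolvent (N : H →ₗ.[ℂ] H) (B : H →L[ℂ] H) : Prop :=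
  (∀ y : H, ∃ h : B y ∈ N.domain, B y + N ⟨B y, h⟩ = y) ∧
    ∀ x : N.domain, B ((x : H) + N x) = x

open scoped Classical in
/-- `(1 + N)⁻¹` as a bounded operator; it exists whenever `N` is positive and self-adjoint
(the value `0` is returned if it does not exist). -/
def resolvent (N : H →ₗ.[ℂ] H) : H →L[ℂ] H :=
  if h : ∃ B, IsResolvent N B then h.choose else 0

end Operators

variable {H : Type*} [NormedAddCommGroup H] [InnerProductSpace ℂ H] [CompleteSpace H]

/-! ### Powers of `1 + N`

Throughout, `N` is a positive self-adjoint operator. It stands for `D²` if `D` is self-adjoint,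
and for the closure of `(D D* + D* D) / 2` for more general `D`; all the spaces below depend
on `N` only. -/

/-- The bounded operator `(1 + N)^(-r/2)`, for `r ≥ 0`, by continuous functional calculus. -/
def negPow (N : H →ₗ.[ℂ] H) (r : ℝ) : H →L[ℂ] H := resolvent N ^ (r / 2)

/-- The unbounded operator `(1 + N)^(r/2)`, for `r ≥ 0`: the inverse of `(1 + N)^(-r/2)`, defined
on the range of the latter. -/
def posPow (N : H →ₗ.[ℂ] H) (r : ℝ) : H →ₗ.[ℂ] H := (ofBdd (negPow N r)).inverse

/-- The space `H_l = dom (1 + N)^(l/2)`, which is `dom |D|^l` if `N = D²`. -/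
def sobolev (N : H →ₗ.[ℂ] H) (l : ℕ) : Submodule ℂ H := (posPow N l).domain

/-- The space `H_∞ = ⋂ l, H_l`. -/
def smoothVectors (N : H →ₗ.[ℂ] H) : Submodule ℂ H := ⨅ l : ℕ, sobolev N l

/-! ### Trace and trace class -/

/-- An orthonormal basis of `H` (as a set of vectors). -/
def onb (H : Type*) [NormedAddCommGroup H] [InnerProductSpace ℂ H] [CompleteSpace H] : Set H :=
  (exists_hilbertBasis ℂ H).choose

/-- The trace `∑ ⟨e, T e⟩ ∈ [0, ∞]` of a positive bounded operator `T`, over an orthonormal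
basis. -/
def posTrace (T : H →L[ℂ] H) : ℝ≥0∞ := ∑' e : onb H, ENNReal.ofReal (⟪(e : H), T e⟫_ℂ).re

/-- `T` is of trace class: the trace of `|T| = (T* T)^(1/2)` is finite. -/
def IsTraceClass (T : H →L[ℂ] H) : Prop := posTrace (CFC.abs T) ≠ ∞

/-! ### Square integrable and integrable operators -/

/-- The weight `φ_s(T) = Tr ((1 + N)^(-s/4) T (1 + N)^(-s/4))` of a positive operator `T`. -/
def weight (N : H →ₗ.[ℂ] H) (s : ℝ) (T : H →L[ℂ] H) : ℝ≥0∞ :=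
  posTrace (negPow N (s / 2) * T * negPow N (s / 2))

/-- The space `B₂(N, p)`: for every `s > p` both `φ_s(T* T)` and `φ_s(T T*)` are finite. -/
def B2 (N : H →ₗ.[ℂ] H) (p : ℝ) : Set (H →L[ℂ] H) :=
  {T | ∀ s : ℝ, p < s → weight N s (star T * T) ≠ ∞ ∧ weight N s (T * star T) ≠ ∞}

/-- The norm `Q_{n+1}` on `B₂(N, p)`. -/
def Qnorm (N : H →ₗ.[ℂ] H) (p : ℝ) (n : ℕ) (T : H →L[ℂ] H) : ℝ :=
  Real.sqrt (‖T‖ ^ 2 + (weight N (p + 1 / ((n : ℝ) + 1)) (star T * T)).toReal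
    + (weight N (p + 1 / ((n : ℝ) + 1)) (T * star T)).toReal)

/-- The span `B₂(N, p)²` of the products of two elements of `B₂(N, p)`. -/
def B2sq (N : H →ₗ.[ℂ] H) (p : ℝ) : Submodule ℂ (H →L[ℂ] H) :=
  Submodule.span ℂ {T | ∃ a ∈ B2 N p, ∃ b ∈ B2 N p, T = a * b}

/-- The norm `P_{n+1}` on `B₂(N, p)²`: the infimum of `∑ Q_{n+1}(a_i) Q_{n+1}(b_i)` over all
finite representations `T = ∑ a_i b_i` with `a_i, b_i ∈ B₂(N, p)`. -/
def Pnorm (N : H →ₗ.[ℂ] H) (p : ℝ) (n : ℕ) (T : H →L[ℂ] H) : ℝ :=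
  sInf {r | ∃ (k : ℕ) (a b : Fin k → (H →L[ℂ] H)),
    (∀ i, a i ∈ B2 N p ∧ b i ∈ B2 N p) ∧ T = ∑ i, a i * b i ∧
      r = ∑ i, Qnorm N p n (a i) * Qnorm N p n (b i)}

/-- The space `B₁(N, p)`, the completion of `B₂(N, p)²` for the norms `P_1, P_2, …`, as a space of
bounded operators (each `P_n` dominates the operator norm): the operator norm limits of the
sequences in `B₂(N, p)²` that are Cauchy for every `P_n`. -/
def B1 (N : H →ₗ.[ℂ] H) (p : ℝ) : Set (H →L[ℂ] H) :=
  {T | ∃ u : ℕ → (H →L[ℂ] H), (∀ j, u j ∈ B2sq N p) ∧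
    (∀ n : ℕ, ∀ ε > 0, ∃ m, ∀ i ≥ m, ∀ j ≥ m, Pnorm N p n (u i - u j) < ε) ∧
    Filter.Tendsto u Filter.atTop (𝓝 T)}

/-! ### Smoothness -/

/-- `S` is (the bounded extension of) `δ^l(T)`, where `δ(T) = [(1 + N)^(1/2), T]`. -/
def IsDeltaPow (N : H →ₗ.[ℂ] H) : ℕ → (H →L[ℂ] H) → (H →L[ℂ] H) → Prop
  | 0, T, S => S = T
  | l + 1, T, S => ∃ T', IsDeltaPow N l T T' ∧ IsBddComm (posPow N 1) T' S

/-- The space `B₁^k(N, p)`: `T` maps `H_l` to `H_l` and `δ^l(T) ∈ B₁(N, p)` for all `l ≤ k`. -/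
def B1pow (N : H →ₗ.[ℂ] H) (p : ℝ) (k : ℕ) : Set (H →L[ℂ] H) :=
  {T | ∀ l ≤ k, (∀ x ∈ sobolev N l, T x ∈ sobolev N l) ∧ ∃ S ∈ B1 N p, IsDeltaPow N l T S}

/-- The space `B₁^∞(N, p) = ⋂ k, B₁^k(N, p)`. -/
def B1inf (N : H →ₗ.[ℂ] H) (p : ℝ) : Set (H →L[ℂ] H) := ⋂ k : ℕ, B1pow N p k

/-- The regular operators of order `0`: `OP⁰(N) = ⋂ l, dom δ^l`. -/
def OP0 (N : H →ₗ.[ℂ] H) : Set (H →L[ℂ] H) :=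
  {T | ∀ l : ℕ, (∀ x ∈ sobolev N l, T x ∈ sobolev N l) ∧ ∃ S, IsDeltaPow N l T S}

/-- `A ∈ OP^n(N) = (1 + N)^(n/2) OP⁰(N)`, as operators on `H_∞`. -/
def MemOP (N : H →ₗ.[ℂ] H) (n : ℕ) (A : H →ₗ.[ℂ] H) : Prop :=
  ∃ T ∈ OP0 N, ∀ x ∈ smoothVectors N, ∃ (h : x ∈ A.domain) (h' : T x ∈ (posPow N n).domain),
    A ⟨x, h⟩ = posPow N n ⟨T x, h'⟩

/-- `A ∈ B₁^∞(N, p) (1 + N)^(n/2)`, as operators on `H_∞`. -/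
def MemTame (N : H →ₗ.[ℂ] H) (p : ℝ) (n : ℕ) (A : H →ₗ.[ℂ] H) : Prop :=
  ∃ T ∈ B1inf N p, ∀ x ∈ smoothVectors N, ∃ (h : x ∈ A.domain) (h' : x ∈ (posPow N n).domain),
    A ⟨x, h⟩ = T (posPow N n ⟨x, h'⟩)

/-! ### Summability

`π` is a representation of the `*`-algebra `A` by bounded operators on `H`. -/

section Triples

variable {A : Type*} [NonUnitalRing A] [StarRing A] [Module ℂ A]

/-- Finite summability: for some `s > 0`, all `a (1 + N)^(-s/2)` are of trace class. -/
def IsFinitelySummable (π : A →⋆ₙₐ[ℂ] (H →L[ℂ] H)) (N : H →ₗ.[ℂ] H) : Prop :=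
  ∃ s : ℝ, 0 < s ∧ ∀ a, IsTraceClass (π a * negPow N s)

/-- The spectral dimension: the infimum of the `s > 0` such that all `|a| (1 + N)^(-s/2)` have
finite trace. -/
def spectralDim (π : A →⋆ₙₐ[ℂ] (H →L[ℂ] H)) (N : H →ₗ.[ℂ] H) : ℝ :=
  sInf {s | 0 < s ∧ ∀ a, IsTraceClass (CFC.abs (π a) * negPow N s)}

/-! ### Spectral triples -/

/-- `(A, H, D)` is a spectral triple. -/
structure IsSpectralTriple (π : A →⋆ₙₐ[ℂ] (H →L[ℂ] H)) (D : H →ₗ.[ℂ] H) : Prop where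
  selfAdjoint : IsSelfAdjoint D
  comm_bdd : ∀ a, ∃ C, IsBddComm D (π a) C
  compact : ∀ a, IsCompactOperator (π a * negPow (opMul D D) 1)

/-- The spectral triple `(A, H, D)` is smoothly summable: it is finitely summable, with spectral
dimension `p` say, and `A ∪ [D, A] ⊆ B₁^∞(D, p)`. -/
structure IsSmoothlySummable (π : A →⋆ₙₐ[ℂ] (H →L[ℂ] H)) (D : H →ₗ.[ℂ] H) : Prop where
  isSpectralTriple : IsSpectralTriple π D
  finitelySummable : IsFinitelySummable π (opMul D D)
  algebra_mem : ∀ a, π a ∈ B1inf (opMul D D) (spectralDim π (opMul D D))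
  comm_mem : ∀ a, ∃ C ∈ B1inf (opMul D D) (spectralDim π (opMul D D)), IsBddComm D (π a) C

/-! ### Pseudo-Riemannian spectral triples -/

/-- `(D D* + D* D) / 2` on `dom D D* ∩ dom D* D`. -/
def absSq₀ (D : H →ₗ.[ℂ] H) : H →ₗ.[ℂ] H :=
  (1 / 2 : ℂ) • (opMul D D.adjoint + opMul D.adjoint D)

/-- The operator `⟨D⟩²`: the closure of `(D D* + D* D) / 2`. -/
def absSq (D : H →ₗ.[ℂ] H) : H →ₗ.[ℂ] H := (absSq₀ D).closure

/-- The operator `R_D = (i/2) (D² - D*²)` on `dom D² ∩ dom D*²`. -/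
def remainder (D : H →ₗ.[ℂ] H) : H →ₗ.[ℂ] H :=
  (Complex.I / 2) • (opMul D D - opMul D.adjoint D.adjoint)

/-- The Wick rotation `D_E`: the closure of `(D + D*) / 2 + (i/2) (D - D*)`, with initial domain
`dom D ∩ dom D*`. -/
def wick (D : H →ₗ.[ℂ] H) : H →ₗ.[ℂ] H :=
  ((1 / 2 : ℂ) • (D + D.adjoint) + (Complex.I / 2) • (D - D.adjoint)).closure

/-- `(A, H, D)` is a pseudo-Riemannian spectral triple. -/
structure IsPseudoRiemannianTriple (π : A →⋆ₙₐ[ℂ] (H →L[ℂ] H)) (D : H →ₗ.[ℂ] H) : Prop where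
  dense : Dense (D.domain : Set H)
  closed : D.IsClosed
  absSq_dense : Dense ((absSq₀ D).domain : Set H)
  absSq_selfAdjoint : IsSelfAdjoint (absSq D)
  remainder_maps : ∀ x ∈ smoothVectors (absSq D),
    ∃ h : x ∈ (remainder D).domain, remainder D ⟨x, h⟩ ∈ smoothVectors (absSq D)
  comm_remainder : MemOP (absSq D) 2 (opComm (absSq D) (remainder D))
  /-- `a R_D (1 + ⟨D⟩²)⁻¹`, which is defined on `H_∞`, is (extends to) a compact operator. -/
  remainder_compact : ∀ a, ∃ K : H →L[ℂ] H, IsCompactOperator K ∧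
    ∀ x ∈ smoothVectors (absSq D),
      ∃ h : negPow (absSq D) 2 x ∈ (remainder D).domain,
        π a (remainder D ⟨negPow (absSq D) 2 x, h⟩) = K x
  comm_bdd : ∀ a, ∃ C, IsBddComm D (π a) C
  comm_adjoint_bdd : ∀ a, ∃ C, IsBddComm D.adjoint (π a) C
  compact : ∀ a, IsCompactOperator (π a * negPow (absSq D) 1)

/-- The sets `S⁰ = A ∪ [D, A] ∪ [D*, A]` and `S^(n+1) = [⟨D⟩², S^n] ∪ [R_D, S^n]`. -/
def commSet (π : A →⋆ₙₐ[ℂ] (H →L[ℂ] H)) (D : H →ₗ.[ℂ] H) : ℕ → Set (H →ₗ.[ℂ] H)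
  | 0 => {s | ∃ a, s = ofBdd (π a) ∨ s = opComm D (ofBdd (π a)) ∨
      s = opComm D.adjoint (ofBdd (π a))}
  | n + 1 => {s | ∃ t ∈ commSet π D n, s = opComm (absSq D) t ∨ s = opComm (remainder D) t}

/-- The pseudo-Riemannian spectral triple `(A, H, D)` is smoothly summable: it is finitely
summable, with spectral dimension `p` say, and `S^n ⊆ B₁^∞(⟨D⟩, p) (1 + ⟨D⟩²)^(n/2)` for
all `n ≥ 0`. -/
structure IsSmoothlySummablePR (π : A →⋆ₙₐ[ℂ] (H →L[ℂ] H)) (D : H →ₗ.[ℂ] H) : Prop where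
  isTriple : IsPseudoRiemannianTriple π D
  finitelySummable : IsFinitelySummable π (absSq D)
  smooth : ∀ n, ∀ s ∈ commSet π D n, MemTame (absSq D) (spectralDim π (absSq D)) n s

end Triples

/-- `(1 + N) (1 + M)⁻¹` is an everywhere defined bounded operator. -/
def IsBddRatio (N M : H →ₗ.[ℂ] H) : Prop :=
  ∃ X : H →L[ℂ] H, ∀ y : H, ∃ (z : H) (hM : z ∈ M.domain) (hN : z ∈ N.domain),
    z + M ⟨z, hM⟩ = y ∧ z + N ⟨z, hN⟩ = X y

end

end WickRotation

/-!
# Wick rotation of pseudo-Riemannian spectral triples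

Write `N = ⟨D⟩²`, `M = D_E²`, `B = (1 + N)⁻¹`, `B' = (1 + M)⁻¹` and `K = B^(1/2)`. The proof compares the
two resolvents and then carries integrability and smoothness from `N` over to `M`.

*Self-adjointness.* `D_E` is symmetric, and the ratio hypothesis makes `1 + D_E²` onto, which forces
`D_E` to be self-adjoint (`IsSymm.isSelfAdjoint_of_surjective`). The quadratic form of `N` is
`(‖D x‖² + ‖D* x‖²) / 2` (`exists_inner_absSq`), so that `M = N + R_D` on the common domain (`wick_sq`),
and `B' = B X` with `X` bounded.

*Ranges of powers.* The form of `R_D` is dominated by that of `N`, so that `K R_D K` is bounded. Since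
`[N, R_D]` has order two, `K R_D K` preserves the range of `B`, hence by interpolation that of `K`
(`exists_half_factor`, a form of Reid's inequality), and `R₁ = R_D B` is bounded
(`exists_bounded_quotient`). Thus `B = B' (1 + R₁)`. The commutators of `R₁` with powers of `B` are of
lower order and become small relative to the invertible `1 + R₁` when the spectral parameter is moved
to `-λ` with `λ` large. This gives elliptic regularity for `M` (`exists_resolvent_factor`), so `B'^n` and
`B^n` have the same range for every `n` (`exists_pow_factor`), and by the Löwner–Heinz inequality the
same holds for all real powers (`exists_rpow_factor`, `IsComparable`). Compactness, finite
summability, the spectral dimension, and the spaces `H_∞`, `B₂`, `B₁` are therefore the same for `N` and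
`M`.

*Smoothness.* The spaces `B₁^∞` are defined by commutators with the square root `(1 + M)^(1/2)`, whereas
the hypothesis on the sets `S^n` controls iterated commutators with `M = N + R_D`. The iterates
`T_{n+1} = [M, T_n] (1 + M)^(-1/2)` of an element `T₀` of `S⁰` all lie in `B₁`
(`isRegular_of_mem_commSpan`). If `x` and `y` denote left and right multiplication by `(1 + M)^(1/2)`,
then `x - y = (1/2) (x² - y²) y⁻¹ - (1/2) (x - y)² y⁻¹`, and
`(x - y)² y⁻¹ = (x + y)⁻² y ((x² - y²) y⁻¹)²` involves only the iterates and the inverse of `x + y`. This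
inverse square is an absolutely convergent series of two-sided multiplications by functions of
`(1 + M)^(-1/2)` (`sylvesterSeries`), which preserve `B₁` (`B1_tsum_mul_mul`). Hence `δ(T₀)` has the same
property as `T₀`, and induction gives `T₀ ∈ B₁^∞` (`IsRegular.mem_B1inf`).
-/


namespace WickRotation

section BoundedOperators

variable {H : Type*} [NormedAddCommGroup H] [InnerProductSpace ℂ H]

/-! ### Factorisation of bounded operators -/

lemma clm_eq_of_eqOn_dense {A C : H →L[ℂ] H} {S : Set H} (hS : Dense S)
    (h : ∀ x ∈ S, A x = C x) : A = C :=
  DFunLike.coe_injective (Continuous.ext_on hS A.continuous C.continuous h)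

lemma re_inner_nonneg {B : H →L[ℂ] H} (hB : 0 ≤ B) (x : H) : 0 ≤ (⟪x, B x⟫_ℂ).re :=
  ((ContinuousLinearMap.nonneg_iff_isPositive B).1 hB).re_inner_nonneg_right x

lemma re_inner_mono {B C : H →L[ℂ] H} (h : B ≤ C) (x : H) :
    (⟪x, B x⟫_ℂ).re ≤ (⟪x, C x⟫_ℂ).re := by
  have := ((ContinuousLinearMap.le_def B C).1 h).re_inner_nonneg_right x
  rw [sub_apply, inner_sub_right, map_sub] at this
  simp only [RCLike.re_to_complex] at this
  linarith

lemma pow_injective {B : H →L[ℂ] H} (hi : Function.Injective B) (n : ℕ) :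
    Function.Injective (B ^ n : H →L[ℂ] H) := by
  induction n with
  | zero => simpa using Function.injective_id
  | succ k ih =>
    rw [pow_succ]
    exact ih.comp hi

variable [CompleteSpace H]

/-- Douglas' factorisation lemma: domination of norms gives a left factor. -/
lemma exists_factor_of_norm_le {A C : H →L[ℂ] H} {c : ℝ} (h : ∀ x, ‖A x‖ ≤ c * ‖C x‖) :
    ∃ W : H →L[ℂ] H, A = W * C := by
  let S : Submodule ℂ H := (LinearMap.range (C : H →ₗ[ℂ] H)).topologicalClosure
  -- `C x ↦ A x` is bounded on the range of `C`; extend it to the closure `S`, and by `0` on `Sᗮ`.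
  have hS : IsClosed (S : Set H) := Submodule.isClosed_topologicalClosure _
  have : CompleteSpace S := hS.completeSpace_coe
  have hmem : ∀ x, C x ∈ S := fun x =>
    Submodule.le_topologicalClosure _ ⟨x, rfl⟩
  let e : H →ₗ[ℂ] S := (C : H →ₗ[ℂ] H).codRestrict S hmem
  have hd : DenseRange e := by
    intro y
    rw [Metric.mem_closure_iff]
    intro ε hε
    have hy : (y : H) ∈ closure ((LinearMap.range (C : H →ₗ[ℂ] H) : Submodule ℂ H) : Set H) := y.2
    obtain ⟨_, ⟨x, rfl⟩, hx⟩ := Metric.mem_closure_iff.1 hy ε hε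
    exact ⟨e x, ⟨x, rfl⟩, hx⟩
  have hn : ∃ c, ∀ x, ‖(A : H →ₗ[ℂ] H) x‖ ≤ c * ‖e x‖ := ⟨c, h⟩
  refine ⟨((A : H →ₗ[ℂ] H).extendOfNorm e) ∘L S.orthogonalProjectionOnto, ?_⟩
  ext x
  have h1 : S.orthogonalProjectionOnto (C x) = e x :=
    Submodule.orthogonalProjectionOnto_mem_subspace_eq_self (K := S) (e x)
  have h2 := LinearMap.extendOfNorm_eq hd hn x
  simp only [mul_apply_eq_comp, ContinuousLinearMap.comp_apply, h1, h2]
  rfl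

/-- Range inclusion in the range of an injective operator gives a bounded right factor, by the
closed graph theorem. -/
lemma exists_factor_of_range {A C : H →L[ℂ] H} (hC : Function.Injective C)
    (h : ∀ x, ∃ u, C u = A x) : ∃ Y : H →L[ℂ] H, A = C * Y := by
  choose g hg using h
  let gl : H →ₗ[ℂ] H :=
    { toFun := g
      map_add' := fun x y => hC (by simp [hg])
      map_smul' := fun c x => hC (by simp [hg]) }
  refine ⟨ContinuousLinearMap.ofSeqClosedGraph (g := gl) ?_, ?_⟩
  · intro u x y hu hy
    apply hC
    have h1 : Filter.Tendsto (fun n => C (g (u n))) Filter.atTop (𝓝 (C y)) :=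
      (C.continuous.tendsto y).comp hy
    have h2 : Filter.Tendsto (fun n => A (u n)) Filter.atTop (𝓝 (A x)) :=
      (A.continuous.tendsto x).comp hu
    simp only [hg] at h1
    rw [tendsto_nhds_unique h1 h2]
    exact (hg x).symm
  · ext x
    exact (hg x).symm

lemma inner_map_of_selfAdjoint {B : H →L[ℂ] H} (hB : IsSelfAdjoint B) (x y : H) :
    ⟪B x, y⟫_ℂ = ⟪x, B y⟫_ℂ := by
  have := ContinuousLinearMap.adjoint_inner_left B y x
  rw [← ContinuousLinearMap.star_eq_adjoint, hB.star_eq] at this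
  exact this

lemma norm_sq_eq_inner_star_mul (A : H →L[ℂ] H) (x : H) :
    ‖A x‖ ^ 2 = (⟪x, (star A * A) x⟫_ℂ).re := by
  rw [mul_apply_eq_comp, ContinuousLinearMap.star_eq_adjoint,
    ContinuousLinearMap.adjoint_inner_right]
  exact (inner_self_eq_norm_sq (𝕜 := ℂ) (A x)).symm

lemma le_of_norm_le {A C : H →L[ℂ] H} {c : ℝ}
    (h : ∀ x, ‖A x‖ ^ 2 ≤ c * ‖C x‖ ^ 2) : star A * A ≤ c • (star C * C) := by
  rw [ContinuousLinearMap.le_def, ContinuousLinearMap.isPositive_def]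
  constructor
  · rw [← ContinuousLinearMap.isSelfAdjoint_iff_isSymmetric]
    exact (IsSelfAdjoint.smul (by simp [IsSelfAdjoint]) (IsSelfAdjoint.star_mul_self C)).sub
      (IsSelfAdjoint.star_mul_self A)
  · intro x
    have := h x
    rw [norm_sq_eq_inner_star_mul, norm_sq_eq_inner_star_mul] at this
    rw [ContinuousLinearMap.reApplyInnerSelf_apply, inner_re_symm]
    rw [sub_apply, inner_sub_right, smul_apply,
      inner_smul_right_eq_smul]
    simp only [map_sub, Complex.real_smul, RCLike.re_to_complex, Complex.re_ofReal_mul]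
    linarith

/-! ### Powers of a positive operator -/

lemma rpow_add_of_nonneg {B : H →L[ℂ] H} {s t : ℝ} (hs : 0 ≤ s) (ht : 0 ≤ t) :
    B ^ (s + t) = B ^ s * B ^ t := by
  rw [CFC.rpow_def, CFC.rpow_def, CFC.rpow_def, ← cfc_mul _ _ B
    (NNReal.continuous_rpow_const hs).continuousOn (NNReal.continuous_rpow_const ht).continuousOn]
  congr 1
  ext x : 1
  exact NNReal.rpow_add_of_nonneg _ hs ht

lemma rpow_isSelfAdjoint (B : H →L[ℂ] H) (s : ℝ) : IsSelfAdjoint (B ^ s) :=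
  IsSelfAdjoint.of_nonneg CFC.rpow_nonneg

lemma rpow_injective {B : H →L[ℂ] H} (hB : 0 ≤ B) (hi : Function.Injective B) {s : ℝ}
    (hs : 0 ≤ s) : Function.Injective (B ^ s : H →L[ℂ] H) := by
  obtain ⟨n, hn⟩ := exists_nat_ge s
  have h1 : B ^ n = B ^ ((n : ℝ) - s) * B ^ s := by
    rw [← rpow_add_of_nonneg (by linarith) hs, sub_add_cancel, CFC.rpow_natCast B n hB]
  have h2 := pow_injective hi n
  rw [h1] at h2
  exact Function.Injective.of_comp (f := (B ^ ((n : ℝ) - s) : H →L[ℂ] H)) h2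

lemma norm_sq_rpow {B : H →L[ℂ] H} {s : ℝ} (hs : 0 ≤ s) (x : H) :
    ‖(B ^ s) x‖ ^ 2 = (⟪x, (B ^ (2 * s)) x⟫_ℂ).re := by
  rw [norm_sq_eq_inner_star_mul, (rpow_isSelfAdjoint B s).star_eq, ← rpow_add_of_nonneg hs hs,
    two_mul]

/-- If all integer powers of `B'` factor through those of `B`, then so do all real powers: this is
the Löwner–Heinz inequality. -/
lemma exists_rpow_factor {B B' : H →L[ℂ] H} (hB : 0 ≤ B) (hB' : 0 ≤ B')
    (h : ∀ n : ℕ, ∃ Y, B' ^ n = B ^ n * Y) {s : ℝ} (hs : 0 ≤ s) :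
    ∃ Y : H →L[ℂ] H, B' ^ s = B ^ s * Y := by
  obtain ⟨n, hn⟩ := exists_nat_gt s
  have hn0 : (0 : ℝ) < n := hs.trans_lt hn
  obtain ⟨Y, hY⟩ := h n
  have hsB : IsSelfAdjoint B := IsSelfAdjoint.of_nonneg hB
  have hsB' : IsSelfAdjoint B' := IsSelfAdjoint.of_nonneg hB'
  have h1 : B' ^ (2 * (n : ℝ)) ≤ (‖Y‖ ^ 2 : ℝ) • B ^ (2 * (n : ℝ)) := by
    have h2 : B' ^ n = star Y * B ^ n := by
      rw [← (hsB'.pow n).star_eq, hY, star_mul, (hsB.pow n).star_eq]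
    have h3 : ∀ x, ‖(B' ^ n) x‖ ^ 2 ≤ ‖Y‖ ^ 2 * ‖(B ^ n) x‖ ^ 2 := by
      intro x
      rw [h2, ← mul_pow]
      have : ‖star Y ((B ^ n) x)‖ ≤ ‖Y‖ * ‖(B ^ n) x‖ := by
        rw [← norm_star Y]; exact ContinuousLinearMap.le_opNorm _ _
      exact pow_le_pow_left₀ (norm_nonneg _) this 2
    have h4 := le_of_norm_le h3
    rw [(hsB'.pow n).star_eq, (hsB.pow n).star_eq, ← pow_add, ← pow_add, ← two_mul,
      ← CFC.rpow_natCast B' _ hB', ← CFC.rpow_natCast B _ hB] at h4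
    push_cast at h4
    exact h4
  -- `t ↦ t ^ (s / n)` is operator monotone
  have hθ : s / n ∈ Set.Icc (0 : ℝ) 1 := ⟨by positivity, by rw [div_le_one hn0]; exact hn.le⟩
  have h5 := CFC.rpow_le_rpow hθ h1
  have e : 2 * (n : ℝ) * (s / n) = 2 * s := by field_simp
  have hc : ((‖Y‖ ^ 2 : ℝ) • B ^ (2 * (n : ℝ))) ^ (s / n)
      = ((‖Y‖ ^ 2) ^ (s / n) : ℝ) • B ^ (2 * s) := by
    rw [CFC.rpow_def, CFC.rpow_def, CFC.rpow_def]
    have hcont : ∀ r : ℝ, 0 ≤ r → Continuous fun x : NNReal => x ^ r := fun r hr =>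
      NNReal.continuous_rpow_const hr
    have e1 : (‖Y‖ ^ 2 : ℝ) • cfc (fun x : NNReal => x ^ (2 * (n : ℝ))) B =
        cfc (fun x : NNReal => (‖Y‖₊ ^ 2) • x ^ (2 * (n : ℝ))) B := by
      rw [cfc_smul _ _ B (hcont _ (by positivity)).continuousOn]
      rfl
    have e2 : ((‖Y‖ ^ 2) ^ (s / n) : ℝ) • cfc (fun x : NNReal => x ^ (2 * s)) B =
        cfc (fun x : NNReal => ((‖Y‖₊ ^ 2) ^ (s / n) : NNReal) • x ^ (2 * s)) B := by
      rw [cfc_smul _ _ B (hcont _ (by positivity)).continuousOn]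
      rfl
    rw [e1, e2, ← cfc_comp' (fun x : NNReal => x ^ (s / n))
      (fun x : NNReal => (‖Y‖₊ ^ 2) • x ^ (2 * (n : ℝ))) B (hcont _ hθ.1).continuousOn
      ((hcont (2 * (n : ℝ)) (by positivity)).const_smul (‖Y‖₊ ^ 2)).continuousOn]
    congr 1
    ext x : 1
    simp only [smul_eq_mul]
    rw [NNReal.mul_rpow, ← NNReal.rpow_mul, e]
  rw [CFC.rpow_rpow_of_exponent_nonneg B' _ _ (by positivity) hθ.1 hB', e, hc] at h5
  set c : ℝ := (‖Y‖ ^ 2) ^ (s / n)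
  have hc0 : 0 ≤ c := Real.rpow_nonneg (by positivity) _
  have h6 : ∀ x, ‖(B' ^ s) x‖ ≤ √c * ‖(B ^ s) x‖ := by
    intro x
    have := re_inner_mono h5 x
    rw [smul_apply, inner_smul_right_eq_smul, Complex.real_smul,
      Complex.re_ofReal_mul, ← norm_sq_rpow hs, ← norm_sq_rpow hs] at this
    refine le_of_sq_le_sq ?_ (by positivity)
    rw [mul_pow, Real.sq_sqrt hc0]
    exact this
  obtain ⟨W, hW⟩ := exists_factor_of_norm_le h6
  refine ⟨star W, ?_⟩
  rw [← (rpow_isSelfAdjoint B' s).star_eq, hW, star_mul, (rpow_isSelfAdjoint B s).star_eq]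

end BoundedOperators

section BoundedOperators

variable {H : Type*} [NormedAddCommGroup H] [InnerProductSpace ℂ H] [CompleteSpace H]

/-! ### Interpolation, uniqueness for the Sylvester equation, and spectral cut-offs -/

/-- A log-convex sequence that grows at most like `r ^ n` has all its ratios bounded by `r`: if the
first ratio exceeds `r`, so do all later ones. -/
lemma le_geom_of_log_convex {a : ℕ → ℝ} {C r : ℝ} (ha : ∀ n, 0 ≤ a n) (hr : 0 ≤ r)
    (hconv : ∀ n, a (n + 1) ^ 2 ≤ a n * a (n + 2)) (hb : ∀ n, a n ≤ C * r ^ n) :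
    a 1 ≤ r * a 0 := by
  by_contra! hlt
  have h0 : 0 < a 0 := by
    rcases (ha 0).lt_or_eq with h | h
    · exact h
    · have := hconv 0
      rw [← h] at this
      have h1 : a 1 = 0 := by
        have : a 1 ^ 2 ≤ 0 := by simpa using this
        exact pow_eq_zero_iff (two_ne_zero) |>.1 (le_antisymm this (sq_nonneg _))
      rw [h1, ← h] at hlt
      simp at hlt
  set q := a 1 / a 0 with hq
  have hrq : r < q := by rw [hq, lt_div_iff₀ h0]; exact hlt
  have hq0 : 0 < q := hr.trans_lt hrq
  have step : ∀ n, 0 < a n ∧ q * a n ≤ a (n + 1) := by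
    intro n
    induction n with
    | zero => exact ⟨h0, by rw [hq, div_mul_cancel₀ _ h0.ne']⟩
    | succ k ih =>
      have hp : 0 < a (k + 1) := (mul_pos hq0 ih.1).trans_le ih.2
      refine ⟨hp, ?_⟩
      have h1 := hconv k
      have h2 : q * a k * a (k + 1) ≤ a (k + 1) ^ 2 := by
        rw [sq]; exact mul_le_mul_of_nonneg_right ih.2 hp.le
      have h3 : a k * (q * a (k + 1)) ≤ a k * a (k + 2) := by linarith
      exact le_of_mul_le_mul_left h3 ih.1
  have grow : ∀ n, a 0 * q ^ n ≤ a n := by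
    intro n
    induction n with
    | zero => simp
    | succ k ih =>
      calc a 0 * q ^ (k + 1) = q * (a 0 * q ^ k) := by ring
        _ ≤ q * a k := mul_le_mul_of_nonneg_left ih hq0.le
        _ ≤ a (k + 1) := (step k).2
  rcases hr.lt_or_eq with hr0 | hr0
  · have hgt : 1 < q / r := by rw [one_lt_div hr0]; exact hrq
    obtain ⟨n, hn⟩ := pow_unbounded_of_one_lt (C / a 0) hgt
    rw [div_pow, div_lt_div_iff₀ h0 (pow_pos hr0 n)] at hn
    have := (grow n).trans (hb n)
    linarith
  · have := (grow 1).trans (hb 1)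
    rw [← hr0] at this
    have : 0 < a 0 * q ^ 1 := by positivity
    simp at *
    linarith

/-- The Cauchy–Schwarz inequality for the form of a positive operator. -/
lemma re_inner_sq_le_of_nonneg {B : H →L[ℂ] H} (hB : 0 ≤ B) (x y : H) :
    (⟪x, B y⟫_ℂ).re ^ 2 ≤ (⟪x, B x⟫_ℂ).re * (⟪y, B y⟫_ℂ).re := by
  have hs : IsSelfAdjoint (CFC.sqrt B) := IsSelfAdjoint.of_nonneg (CFC.sqrt_nonneg B)
  have key : ∀ u v : H, ⟪u, B v⟫_ℂ = ⟪CFC.sqrt B u, CFC.sqrt B v⟫_ℂ := by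
    intro u v
    conv_lhs => rw [← CFC.sqrt_mul_sqrt_self B hB]
    rw [mul_apply_eq_comp, ← inner_map_of_selfAdjoint hs]
  rw [key, key, key]
  have h1 : |(⟪CFC.sqrt B x, CFC.sqrt B y⟫_ℂ).re| ≤ ‖CFC.sqrt B x‖ * ‖CFC.sqrt B y‖ :=
    (Complex.abs_re_le_norm _).trans (norm_inner_le_norm _ _)
  have h2 : ∀ z : H, (⟪z, z⟫_ℂ).re = ‖z‖ ^ 2 := fun z => inner_self_eq_norm_sq (𝕜 := ℂ) z
  rw [h2, h2, ← mul_pow, ← sq_abs]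
  exact pow_le_pow_left₀ (abs_nonneg _) h1 2

/-- Reid's inequality: an operator `C` which is symmetric for the form of `B ≥ 0` is bounded by
`‖C‖` with respect to this form. -/
lemma reid_inequality {B C : H →L[ℂ] H} (hB : 0 ≤ B) (hC : IsSelfAdjoint (B * C)) (x : H) :
    (⟪x, B (C x)⟫_ℂ).re ≤ ‖C‖ * (⟪x, B x⟫_ℂ).re := by
  have hsB : IsSelfAdjoint B := IsSelfAdjoint.of_nonneg hB
  have hsym : ∀ u v : H, ⟪C u, B v⟫_ℂ = ⟪u, B (C v)⟫_ℂ := by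
    intro u v
    rw [← inner_map_of_selfAdjoint hsB]
    exact inner_map_of_selfAdjoint hC u v
  let q : H → ℝ := fun y => (⟪y, B y⟫_ℂ).re
  have hq : ∀ y, 0 ≤ q y := fun y => re_inner_nonneg hB y
  have hqb : ∀ y, q y ≤ ‖B‖ * ‖y‖ ^ 2 := by
    intro y
    calc q y ≤ ‖⟪y, B y⟫_ℂ‖ := Complex.re_le_norm _
      _ ≤ ‖y‖ * ‖B y‖ := norm_inner_le_norm _ _
      _ ≤ ‖y‖ * (‖B‖ * ‖y‖) := by gcongr; exact B.le_opNorm y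
      _ = ‖B‖ * ‖y‖ ^ 2 := by ring
  -- the sequence `q (C^n x)` is log-convex and grows at most like `‖C‖^(2n)`
  have h1 : q (C x) ≤ ‖C‖ ^ 2 * q x := by
    have := le_geom_of_log_convex (a := fun n => q ((C ^ n) x)) (C := ‖B‖ * ‖x‖ ^ 2)
      (r := ‖C‖ ^ 2) (fun n => hq _) (by positivity) ?_ ?_
    · simpa using this
    · intro n
      have e1 : (C ^ (n + 1)) x = C ((C ^ n) x) := by rw [pow_succ']; rfl
      have e2 : (C ^ (n + 2)) x = C (C ((C ^ n) x)) := by rw [pow_succ', pow_succ']; rfl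
      simp only [e1, e2]
      set y := (C ^ n) x
      have : q (C y) = (⟪y, B (C (C y))⟫_ℂ).re := by
        simp only [q]; rw [hsym]
      rw [this]
      exact re_inner_sq_le_of_nonneg hB _ _
    · intro n
      refine (hqb _).trans ?_
      have : ‖(C ^ n) x‖ ≤ ‖C‖ ^ n * ‖x‖ := by
        refine ((C ^ n).le_opNorm x).trans ?_
        gcongr
        rcases n.eq_zero_or_pos with h | h
        · subst h
          rw [pow_zero, pow_zero]
          exact ContinuousLinearMap.norm_id_le
        · exact norm_pow_le' C h
      calc ‖B‖ * ‖(C ^ n) x‖ ^ 2 ≤ ‖B‖ * (‖C‖ ^ n * ‖x‖) ^ 2 := by gcongr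
        _ = ‖B‖ * ‖x‖ ^ 2 * (‖C‖ ^ 2) ^ n := by ring
  have h2 := re_inner_sq_le_of_nonneg hB x (C x)
  have h3 : (⟪x, B (C x)⟫_ℂ).re ^ 2 ≤ (‖C‖ * q x) ^ 2 := by
    refine h2.trans ?_
    calc q x * q (C x) ≤ q x * (‖C‖ ^ 2 * q x) := mul_le_mul_of_nonneg_left h1 (hq x)
      _ = (‖C‖ * q x) ^ 2 := by ring
  exact (le_abs_self _).trans (abs_le_of_sq_le_sq' h3 (mul_nonneg (norm_nonneg _) (hq x)) |> fun h =>
    abs_le.2 h)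

/-- Half-way interpolation: an operator preserving `ran B` preserves `ran B^(1/2)`. -/
lemma exists_half_factor {B X Y : H →L[ℂ] H} (hB : 0 ≤ B) (h : X * B = B * Y) :
    ∃ X₁ : H →L[ℂ] H, X * B ^ (1 / 2 : ℝ) = B ^ (1 / 2 : ℝ) * X₁ := by
  have hK := rpow_isSelfAdjoint B (1 / 2)
  have hsB : IsSelfAdjoint B := IsSelfAdjoint.of_nonneg hB
  -- `Y X*` is symmetric for the form of `B`, so Reid's inequality bounds `‖B^(1/2) X* x‖`.
  have e : B * (Y * star X) = X * B * star X := by rw [h, mul_assoc]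
  have hsa : IsSelfAdjoint (B * (Y * star X)) := by
    rw [e]; exact hsB.conjugate X
  have hK2 : ∀ x : H, ‖(B ^ (1 / 2 : ℝ)) x‖ ^ 2 = (⟪x, B x⟫_ℂ).re := by
    intro x
    rw [norm_sq_rpow (by norm_num)]
    norm_num
    rw [CFC.rpow_one B hB]
  have hn : ∀ x, ‖(B ^ (1 / 2 : ℝ) * star X) x‖ ≤ √‖Y * star X‖ * ‖(B ^ (1 / 2 : ℝ)) x‖ := by
    intro x
    refine le_of_sq_le_sq ?_ (by positivity)
    rw [mul_pow, Real.sq_sqrt (norm_nonneg _), hK2]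
    refine le_trans (le_of_eq ?_) (reid_inequality hB hsa x)
    rw [mul_apply_eq_comp, hK2, ContinuousLinearMap.star_eq_adjoint,
      ContinuousLinearMap.adjoint_inner_left, ← ContinuousLinearMap.star_eq_adjoint]
    have := DFunLike.congr_fun e x
    simp only [mul_apply_eq_comp] at this ⊢
    rw [this]
  obtain ⟨W, hW⟩ := exists_factor_of_norm_le hn
  refine ⟨star W, ?_⟩
  have := congrArg star hW
  rwa [star_mul, star_star, star_mul, hK.star_eq] at this

/-- Uniqueness for the Sylvester equation `C K + K C = 0`: `C` commutes with `K²`, hence with `K`. -/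
lemma eq_zero_of_anticommute {K C : H →L[ℂ] H} (hK : 0 ≤ K) (hi : Function.Injective K)
    (h : C * K + K * C = 0) : C = 0 := by
  have h1 : C * K = -(K * C) := eq_neg_of_add_eq_zero_left h
  have h2 : Commute (K * K) C := by
    rw [commute_iff_eq]
    calc K * K * C = K * (K * C) := mul_assoc _ _ _
      _ = -(K * (C * K)) := by rw [h1]; simp
      _ = C * (K * K) := by rw [← mul_assoc, ← neg_mul, ← h1, mul_assoc]
  have h3 : Commute K C := by
    have h4 : CFC.sqrt (K * K) = K := CFC.sqrt_mul_self K hK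
    rw [← h4, CFC.sqrt_eq_cfc]
    exact Commute.cfc_nnreal h2 _
  rw [h3.symm.eq] at h
  ext x
  apply hi
  have h5 := DFunLike.congr_fun h x
  simp only [add_apply, mul_apply_eq_comp, zero_apply] at h5
  rw [← two_smul ℂ, smul_eq_zero] at h5
  simpa using h5

lemma denseRange_of_selfAdjoint {B : H →L[ℂ] H} (hB : IsSelfAdjoint B)
    (hi : Function.Injective B) : DenseRange B := by
  have h := ContinuousLinearMap.orthogonal_range B
  rw [← ContinuousLinearMap.star_eq_adjoint, hB.star_eq] at h
  have hk : (B : H →ₗ[ℂ] H).ker = ⊥ := LinearMap.ker_eq_bot.2 hi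
  rw [hk, ← Submodule.topologicalClosure_eq_top_iff] at h
  exact (Submodule.dense_iff_topologicalClosure_eq_top).2 h

/-- The vectors in the range of all powers of an injective positive operator are dense: spectral
cut-offs of any vector near `0` lie in all these ranges. -/
lemma dense_iInter_range_pow {B : H →L[ℂ] H} (hB : 0 ≤ B) (hi : Function.Injective B) :
    Dense {x : H | ∀ n : ℕ, ∃ u, (B ^ n) u = x} := by
  have hsB : IsSelfAdjoint B := IsSelfAdjoint.of_nonneg hB
  have hspec : ∀ t ∈ spectrum ℝ B, 0 ≤ t := fun t ht => spectrum_nonneg_of_nonneg hB ht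
  -- `h k` vanishes on `[0, 1 / (k + 1)]` and equals `1` on `[2 / (k + 1), ∞)`
  let h : ℕ → ℝ → ℝ := fun k t => max 0 (min 1 (((k : ℝ) + 1) * t - 1))
  have hc : ∀ k, Continuous (h k) := fun k => by fun_prop
  have hrange : ∀ k u, cfc (h k) B u ∈ {x : H | ∀ n : ℕ, ∃ u, (B ^ n) u = x} := by
    intro k u n
    let g : ℝ → ℝ := fun t => h k t / (max t (1 / ((k : ℝ) + 1))) ^ n
    have hk : (0 : ℝ) < 1 / ((k : ℝ) + 1) := by positivity
    have hg : Continuous g := by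
      refine (hc k).div (by fun_prop) fun t => ?_
      exact pow_ne_zero _ (lt_max_of_lt_right hk).ne'
    refine ⟨cfc g B u, ?_⟩
    rw [← mul_apply_eq_comp]
    congr 1
    conv_lhs => rw [← cfc_pow_id (R := ℝ) B n]
    rw [← cfc_mul _ _ B (by fun_prop) hg.continuousOn]
    refine cfc_congr fun t ht => ?_
    simp only [g]
    rcases le_or_gt t (1 / ((k : ℝ) + 1)) with h1 | h1
    · have : h k t = 0 := by
        simp only [h]
        rw [max_eq_left]
        refine (min_le_right _ _).trans ?_
        rw [le_div_iff₀ (by positivity)] at h1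
        linarith
      rw [this]; simp
    · rw [max_eq_left h1.le]
      have : t ^ n ≠ 0 := pow_ne_zero _ (hk.trans h1).ne'
      field_simp
  have hbound : ∀ k, ‖B - cfc (h k) B * B‖ ≤ 2 / ((k : ℝ) + 1) := by
    intro k
    have e : B - cfc (h k) B * B = cfc (fun t => t - h k t * t) B := by
      rw [cfc_sub (fun t => t) (fun t => h k t * t) B (by fun_prop)
        ((hc k).mul continuous_id).continuousOn, cfc_mul (h k) (fun t => t) B
        (hc k).continuousOn (by fun_prop), cfc_id' ℝ B]
    rw [e]
    refine norm_cfc_le (by positivity) fun t ht => ?_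
    have ht0 := hspec t ht
    have h0 : 0 ≤ h k t := le_max_left _ _
    have h1 : h k t ≤ 1 := max_le zero_le_one (min_le_left _ _)
    rw [Real.norm_eq_abs, abs_of_nonneg (by nlinarith)]
    rcases le_or_gt t (2 / ((k : ℝ) + 1)) with h2 | h2
    · nlinarith
    · have : h k t = 1 := by
        simp only [h]
        rw [min_eq_left, max_eq_right zero_le_one]
        rw [div_lt_iff₀ (by positivity)] at h2
        linarith
      rw [this]
      simp only [one_mul, sub_self]
      positivity
  have hd : DenseRange B := denseRange_of_selfAdjoint hsB hi
  rw [← dense_closure]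
  refine hd.mono ?_
  rintro _ ⟨u, rfl⟩
  refine mem_closure_of_tendsto (f := fun k : ℕ => cfc (h k) B (B u)) (b := Filter.atTop) ?_
    (Filter.Eventually.of_forall fun k => hrange k _)
  rw [tendsto_iff_norm_sub_tendsto_zero]
  refine squeeze_zero (fun k => norm_nonneg _) (g := fun k : ℕ => 2 / ((k : ℝ) + 1) * ‖u‖) ?_ ?_
  · intro k
    rw [norm_sub_rev]
    refine le_trans ?_ (mul_le_mul_of_nonneg_right (hbound k) (norm_nonneg u))
    exact (B - cfc (h k) B * B).le_opNorm u
  · have := (tendsto_one_div_add_atTop_nhds_zero_nat (𝕜 := ℝ)).const_mul (2 * ‖u‖)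
    rw [mul_zero] at this
    refine this.congr fun k => ?_
    ring

end BoundedOperators

noncomputable section HilbertSchmidt

variable {H : Type*} [NormedAddCommGroup H] [InnerProductSpace ℂ H] [CompleteSpace H]

/-! ### Hilbert–Schmidt and trace class operators -/

/-- The square of the Hilbert–Schmidt norm, in `[0, ∞]`, computed in the orthonormal basis used for
the trace. -/
def hsSq (T : H →L[ℂ] H) : ℝ≥0∞ := ∑' e : onb H, ENNReal.ofReal (‖T (e : H)‖ ^ 2)

lemma posTrace_star_mul_self (T : H →L[ℂ] H) : posTrace (star T * T) = hsSq T := by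
  unfold posTrace hsSq
  refine tsum_congr fun e => ?_
  rw [norm_sq_eq_inner_star_mul]

/-- Parseval's identity for the orthonormal basis used for the trace. -/
lemma parseval_onb (x : H) :
    ENNReal.ofReal (‖x‖ ^ 2) = ∑' e : onb H, ENNReal.ofReal (‖⟪(e : H), x⟫_ℂ‖ ^ 2) := by
  obtain ⟨b, hb⟩ := (exists_hilbertBasis ℂ H).choose_spec
  have h := b.hasSum_inner_mul_inner x x
  have h1 : HasSum (fun i => ‖⟪b i, x⟫_ℂ‖ ^ 2) (‖x‖ ^ 2) := by
    have h2 := (Complex.hasSum_re h)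
    have e1 : (⟪x, x⟫_ℂ).re = ‖x‖ ^ 2 := inner_self_eq_norm_sq (𝕜 := ℂ) x
    rw [e1] at h2
    refine h2.congr_fun fun i => ?_
    rw [← inner_conj_symm x (b i), ← Complex.normSq_eq_conj_mul_self, Complex.ofReal_re,
      Complex.normSq_eq_norm_sq]
  rw [← h1.tsum_eq, ENNReal.ofReal_tsum_of_nonneg (fun i => by positivity) h1.summable]
  refine tsum_congr fun e => ?_
  rw [hb]

lemma hsSq_star (T : H →L[ℂ] H) : hsSq (star T) = hsSq T := by
  unfold hsSq
  simp_rw [parseval_onb (star T _), parseval_onb (T _)]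
  rw [ENNReal.tsum_comm]
  refine tsum_congr fun e => tsum_congr fun f => ?_
  rw [ContinuousLinearMap.star_eq_adjoint, ContinuousLinearMap.adjoint_inner_right,
    norm_inner_symm]

lemma hsSq_mul_left_le (X T : H →L[ℂ] H) :
    hsSq (X * T) ≤ ENNReal.ofReal (‖X‖ ^ 2) * hsSq T := by
  unfold hsSq
  rw [← ENNReal.tsum_mul_left]
  refine ENNReal.tsum_le_tsum fun e => ?_
  rw [← ENNReal.ofReal_mul (by positivity), ← mul_pow]
  exact ENNReal.ofReal_le_ofReal (pow_le_pow_left₀ (norm_nonneg _) (X.le_opNorm _) 2)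

lemma hsSq_mul_right_le (T X : H →L[ℂ] H) :
    hsSq (T * X) ≤ ENNReal.ofReal (‖X‖ ^ 2) * hsSq T := by
  rw [← hsSq_star (T * X), star_mul, ← hsSq_star T, ← norm_star X]
  exact hsSq_mul_left_le _ _

lemma norm_abs_apply (T : H →L[ℂ] H) (x : H) : ‖CFC.abs T x‖ = ‖T x‖ := by
  have h : ‖CFC.abs T x‖ ^ 2 = ‖T x‖ ^ 2 := by
    rw [norm_sq_eq_inner_star_mul, norm_sq_eq_inner_star_mul,
      (IsSelfAdjoint.of_nonneg (CFC.abs_nonneg T)).star_eq, CFC.abs_mul_abs]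
  exact (pow_left_inj₀ (norm_nonneg _) (norm_nonneg _) two_ne_zero).1 h

/-- Trace class operators form a right ideal. The factors of the polar decompositions are provided
by Douglas' lemma, and `|T Y|` is a product of two Hilbert–Schmidt operators. -/
lemma IsTraceClass.mul_right {T : H →L[ℂ] H} (hT : IsTraceClass T) (Y : H →L[ℂ] H) :
    IsTraceClass (T * Y) := by
  have hP : 0 ≤ CFC.abs T := CFC.abs_nonneg T
  set S := CFC.sqrt (CFC.abs T) with hS
  have hSs : IsSelfAdjoint S := IsSelfAdjoint.of_nonneg (CFC.sqrt_nonneg _)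
  have hSS : S * S = CFC.abs T := CFC.sqrt_mul_sqrt_self _ hP
  have hfin : hsSq S ≠ ∞ := by
    rw [← posTrace_star_mul_self, hSs.star_eq, hSS]; exact hT
  obtain ⟨W, hW⟩ := exists_factor_of_norm_le (A := T) (C := CFC.abs T) (c := 1)
    (fun x => by rw [norm_abs_apply, one_mul])
  obtain ⟨V, hV⟩ := exists_factor_of_norm_le (A := CFC.abs (T * Y)) (C := T * Y) (c := 1)
    (fun x => by rw [norm_abs_apply, one_mul])
  have e : CFC.abs (T * Y) = star (star (V * W * S)) * (S * Y) := by
    rw [hV, star_star]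
    conv_lhs => rw [hW, ← hSS]
    simp only [mul_assoc]
  have h1 : hsSq (star (V * W * S)) ≠ ∞ := by
    rw [hsSq_star]
    exact ne_top_of_le_ne_top (ENNReal.mul_ne_top ENNReal.ofReal_ne_top hfin)
      (hsSq_mul_left_le _ _)
  have h2 : hsSq (S * Y) ≠ ∞ :=
    ne_top_of_le_ne_top (ENNReal.mul_ne_top ENNReal.ofReal_ne_top hfin) (hsSq_mul_right_le _ _)
  unfold IsTraceClass
  rw [e]
  refine ne_top_of_le_ne_top (ENNReal.add_ne_top.2 ⟨h1, h2⟩) ?_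
  unfold posTrace hsSq
  rw [← ENNReal.tsum_add]
  refine ENNReal.tsum_le_tsum fun f => ?_
  rw [← ENNReal.ofReal_add (by positivity) (by positivity)]
  refine ENNReal.ofReal_le_ofReal ?_
  rw [mul_apply_eq_comp, ContinuousLinearMap.star_eq_adjoint (star (V * W * S)),
    ContinuousLinearMap.adjoint_inner_right]
  set a := (star (V * W * S)) (f : H)
  set b := (S * Y) (f : H)
  have h3 : (⟪a, b⟫_ℂ).re ≤ ‖a‖ * ‖b‖ := (Complex.re_le_norm _).trans (norm_inner_le_norm _ _)
  nlinarith [sq_nonneg (‖a‖ - ‖b‖), norm_nonneg a, norm_nonneg b]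

/-! ### The spaces `B₂(N, p)` and `B₁(N, p)` -/

lemma negPow_isSelfAdjoint (N : H →ₗ.[ℂ] H) (r : ℝ) : IsSelfAdjoint (negPow N r) :=
  rpow_isSelfAdjoint _ _

lemma weight_star_mul_self (N : H →ₗ.[ℂ] H) (s : ℝ) (T : H →L[ℂ] H) :
    weight N s (star T * T) = hsSq (T * negPow N (s / 2)) := by
  rw [← posTrace_star_mul_self, weight, star_mul, (negPow_isSelfAdjoint N _).star_eq]
  simp only [mul_assoc]

lemma weight_mul_star_self (N : H →ₗ.[ℂ] H) (s : ℝ) (T : H →L[ℂ] H) :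
    weight N s (T * star T) = hsSq (star T * negPow N (s / 2)) := by
  simpa using weight_star_mul_self N s (star T)

lemma mem_B2_iff {N : H →ₗ.[ℂ] H} {p : ℝ} {T : H →L[ℂ] H} :
    T ∈ B2 N p ↔ ∀ s, p < s → hsSq (T * negPow N (s / 2)) ≠ ∞ ∧
      hsSq (star T * negPow N (s / 2)) ≠ ∞ := by
  simp only [B2, Set.mem_ofPred_eq, weight_star_mul_self, weight_mul_star_self]

lemma Qnorm_eq (N : H →ₗ.[ℂ] H) (p : ℝ) (n : ℕ) (T : H →L[ℂ] H) :
    Qnorm N p n T = Real.sqrt (‖T‖ ^ 2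
      + (hsSq (T * negPow N ((p + 1 / ((n : ℝ) + 1)) / 2))).toReal
      + (hsSq (star T * negPow N ((p + 1 / ((n : ℝ) + 1)) / 2))).toReal) := by
  rw [Qnorm, weight_star_mul_self, weight_mul_star_self]

lemma Qnorm_nonneg (N : H →ₗ.[ℂ] H) (p : ℝ) (n : ℕ) (T : H →L[ℂ] H) : 0 ≤ Qnorm N p n T :=
  Real.sqrt_nonneg _

lemma Qnorm_neg (N : H →ₗ.[ℂ] H) (p : ℝ) (n : ℕ) (T : H →L[ℂ] H) :
    Qnorm N p n (-T) = Qnorm N p n T := by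
  simp [Qnorm]

lemma neg_mem_B2 {N : H →ₗ.[ℂ] H} {p : ℝ} {T : H →L[ℂ] H} (h : T ∈ B2 N p) : -T ∈ B2 N p := by
  simpa [B2] using h

/-- `f` maps `B₂(N, p)` to `B₂(N', p)`, with factor `C n` for the norm `Q_n`. -/
def B2Bound (N N' : H →ₗ.[ℂ] H) (p : ℝ) (C : ℕ → ℝ) (f : (H →L[ℂ] H) → (H →L[ℂ] H)) : Prop :=
  ∀ a ∈ B2 N p, f a ∈ B2 N' p ∧ ∀ n, Qnorm N' p n (f a) ≤ C n * Qnorm N p n a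

/-- A criterion for `B2Bound`, in terms of Hilbert–Schmidt norms. -/
lemma B2Bound.of_hsSq {N N' : H →ₗ.[ℂ] H} {p : ℝ} {f : (H →L[ℂ] H) → (H →L[ℂ] H)} {c₀ : ℝ}
    {c : ℝ → ℝ} {C : ℕ → ℝ} (hc₀ : 0 ≤ c₀) (hc : ∀ s, 0 ≤ c s)
    (hC : ∀ n, c₀ ≤ C n ∧ c (p + 1 / ((n : ℝ) + 1)) ≤ C n)
    (h₀ : ∀ a, ‖f a‖ ≤ c₀ * ‖a‖)
    (h₁ : ∀ s, p < s → ∀ a, hsSq (f a * negPow N' (s / 2)) ≤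
      ENNReal.ofReal (c s ^ 2) * hsSq (a * negPow N (s / 2)))
    (h₂ : ∀ s, p < s → ∀ a, hsSq (star (f a) * negPow N' (s / 2)) ≤
      ENNReal.ofReal (c s ^ 2) * hsSq (star a * negPow N (s / 2))) :
    B2Bound N N' p C f := by
  intro a ha
  rw [mem_B2_iff] at ha
  refine ⟨mem_B2_iff.2 fun s hs => ⟨?_, ?_⟩, fun n => ?_⟩
  · exact ne_top_of_le_ne_top (ENNReal.mul_ne_top ENNReal.ofReal_ne_top (ha s hs).1) (h₁ s hs a)
  · exact ne_top_of_le_ne_top (ENNReal.mul_ne_top ENNReal.ofReal_ne_top (ha s hs).2) (h₂ s hs a)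
  · have hs : p < p + 1 / ((n : ℝ) + 1) := by
      have : (0 : ℝ) < 1 / ((n : ℝ) + 1) := by positivity
      linarith
    rw [Qnorm_eq, Qnorm_eq]
    set s := p + 1 / ((n : ℝ) + 1)
    have hC0 : 0 ≤ C n := hc₀.trans (hC n).1
    rw [Real.sqrt_le_left (by positivity), mul_pow, Real.sq_sqrt (by positivity), mul_add, mul_add]
    have hcC : c s ^ 2 ≤ C n ^ 2 := pow_le_pow_left₀ (hc s) (hC n).2 2
    have key : ∀ x y : ℝ≥0∞, y ≠ ∞ → x ≤ ENNReal.ofReal (c s ^ 2) * y →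
        x.toReal ≤ C n ^ 2 * y.toReal := by
      intro x y hy hxy
      have := ENNReal.toReal_mono (ENNReal.mul_ne_top ENNReal.ofReal_ne_top hy) hxy
      rw [ENNReal.toReal_mul, ENNReal.toReal_ofReal (sq_nonneg _)] at this
      exact this.trans (mul_le_mul_of_nonneg_right hcC ENNReal.toReal_nonneg)
    refine add_le_add (add_le_add ?_ ?_) ?_
    · rw [← mul_pow]
      exact pow_le_pow_left₀ (norm_nonneg _) ((h₀ a).trans
        (mul_le_mul_of_nonneg_right (hC n).1 (norm_nonneg _))) 2
    · exact key _ _ (ha s hs).1 (h₁ s hs a)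
    · exact key _ _ (ha s hs).2 (h₂ s hs a)

/-- Finite representations `T = ∑ aᵢ bᵢ` with factors in `B₂(N, p)`. -/
def IsRep (N : H →ₗ.[ℂ] H) (p : ℝ) (T : H →L[ℂ] H) {k : ℕ} (a b : Fin k → (H →L[ℂ] H)) : Prop :=
  (∀ i, a i ∈ B2 N p ∧ b i ∈ B2 N p) ∧ T = ∑ i, a i * b i

lemma Pnorm_le_of_isRep {N : H →ₗ.[ℂ] H} {p : ℝ} {T : H →L[ℂ] H} {k : ℕ}
    {a b : Fin k → (H →L[ℂ] H)} (h : IsRep N p T a b) (n : ℕ) :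
    Pnorm N p n T ≤ ∑ i, Qnorm N p n (a i) * Qnorm N p n (b i) := by
  refine csInf_le ⟨0, ?_⟩ ⟨k, a, b, h.1, h.2, rfl⟩
  rintro r ⟨k, a, b, -, -, rfl⟩
  exact Finset.sum_nonneg fun i _ => mul_nonneg (Qnorm_nonneg _ _ _ _) (Qnorm_nonneg _ _ _ _)

lemma Pnorm_nonneg (N : H →ₗ.[ℂ] H) (p : ℝ) (n : ℕ) (T : H →L[ℂ] H) : 0 ≤ Pnorm N p n T := by
  refine Real.sInf_nonneg ?_
  rintro r ⟨k, a, b, -, -, rfl⟩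
  exact Finset.sum_nonneg fun i _ => mul_nonneg (Qnorm_nonneg _ _ _ _) (Qnorm_nonneg _ _ _ _)

lemma smul_mem_B2 {N : H →ₗ.[ℂ] H} {p : ℝ} {T : H →L[ℂ] H} (h : T ∈ B2 N p) (z : ℂ) :
    z • T ∈ B2 N p := by
  rw [mem_B2_iff] at h ⊢
  intro s hs
  have key : ∀ (w : ℂ) (X : H →L[ℂ] H), hsSq X ≠ ∞ → hsSq (w • X) ≠ ∞ := by
    intro w X hX
    have := hsSq_mul_left_le (w • (1 : H →L[ℂ] H)) X
    rw [smul_mul_assoc, one_mul] at this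
    exact ne_top_of_le_ne_top (ENNReal.mul_ne_top ENNReal.ofReal_ne_top hX) this
  rw [star_smul, smul_mul_assoc, smul_mul_assoc]
  exact ⟨key _ _ (h s hs).1, key _ _ (h s hs).2⟩

lemma isRep_append {N : H →ₗ.[ℂ] H} {p : ℝ} {S T : H →L[ℂ] H} {k l : ℕ}
    {a b : Fin k → (H →L[ℂ] H)} {c d : Fin l → (H →L[ℂ] H)} (h : IsRep N p S a b)
    (h' : IsRep N p T c d) : IsRep N p (S + T) (Fin.append a c) (Fin.append b d) := by
  refine ⟨fun i => ?_, ?_⟩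
  · refine Fin.addCases (fun i => ?_) (fun i => ?_) i
    · simpa using h.1 i
    · simpa using h'.1 i
  · rw [Fin.sum_univ_add]
    simp [h.2, h'.2]

lemma exists_isRep_of_mem {N : H →ₗ.[ℂ] H} {p : ℝ} {T : H →L[ℂ] H} (h : T ∈ B2sq N p) :
    ∃ (k : ℕ) (a b : Fin k → (H →L[ℂ] H)), IsRep N p T a b := by
  induction h using Submodule.span_induction with
  | mem x hx =>
    obtain ⟨a, ha, b, hb, rfl⟩ := hx
    exact ⟨1, fun _ => a, fun _ => b, fun _ => ⟨ha, hb⟩, by simp⟩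
  | zero => exact ⟨0, Fin.elim0, Fin.elim0, fun i => i.elim0, by simp⟩
  | add x y _ _ hx hy =>
    obtain ⟨k, a, b, h⟩ := hx
    obtain ⟨l, c, d, h'⟩ := hy
    exact ⟨_, _, _, isRep_append h h'⟩
  | smul z x _ hx =>
    obtain ⟨k, a, b, h⟩ := hx
    refine ⟨k, fun i => z • a i, b, fun i => ⟨smul_mem_B2 (h.1 i).1 z, (h.1 i).2⟩, ?_⟩
    rw [h.2, Finset.smul_sum]
    simp only [smul_mul_assoc]

lemma mem_B2sq_of_isRep {N : H →ₗ.[ℂ] H} {p : ℝ} {T : H →L[ℂ] H} {k : ℕ}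
    {a b : Fin k → (H →L[ℂ] H)} (h : IsRep N p T a b) : T ∈ B2sq N p := by
  rw [h.2]
  exact Submodule.sum_mem _ fun i _ => Submodule.subset_span ⟨_, (h.1 i).1, _, (h.1 i).2, rfl⟩

lemma exists_isRep_lt {N : H →ₗ.[ℂ] H} {p : ℝ} {T : H →L[ℂ] H} (h : T ∈ B2sq N p) (n : ℕ) {ε : ℝ}
    (hε : 0 < ε) : ∃ (k : ℕ) (a b : Fin k → (H →L[ℂ] H)), IsRep N p T a b ∧
      ∑ i, Qnorm N p n (a i) * Qnorm N p n (b i) < Pnorm N p n T + ε := by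
  obtain ⟨k, a, b, hr⟩ := exists_isRep_of_mem h
  obtain ⟨r, ⟨k, a, b, h1, h2, rfl⟩, hlt⟩ := Real.lt_sInf_add_pos
    (s := {r | ∃ (k : ℕ) (a b : Fin k → (H →L[ℂ] H)), (∀ i, a i ∈ B2 N p ∧ b i ∈ B2 N p) ∧
      T = ∑ i, a i * b i ∧ r = ∑ i, Qnorm N p n (a i) * Qnorm N p n (b i)})
    ⟨_, k, a, b, hr.1, hr.2, rfl⟩ hε
  exact ⟨k, a, b, ⟨h1, h2⟩, hlt⟩

lemma Pnorm_zero (N : H →ₗ.[ℂ] H) (p : ℝ) (n : ℕ) : Pnorm N p n 0 = 0 := by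
  refine le_antisymm ?_ (Pnorm_nonneg _ _ _ _)
  have : IsRep N p 0 (Fin.elim0 : Fin 0 → (H →L[ℂ] H)) Fin.elim0 := ⟨fun i => i.elim0, by simp⟩
  simpa using Pnorm_le_of_isRep this n

lemma Pnorm_add_le {N : H →ₗ.[ℂ] H} {p : ℝ} {S T : H →L[ℂ] H} (hS : S ∈ B2sq N p)
    (hT : T ∈ B2sq N p) (n : ℕ) : Pnorm N p n (S + T) ≤ Pnorm N p n S + Pnorm N p n T := by
  refine le_of_forall_pos_le_add fun ε hε => ?_
  obtain ⟨k, a, b, h, h1⟩ := exists_isRep_lt hS n (half_pos hε)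
  obtain ⟨l, c, d, h', h2⟩ := exists_isRep_lt hT n (half_pos hε)
  have := Pnorm_le_of_isRep (isRep_append h h') n
  rw [Fin.sum_univ_add] at this
  simp only [Fin.append_left, Fin.append_right] at this
  linarith

lemma Pnorm_sum_le {N : H →ₗ.[ℂ] H} {p : ℝ} {ι : Type*} (s : Finset ι) {f : ι → (H →L[ℂ] H)}
    (hf : ∀ i, f i ∈ B2sq N p) (n : ℕ) :
    Pnorm N p n (∑ i ∈ s, f i) ≤ ∑ i ∈ s, Pnorm N p n (f i) := by
  classical
  induction s using Finset.induction_on with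
  | empty => simp [Pnorm_zero]
  | insert i s hi ih =>
    rw [Finset.sum_insert hi, Finset.sum_insert hi]
    exact (Pnorm_add_le (hf i) (Submodule.sum_mem _ fun j _ => hf j) n).trans
      (add_le_add le_rfl ih)

lemma Pnorm_neg_le {N : H →ₗ.[ℂ] H} {p : ℝ} {T : H →L[ℂ] H} (hT : T ∈ B2sq N p) (n : ℕ) :
    Pnorm N p n (-T) ≤ Pnorm N p n T := by
  refine le_of_forall_pos_le_add fun ε hε => ?_
  obtain ⟨k, a, b, h, h1⟩ := exists_isRep_lt hT n hε
  have hr : IsRep N p (-T) (fun i => -a i) b :=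
    ⟨fun i => ⟨neg_mem_B2 (h.1 i).1, (h.1 i).2⟩, by rw [h.2]; simp⟩
  have := Pnorm_le_of_isRep hr n
  simp only [Qnorm_neg] at this
  linarith

/-- Two-sided multiplications that are bounded for the norms `Q_n` are bounded for `P_n`. -/
lemma Pnorm_mul_mul_le {N N' : H →ₗ.[ℂ] H} {p : ℝ} {C C' : ℕ → ℝ} {F G : H →L[ℂ] H}
    (hC : ∀ n, 0 ≤ C n) (hC' : ∀ n, 0 ≤ C' n)
    (hF : B2Bound N N' p C (fun a => F * a)) (hG : B2Bound N N' p C' (fun b => b * G))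
    {T : H →L[ℂ] H} (hT : T ∈ B2sq N p) :
    F * T * G ∈ B2sq N' p ∧ ∀ n, Pnorm N' p n (F * T * G) ≤ C n * C' n * Pnorm N p n T := by
  have rep : ∀ {k : ℕ} {a b : Fin k → (H →L[ℂ] H)}, IsRep N p T a b →
      IsRep N' p (F * T * G) (fun i => F * a i) (fun i => b i * G) := by
    intro k a b h
    refine ⟨fun i => ⟨(hF _ (h.1 i).1).1, (hG _ (h.1 i).2).1⟩, ?_⟩
    rw [h.2, Finset.mul_sum, Finset.sum_mul]
    simp only [mul_assoc]
  constructor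
  · obtain ⟨k, a, b, h⟩ := exists_isRep_of_mem hT
    exact mem_B2sq_of_isRep (rep h)
  · intro n
    have hCC : 0 ≤ C n * C' n := mul_nonneg (hC n) (hC' n)
    refine le_of_forall_pos_le_add fun ε hε => ?_
    obtain ⟨k, a, b, h, h1⟩ := exists_isRep_lt hT n
      (ε := ε / (C n * C' n + 1)) (by positivity)
    refine (Pnorm_le_of_isRep (rep h) n).trans ?_
    calc ∑ i, Qnorm N' p n (F * a i) * Qnorm N' p n (b i * G)
        ≤ ∑ i, (C n * C' n) * (Qnorm N p n (a i) * Qnorm N p n (b i)) := by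
          refine Finset.sum_le_sum fun i _ => ?_
          calc _ ≤ (C n * Qnorm N p n (a i)) * (C' n * Qnorm N p n (b i)) :=
                mul_le_mul ((hF _ (h.1 i).1).2 n) ((hG _ (h.1 i).2).2 n) (Qnorm_nonneg _ _ _ _)
                  (mul_nonneg (hC n) (Qnorm_nonneg _ _ _ _))
            _ = _ := by ring
      _ = (C n * C' n) * ∑ i, Qnorm N p n (a i) * Qnorm N p n (b i) := by rw [Finset.mul_sum]
      _ ≤ (C n * C' n) * (Pnorm N p n T + ε / (C n * C' n + 1)) :=
          mul_le_mul_of_nonneg_left h1.le hCC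
      _ ≤ C n * C' n * Pnorm N p n T + ε := by
          rw [mul_add]
          refine add_le_add le_rfl ?_
          rw [mul_div_assoc', div_le_iff₀ (by positivity)]
          nlinarith

lemma B1_add {N : H →ₗ.[ℂ] H} {p : ℝ} {S T : H →L[ℂ] H} (hS : S ∈ B1 N p) (hT : T ∈ B1 N p) :
    S + T ∈ B1 N p := by
  obtain ⟨u, hu, hu', hul⟩ := hS
  obtain ⟨v, hv, hv', hvl⟩ := hT
  refine ⟨fun j => u j + v j, fun j => add_mem (hu j) (hv j), fun n ε hε => ?_, hul.add hvl⟩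
  obtain ⟨m, hm⟩ := hu' n (ε / 2) (half_pos hε)
  obtain ⟨m', hm'⟩ := hv' n (ε / 2) (half_pos hε)
  refine ⟨max m m', fun i hi j hj => ?_⟩
  have h1 := hm i ((le_max_left _ _).trans hi) j ((le_max_left _ _).trans hj)
  have h2 := hm' i ((le_max_right _ _).trans hi) j ((le_max_right _ _).trans hj)
  have h3 := Pnorm_add_le (sub_mem (hu i) (hu j)) (sub_mem (hv i) (hv j)) n
  have e : u i + v i - (u j + v j) = u i - u j + (v i - v j) := by abel
  rw [e]
  linarith

/-- Series of two-sided multiplications, with summable bounds for the norms `Q_n`, map `B₁(N, p)` to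
`B₁(N', p)`. -/
lemma B1_tsum_mul_mul {N N' : H →ₗ.[ℂ] H} {p : ℝ} {C C' : ℕ → ℕ → ℝ} {F G : ℕ → (H →L[ℂ] H)}
    (hC : ∀ k n, 0 ≤ C k n) (hC' : ∀ k n, 0 ≤ C' k n)
    (hF : ∀ k, B2Bound N N' p (C k) (fun a => F k * a))
    (hG : ∀ k, B2Bound N N' p (C' k) (fun b => b * G k))
    (hsum : ∀ n, Summable fun k => C k n * C' k n)
    (hnorm : Summable fun k => ‖F k‖ * ‖G k‖)
    {T : H →L[ℂ] H} (hT : T ∈ B1 N p) : ∑' k, F k * T * G k ∈ B1 N' p := by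
  obtain ⟨u, hu, hu', hul⟩ := hT
  have hmem : ∀ k {S : H →L[ℂ] H}, S ∈ B2sq N p → F k * S * G k ∈ B2sq N' p := fun k S hS =>
    (Pnorm_mul_mul_le (hC k) (hC' k) (hF k) (hG k) hS).1
  have hle : ∀ k n {S : H →L[ℂ] H}, S ∈ B2sq N p →
      Pnorm N' p n (F k * S * G k) ≤ C k n * C' k n * Pnorm N p n S := fun k n S hS =>
    (Pnorm_mul_mul_le (hC k) (hC' k) (hF k) (hG k) hS).2 n
  have hsm : ∀ S : H →L[ℂ] H, Summable fun k => F k * S * G k := by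
    intro S
    refine Summable.of_norm_bounded (g := fun k => ‖F k‖ * ‖G k‖ * ‖S‖) (hnorm.mul_right _) ?_
    intro k
    calc ‖F k * S * G k‖ ≤ ‖F k‖ * ‖S‖ * ‖G k‖ :=
          (norm_mul_le _ _).trans (mul_le_mul_of_nonneg_right (norm_mul_le _ _) (norm_nonneg _))
      _ = _ := by ring
  -- the approximating sequence cuts off the series applied to `u j` at `j`
  refine ⟨fun j => ∑ k ∈ Finset.range j, F k * u j * G k,
    fun j => Submodule.sum_mem _ fun k _ => hmem k (hu j), ?_, ?_⟩
  · intro n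
    -- the norms `P_n (u i)` are bounded
    obtain ⟨m₀, hm₀⟩ := hu' n 1 one_pos
    set L := Pnorm N p n (u m₀) + 1 with hL
    have hL0 : 0 < L := by have := Pnorm_nonneg N p n (u m₀); linarith
    have hbd : ∀ i ≥ m₀, Pnorm N p n (u i) ≤ L := by
      intro i hi
      have h1 := Pnorm_add_le (hu m₀) (sub_mem (hu i) (hu m₀)) n
      rw [add_sub_cancel] at h1
      have h2 := hm₀ i hi m₀ le_rfl
      linarith
    set D := ∑' k, C k n * C' k n with hD
    have hnn : ∀ k, 0 ≤ C k n * C' k n := fun k => mul_nonneg (hC k n) (hC' k n)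
    have hD0 : 0 ≤ D := tsum_nonneg hnn
    -- the case of ordered indices
    have main : ∀ ε > 0, ∃ m, ∀ i ≥ m, ∀ j ≥ m, j ≤ i →
        Pnorm N' p n (∑ k ∈ Finset.range i, F k * u i * G k -
          ∑ k ∈ Finset.range j, F k * u j * G k) < ε := by
      intro ε hε
      obtain ⟨m₁, hm₁⟩ := hu' n (ε / (2 * (D + 1))) (by positivity)
      have htail := tendsto_sum_nat_add (fun k => C k n * C' k n)
      have hev : ∀ᶠ j in Filter.atTop, ∑' k, C (k + j) n * C' (k + j) n < ε / (2 * L) :=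
        htail.eventually_lt_const (by positivity)
      obtain ⟨m₂, hm₂⟩ := Filter.eventually_atTop.1 hev
      refine ⟨max m₀ (max m₁ m₂), fun i hi j hj hji => ?_⟩
      have hi0 : m₀ ≤ i := (le_max_left _ _).trans hi
      have hi1 : m₁ ≤ i := (le_max_left _ _).trans ((le_max_right _ _).trans hi)
      have hj1 : m₁ ≤ j := (le_max_left _ _).trans ((le_max_right _ _).trans hj)
      have hj2 : m₂ ≤ j := (le_max_right _ _).trans ((le_max_right _ _).trans hj)
      have e : ∑ k ∈ Finset.range i, F k * u i * G k - ∑ k ∈ Finset.range j, F k * u j * G k =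
          ∑ k ∈ Finset.range j, F k * (u i - u j) * G k
            + ∑ k ∈ Finset.range (i - j), F (j + k) * u i * G (j + k) := by
        obtain ⟨d, rfl⟩ := Nat.exists_eq_add_of_le hji
        rw [Finset.sum_range_add, Nat.add_sub_cancel_left]
        simp only [mul_sub, sub_mul, Finset.sum_sub_distrib]
        abel
      rw [e]
      have hd : u i - u j ∈ B2sq N p := sub_mem (hu i) (hu j)
      have p1 : Pnorm N' p n (∑ k ∈ Finset.range j, F k * (u i - u j) * G k) ≤
          D * Pnorm N p n (u i - u j) := by
        refine (Pnorm_sum_le _ (fun k => hmem k hd) n).trans ?_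
        refine (Finset.sum_le_sum fun k _ => hle k n hd).trans ?_
        rw [← Finset.sum_mul]
        exact mul_le_mul_of_nonneg_right ((hsum n).sum_le_tsum _ fun k _ => hnn k)
          (Pnorm_nonneg _ _ _ _)
      have p2 : Pnorm N' p n (∑ k ∈ Finset.range (i - j), F (j + k) * u i * G (j + k)) ≤
          (∑' k, C (k + j) n * C' (k + j) n) * L := by
        refine (Pnorm_sum_le _ (fun k => hmem _ (hu i)) n).trans ?_
        refine (Finset.sum_le_sum fun k _ => hle _ n (hu i)).trans ?_
        rw [← Finset.sum_mul]
        refine mul_le_mul ?_ (hbd i hi0) (Pnorm_nonneg _ _ _ _) (tsum_nonneg fun k => hnn _)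
        simp only [add_comm j]
        exact ((summable_nat_add_iff (f := fun k => C k n * C' k n) j).2 (hsum n)).sum_le_tsum _
          fun k _ => hnn _
      have q1 : D * Pnorm N p n (u i - u j) ≤ ε / 2 := by
        have h1 := (hm₁ i hi1 j hj1).le
        calc D * Pnorm N p n (u i - u j) ≤ (D + 1) * (ε / (2 * (D + 1))) :=
              mul_le_mul (by linarith) h1 (Pnorm_nonneg _ _ _ _) (by linarith)
          _ = ε / 2 := by field_simp
      have q2 : (∑' k, C (k + j) n * C' (k + j) n) * L < ε / 2 := by
        have := mul_lt_mul_of_pos_right (hm₂ j hj2) hL0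
        refine this.trans_le (le_of_eq ?_)
        field_simp
      refine (Pnorm_add_le (Submodule.sum_mem _ fun k _ => hmem k hd)
        (Submodule.sum_mem _ fun k _ => hmem _ (hu i)) n).trans_lt ?_
      linarith
    intro ε hε
    obtain ⟨m, hm⟩ := main ε hε
    refine ⟨m, fun i hi j hj => ?_⟩
    rcases le_total j i with h | h
    · exact hm i hi j hj h
    · rw [← neg_sub]
      refine (Pnorm_neg_le (sub_mem (Submodule.sum_mem _ fun k _ => hmem k (hu j))
        (Submodule.sum_mem _ fun k _ => hmem k (hu i))) n).trans_lt (hm j hj i hi h)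
  · -- convergence in norm
    have h1 : Filter.Tendsto (fun j => ∑ k ∈ Finset.range j, F k * T * G k) Filter.atTop
        (𝓝 (∑' k, F k * T * G k)) := (hsm T).hasSum.tendsto_sum_nat
    have h2 : Filter.Tendsto (fun j => ∑ k ∈ Finset.range j, F k * (u j - T) * G k) Filter.atTop
        (𝓝 0) := by
      refine squeeze_zero_norm (a := fun j => (∑' k, ‖F k‖ * ‖G k‖) * ‖u j - T‖) (fun j => ?_) ?_
      · refine (norm_sum_le _ _).trans ?_
        refine (Finset.sum_le_sum (g := fun k => ‖F k‖ * ‖G k‖ * ‖u j - T‖) fun k _ => ?_).trans ?_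
        · calc ‖F k * (u j - T) * G k‖ ≤ ‖F k‖ * ‖u j - T‖ * ‖G k‖ :=
                (norm_mul_le _ _).trans
                  (mul_le_mul_of_nonneg_right (norm_mul_le _ _) (norm_nonneg _))
            _ = _ := by ring
        · rw [← Finset.sum_mul]
          exact mul_le_mul_of_nonneg_right (hnorm.sum_le_tsum _ fun k _ => by positivity)
            (norm_nonneg _)
      · have := (tendsto_iff_norm_sub_tendsto_zero.1 hul).const_mul (∑' k, ‖F k‖ * ‖G k‖)
        rwa [mul_zero] at this
    have h3 := h1.add h2
    rw [add_zero] at h3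
    refine h3.congr fun j => ?_
    rw [← Finset.sum_add_distrib]
    refine Finset.sum_congr rfl fun k _ => ?_
    rw [mul_sub, sub_mul]
    abel

end HilbertSchmidt

noncomputable section Series

variable {H : Type*} [NormedAddCommGroup H] [InnerProductSpace ℂ H] [CompleteSpace H]

/-! ### The Sylvester equation of second order -/

/-- The left factors `K² (1 + K)⁻² ((1 - K) / (1 + K))^k` of the series `sylvesterSeries`. -/
def seriesLeft (K : H →L[ℂ] H) (k : ℕ) : H →L[ℂ] H :=
  cfc (fun t : ℝ => t ^ 2 / (1 + t) ^ 2 * ((1 - t) / (1 + t)) ^ k) K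

/-- The right factors `K (1 + K)⁻² ((1 - K) / (1 + K))^k` of the series `sylvesterSeries`. -/
def seriesRight (K : H →L[ℂ] H) (k : ℕ) : H →L[ℂ] H :=
  cfc (fun t : ℝ => t / (1 + t) ^ 2 * ((1 - t) / (1 + t)) ^ k) K

/-- The solution `X` of `K² X + 2 K X K + X K² = K² A K`. In terms of the Cayley transform
`U = (1 - K) / (1 + K)` the left-hand side is obtained by applying `X ↦ X - U X U` twice, up to
factors `1 + K`, so that it is inverted by the derivative of a geometric series. -/
def sylvesterSeries (K A : H →L[ℂ] H) : H →L[ℂ] H :=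
  ∑' k : ℕ, ((4 * ((k : ℝ) + 1)) • seriesLeft K k) * A * seriesRight K k

lemma spectrum_mem_Icc {K : H →L[ℂ] H} (hK : 0 ≤ K) (hK1 : K ≤ 1) {t : ℝ}
    (ht : t ∈ spectrum ℝ K) : 0 ≤ t ∧ t ≤ 1 :=
  ⟨spectrum_nonneg_of_nonneg hK ht, (CFC.le_one_iff K).1 hK1 t ht⟩

lemma one_add_quad_le_pow {t : ℝ} (ht : 0 ≤ t) (k : ℕ) :
    1 + k * t + (k * (k - 1) / 2) * t ^ 2 ≤ (1 + t) ^ k := by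
  induction k with
  | zero => simp
  | succ k ih =>
    have h := mul_le_mul_of_nonneg_right ih (by linarith : 0 ≤ 1 + t)
    rw [← pow_succ] at h
    refine le_trans ?_ h
    have h2 : 0 ≤ (k : ℝ) * (k - 1) / 2 * t ^ 3 := by
      rcases k.eq_zero_or_pos with h0 | h0
      · simp [h0]
      · have : (1 : ℝ) ≤ k := by exact_mod_cast h0
        have : (0 : ℝ) ≤ k - 1 := by linarith
        positivity
    push_cast
    nlinarith

lemma cayley_pow_le {t : ℝ} (h0 : 0 ≤ t) (h1 : t ≤ 1) (k : ℕ) :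
    ((1 - t) / (1 + t)) ^ k ≤ 1 / (1 + t) ^ k := by
  rw [div_pow]
  exact div_le_div_of_nonneg_right (pow_le_one₀ (by linarith) (by linarith)) (by positivity)

lemma cayley_nonneg {t : ℝ} (h0 : 0 ≤ t) (h1 : t ≤ 1) (k : ℕ) :
    0 ≤ ((1 - t) / (1 + t)) ^ k :=
  pow_nonneg (div_nonneg (by linarith) (by linarith)) k

lemma norm_seriesLeft_le {K : H →L[ℂ] H} (hK : 0 ≤ K) (hK1 : K ≤ 1) (k : ℕ) :
    ‖seriesLeft K k‖ ≤ 4 / ((k : ℝ) + 1) ^ 2 := by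
  refine norm_cfc_le (by positivity) fun t ht => ?_
  obtain ⟨h0, h1⟩ := spectrum_mem_Icc hK hK1 ht
  have hc := cayley_nonneg h0 h1 k
  have hp : 0 ≤ t ^ 2 / (1 + t) ^ 2 := by positivity
  rw [Real.norm_eq_abs, abs_of_nonneg (mul_nonneg hp hc)]
  have hle : t ^ 2 / (1 + t) ^ 2 ≤ t ^ 2 :=
    div_le_self (sq_nonneg t) (one_le_pow₀ (by linarith))
  refine (mul_le_mul hle (cayley_pow_le h0 h1 k) hc (sq_nonneg t)).trans ?_
  rw [mul_one_div, div_le_div_iff₀ (by positivity) (by positivity)]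
  have hq := one_add_quad_le_pow h0 k
  have hk : (0 : ℝ) ≤ k := k.cast_nonneg
  have ht2 : t ^ 2 ≤ 1 := pow_le_one₀ h0 h1
  have hkt : (k : ℝ) * t ^ 2 ≤ k * t := mul_le_mul_of_nonneg_left (by nlinarith) hk
  nlinarith [mul_nonneg (mul_nonneg hk hk) (sq_nonneg t)]

lemma norm_seriesRight_le {K : H →L[ℂ] H} (hK : 0 ≤ K) (hK1 : K ≤ 1) (k : ℕ) :
    ‖seriesRight K k‖ ≤ 1 / ((k : ℝ) + 1) := by
  refine norm_cfc_le (by positivity) fun t ht => ?_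
  obtain ⟨h0, h1⟩ := spectrum_mem_Icc hK hK1 ht
  have hc := cayley_nonneg h0 h1 k
  have hp : 0 ≤ t / (1 + t) ^ 2 := by positivity
  rw [Real.norm_eq_abs, abs_of_nonneg (mul_nonneg hp hc)]
  have hle : t / (1 + t) ^ 2 ≤ t := div_le_self h0 (one_le_pow₀ (by linarith))
  refine (mul_le_mul hle (cayley_pow_le h0 h1 k) hc h0).trans ?_
  rw [mul_one_div, div_le_div_iff₀ (by positivity) (by positivity)]
  have hq := one_add_mul_le_pow (by linarith : (-2 : ℝ) ≤ t) k
  nlinarith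

lemma one_add_eq_cfc {K : H →L[ℂ] H} (hK : IsSelfAdjoint K) :
    (1 + K : H →L[ℂ] H) = cfc (fun t : ℝ => 1 + t) K := by
  rw [cfc_add K (fun _ => (1 : ℝ)) (fun t => t) (by fun_prop) (by fun_prop),
    cfc_const_one ℝ K, cfc_id' ℝ K]

lemma anticommutator_injective {K : H →L[ℂ] H} (hK : 0 ≤ K) (hi : Function.Injective K)
    {X Y : H →L[ℂ] H} (h : K * X + X * K = K * Y + Y * K) : X = Y := by
  rw [← sub_eq_zero]
  refine eq_zero_of_anticommute hK hi ?_
  have : (X - Y) * K + K * (X - Y) = (K * X + X * K) - (K * Y + Y * K) := by noncomm_ring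
  rw [this, h, sub_self]

section Identities

variable {K : H →L[ℂ] H} (hK : 0 ≤ K) (hK1 : K ≤ 1)
include hK hK1

lemma continuousOn_spectrum_of_continuousOn_Icc {f : ℝ → ℝ} (hf : ContinuousOn f (Set.Icc 0 1)) :
    ContinuousOn f (spectrum ℝ K) :=
  hf.mono fun _ ht => spectrum_mem_Icc hK hK1 ht

/-- The Cayley transform `U = (1 - K) / (1 + K)` shifts the factors of the series. -/
lemma cayley_mul_series :
    ∃ U : H →L[ℂ] H, (1 + K) * U = 1 - K ∧ U * (1 + K) = 1 - K ∧
      (∀ k, U * seriesLeft K k = seriesLeft K (k + 1)) ∧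
      ∀ k, seriesRight K k * U = seriesRight K (k + 1) := by
  have hne : ∀ t ∈ Set.Icc (0 : ℝ) 1, 1 + t ≠ 0 := fun t ht => by linarith [ht.1]
  have cU : ContinuousOn (fun t : ℝ => (1 - t) / (1 + t)) (Set.Icc 0 1) :=
    ContinuousOn.div (by fun_prop) (by fun_prop) hne
  have hne2 : ∀ t ∈ Set.Icc (0 : ℝ) 1, (1 + t) ^ 2 ≠ 0 := fun t ht => pow_ne_zero _ (hne t ht)
  have cL : ∀ k : ℕ, ContinuousOn (fun t : ℝ => t ^ 2 / (1 + t) ^ 2 * ((1 - t) / (1 + t)) ^ k)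
      (Set.Icc 0 1) := fun k =>
    (ContinuousOn.div (by fun_prop) (by fun_prop) hne2).mul (cU.pow k)
  have cR : ∀ k : ℕ, ContinuousOn (fun t : ℝ => t / (1 + t) ^ 2 * ((1 - t) / (1 + t)) ^ k)
      (Set.Icc 0 1) := fun k =>
    (ContinuousOn.div (by fun_prop) (by fun_prop) hne2).mul (cU.pow k)
  have co := @continuousOn_spectrum_of_continuousOn_Icc H _ _ _ K hK hK1
  have e1 := one_add_eq_cfc (IsSelfAdjoint.of_nonneg hK)
  have e2 : (1 - K : H →L[ℂ] H) = cfc (fun t : ℝ => 1 - t) K := by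
    rw [cfc_sub (fun _ => (1 : ℝ)) (fun t => t) K (by fun_prop) (by fun_prop),
      cfc_const_one ℝ K, cfc_id' ℝ K]
  refine ⟨cfc (fun t : ℝ => (1 - t) / (1 + t)) K, ?_, ?_, fun k => ?_, fun k => ?_⟩
  · rw [e1, e2, ← cfc_mul _ _ K (by fun_prop) (co cU)]
    refine cfc_congr fun t ht => ?_
    have := hne t (spectrum_mem_Icc hK hK1 ht)
    field_simp
  · rw [e1, e2, ← cfc_mul _ _ K (co cU) (by fun_prop)]
    refine cfc_congr fun t ht => ?_
    have := hne t (spectrum_mem_Icc hK hK1 ht)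
    field_simp
  · rw [seriesLeft, seriesLeft, ← cfc_mul _ _ K (co cU) (co (cL k))]
    refine cfc_congr fun t _ => ?_
    ring
  · rw [seriesRight, seriesRight, ← cfc_mul _ _ K (co (cR k)) (co cU)]
    refine cfc_congr fun t _ => ?_
    ring

lemma one_add_sq_mul_seriesLeft : (1 + K) * ((1 + K) * seriesLeft K 0) = K * K := by
  have hne : ∀ t ∈ Set.Icc (0 : ℝ) 1, 1 + t ≠ 0 := fun t ht => by linarith [ht.1]
  have hne2 : ∀ t ∈ Set.Icc (0 : ℝ) 1, (1 + t) ^ 2 ≠ 0 := fun t ht => pow_ne_zero _ (hne t ht)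
  have co := @continuousOn_spectrum_of_continuousOn_Icc H _ _ _ K hK hK1
  have e1 := one_add_eq_cfc (IsSelfAdjoint.of_nonneg hK)
  have e2 : K * K = cfc (fun t : ℝ => t * t) K := by
    rw [cfc_mul (fun t => t) (fun t => t) K (by fun_prop) (by fun_prop), cfc_id' ℝ K]
  have c0 : ContinuousOn (fun t : ℝ => t ^ 2 / (1 + t) ^ 2 * ((1 - t) / (1 + t)) ^ 0)
      (Set.Icc 0 1) := by
    simp only [pow_zero, mul_one]
    exact ContinuousOn.div (by fun_prop) (by fun_prop) hne2
  have c1 : ContinuousOn (fun t : ℝ =>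
      (1 + t) * (t ^ 2 / (1 + t) ^ 2 * ((1 - t) / (1 + t)) ^ 0)) (Set.Icc 0 1) :=
    ContinuousOn.mul (by fun_prop) c0
  rw [seriesLeft, e1, ← cfc_mul _ _ K (by fun_prop) (co c0), ← cfc_mul _ _ K (by fun_prop) (co c1),
    e2]
  refine cfc_congr fun t ht => ?_
  have := hne t (spectrum_mem_Icc hK hK1 ht)
  field_simp

lemma seriesRight_mul_one_add_sq : seriesRight K 0 * (1 + K) * (1 + K) = K := by
  have hne : ∀ t ∈ Set.Icc (0 : ℝ) 1, 1 + t ≠ 0 := fun t ht => by linarith [ht.1]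
  have hne2 : ∀ t ∈ Set.Icc (0 : ℝ) 1, (1 + t) ^ 2 ≠ 0 := fun t ht => pow_ne_zero _ (hne t ht)
  have co := @continuousOn_spectrum_of_continuousOn_Icc H _ _ _ K hK hK1
  have e1 := one_add_eq_cfc (IsSelfAdjoint.of_nonneg hK)
  have c0 : ContinuousOn (fun t : ℝ => t / (1 + t) ^ 2 * ((1 - t) / (1 + t)) ^ 0)
      (Set.Icc 0 1) := by
    simp only [pow_zero, mul_one]
    exact ContinuousOn.div (by fun_prop) (by fun_prop) hne2
  have c1 : ContinuousOn (fun t : ℝ =>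
      t / (1 + t) ^ 2 * ((1 - t) / (1 + t)) ^ 0 * (1 + t)) (Set.Icc 0 1) :=
    ContinuousOn.mul c0 (by fun_prop)
  rw [seriesRight, e1, ← cfc_mul _ _ K (co c0) (by fun_prop), ← cfc_mul _ _ K (co c1)
    (by fun_prop)]
  conv_rhs => rw [← cfc_id' ℝ K]
  refine cfc_congr fun t ht => ?_
  have := hne t (spectrum_mem_Icc hK hK1 ht)
  field_simp

lemma summable_series_norm :
    Summable fun k : ℕ => ‖(4 * ((k : ℝ) + 1)) • seriesLeft K k‖ * ‖seriesRight K k‖ := by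
  have h2 : Summable fun k : ℕ => 16 * (1 / ((k : ℝ) + 1) ^ 2) := by
    refine Summable.mul_left _ ?_
    have := (summable_nat_add_iff 1).2 (Real.summable_one_div_nat_pow.2 (one_lt_two))
    simpa using this
  refine Summable.of_nonneg_of_le (fun k => by positivity) (fun k => ?_) h2
  have h3 := norm_seriesLeft_le hK hK1 k
  have h4 := norm_seriesRight_le hK hK1 k
  rw [norm_smul, Real.norm_of_nonneg (by positivity)]
  calc 4 * ((k : ℝ) + 1) * ‖seriesLeft K k‖ * ‖seriesRight K k‖
      ≤ 4 * ((k : ℝ) + 1) * (4 / ((k : ℝ) + 1) ^ 2) * (1 / ((k : ℝ) + 1)) := by gcongr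
    _ = 16 * (1 / ((k : ℝ) + 1) ^ 2) := by field_simp; norm_num

/-- The equation solved by `sylvesterSeries`. -/
lemma sylvesterSeries_eq (A : H →L[ℂ] H) :
    K * (K * sylvesterSeries K A + sylvesterSeries K A * K)
      + (K * sylvesterSeries K A + sylvesterSeries K A * K) * K = K * K * A * K := by
  obtain ⟨U, hU1, hU2, hUL, hUR⟩ := cayley_mul_series hK hK1
  let a : ℕ → (H →L[ℂ] H) := fun k => seriesLeft K k * A * seriesRight K k
  have ha : ∀ k, U * a k * U = a (k + 1) := by
    intro k
    simp only [a]
    rw [← hUL, ← hUR]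
    simp only [mul_assoc]
  have hsumn : Summable fun k : ℕ => ‖((k : ℝ) + 1) • a k‖ := by
    refine Summable.of_nonneg_of_le (fun _ => norm_nonneg _) (fun k => ?_)
      ((summable_series_norm hK hK1).mul_right ‖A‖)
    have e : ((k : ℝ) + 1) • a k =
        (1 / 4 : ℝ) • (((4 * ((k : ℝ) + 1)) • seriesLeft K k) * A * seriesRight K k) := by
      simp only [a, smul_mul_assoc, smul_smul]
      congr 1
      ring
    rw [e, norm_smul]
    have : ‖((4 * ((k : ℝ) + 1)) • seriesLeft K k) * A * seriesRight K k‖ ≤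
        ‖(4 * ((k : ℝ) + 1)) • seriesLeft K k‖ * ‖A‖ * ‖seriesRight K k‖ :=
      (norm_mul_le _ _).trans (mul_le_mul_of_nonneg_right (norm_mul_le _ _) (norm_nonneg _))
    have h4 : ‖(1 / 4 : ℝ)‖ = 1 / 4 := by norm_num
    rw [h4]
    nlinarith [norm_nonneg (((4 * ((k : ℝ) + 1)) • seriesLeft K k) * A * seriesRight K k)]
  have hsum : Summable fun k : ℕ => ((k : ℝ) + 1) • a k := hsumn.of_norm
  have hsum0 : Summable a := by
    refine Summable.of_norm_bounded hsumn fun k => ?_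
    rw [norm_smul, Real.norm_of_nonneg (by positivity)]
    have : (0 : ℝ) ≤ k := k.cast_nonneg
    nlinarith [norm_nonneg (a k)]
  have hconj : ∀ f : ℕ → (H →L[ℂ] H), Summable f → U * (∑' k, f k) * U = ∑' k, U * f k * U := by
    intro f hf
    rw [← hf.tsum_mul_left, (hf.mul_left U).tsum_mul_right]
  set Ψ := ∑' k : ℕ, ((k : ℝ) + 1) • a k with hΨ
  set Ω := ∑' k, a k with hΩ
  have h1 : Ω - U * Ω * U = a 0 := by
    rw [hΩ, hconj _ hsum0]
    simp only [ha]
    conv_lhs => rw [hsum0.tsum_eq_zero_add]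
    abel
  have h2 : Ψ - U * Ψ * U = Ω := by
    have hs1 : Summable fun k => a (k + 1) := (summable_nat_add_iff 1).2 hsum0
    have hs2 : Summable fun k : ℕ => ((k : ℝ) + 1) • a (k + 1) := by
      have := (hsum.mul_left U).mul_right U
      refine this.congr fun k => ?_
      rw [mul_smul_comm, smul_mul_assoc, ha]
    rw [hΨ, hconj _ hsum]
    simp only [mul_smul_comm, smul_mul_assoc, ha]
    conv_lhs => rw [hsum.tsum_eq_zero_add]
    have e : ∑' k : ℕ, (((k + 1 : ℕ) : ℝ) + 1) • a (k + 1)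
        = ∑' k : ℕ, ((k : ℝ) + 1) • a (k + 1) + ∑' k, a (k + 1) := by
      rw [← hs2.tsum_add hs1]
      refine tsum_congr fun k => ?_
      push_cast
      rw [add_smul ((k : ℝ) + 1) 1, one_smul]
    rw [e, hΩ, hsum0.tsum_eq_zero_add]
    simp only [Nat.cast_zero, zero_add, one_smul]
    abel
  -- `(1 + K) (X - U X U) (1 + K) = 2 (K X + X K)`
  have hJ : ∀ X : H →L[ℂ] H,
      (1 + K) * (X - U * X * U) * (1 + K) = (K * X + X * K) + (K * X + X * K) := by
    intro X
    have e : (1 + K) * (X - U * X * U) * (1 + K)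
        = (1 + K) * X * (1 + K) - ((1 + K) * U) * X * (U * (1 + K)) := by noncomm_ring
    rw [e, hU1, hU2]
    noncomm_ring
  have h3 := hJ Ω
  have h4 := hJ Ψ
  rw [h1] at h3
  rw [h2] at h4
  have hΦ : sylvesterSeries K A = Ψ + Ψ + (Ψ + Ψ) := by
    have e : sylvesterSeries K A = (4 : ℝ) • Ψ := by
      rw [hΨ, ← hsum.tsum_const_smul]
      unfold sylvesterSeries
      refine tsum_congr fun k => ?_
      simp only [a, smul_mul_assoc, smul_smul]
    rw [e, show (4 : ℝ) = 1 + 1 + (1 + 1) by norm_num, add_smul, add_smul, one_smul]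
  have h5 : (1 + K) * ((1 + K) * a 0 * (1 + K)) * (1 + K) = K * K * A * K := by
    have e : (1 + K) * ((1 + K) * a 0 * (1 + K)) * (1 + K)
        = ((1 + K) * ((1 + K) * seriesLeft K 0)) * A * (seriesRight K 0 * (1 + K) * (1 + K)) := by
      simp only [a]
      noncomm_ring
    rw [e, one_add_sq_mul_seriesLeft hK hK1, seriesRight_mul_one_add_sq hK hK1]
  rw [← h5, h3, hΦ]
  have h6 : (1 + K) * (K * Ω + Ω * K + (K * Ω + Ω * K)) * (1 + K)
      = K * ((1 + K) * Ω * (1 + K)) + ((1 + K) * Ω * (1 + K)) * K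
        + (K * ((1 + K) * Ω * (1 + K)) + ((1 + K) * Ω * (1 + K)) * K) := by noncomm_ring
  rw [h6, h4]
  noncomm_ring

end Identities

end Series

noncomputable section Regularity

variable {H : Type*} [NormedAddCommGroup H] [InnerProductSpace ℂ H] [CompleteSpace H]

/-! ### Powers of the resolvent and Sobolev spaces -/

lemma negPow_add (N : H →ₗ.[ℂ] H) {r s : ℝ} (hr : 0 ≤ r) (hs : 0 ≤ s) :
    negPow N (r + s) = negPow N r * negPow N s := by
  rw [negPow, negPow, negPow, add_div, rpow_add_of_nonneg (by positivity) (by positivity)]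

lemma negPow_zero {N : H →ₗ.[ℂ] H} (hB : 0 ≤ resolvent N) : negPow N 0 = 1 := by
  rw [negPow, zero_div, CFC.rpow_zero _ hB]

lemma negPow_two {N : H →ₗ.[ℂ] H} (hB : 0 ≤ resolvent N) : negPow N 2 = resolvent N := by
  rw [negPow, div_self two_ne_zero, CFC.rpow_one _ hB]

lemma negPow_injective {N : H →ₗ.[ℂ] H} (hB : 0 ≤ resolvent N)
    (hi : Function.Injective (resolvent N)) {r : ℝ} (hr : 0 ≤ r) :
    Function.Injective (negPow N r) :=
  rpow_injective hB hi (by positivity)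

lemma mem_posPow_domain {N : H →ₗ.[ℂ] H} {r : ℝ} {x : H} :
    x ∈ (posPow N r).domain ↔ ∃ u, negPow N r u = x := by
  rw [posPow, LinearPMap.inverse_domain, LinearMap.mem_range]
  exact ⟨fun ⟨u, hu⟩ => ⟨u, hu⟩, fun ⟨u, hu⟩ => ⟨⟨u, trivial⟩, hu⟩⟩

lemma posPow_negPow {N : H →ₗ.[ℂ] H} (hB : 0 ≤ resolvent N)
    (hi : Function.Injective (resolvent N)) {r : ℝ} (hr : 0 ≤ r) (u : H)
    (h : negPow N r u ∈ (posPow N r).domain) : posPow N r ⟨negPow N r u, h⟩ = u := by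
  have hk : LinearMap.ker (ofBdd (negPow N r)).toFun = ⊥ := by
    rw [LinearMap.ker_eq_bot]
    intro x y hxy
    exact Subtype.ext (negPow_injective hB hi hr hxy)
  exact LinearPMap.inverse_apply_eq hk (x := ⟨u, trivial⟩) rfl

lemma mem_sobolev_iff {N : H →ₗ.[ℂ] H} {l : ℕ} {x : H} :
    x ∈ sobolev N l ↔ ∃ u, negPow N l u = x :=
  mem_posPow_domain

lemma mem_smoothVectors_iff {N : H →ₗ.[ℂ] H} {x : H} :
    x ∈ smoothVectors N ↔ ∀ l : ℕ, ∃ u, negPow N l u = x := by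
  simp only [smoothVectors, Submodule.mem_iInf, mem_sobolev_iff]

/-! ### Chains of commutators and smoothness -/

/-- `T` is the start of a sequence `T₀, T₁, …` in `B₁(N, p)` with `T_{n+1} = [N, T_n] (1 + N)^(-1/2)`.
With `K = (1 + N)^(-1/2)` the last relation is `[T_n, K²] = K² T_{n+1} K`, which makes sense in the
algebra of bounded operators. -/
def IsRegular (N : H →ₗ.[ℂ] H) (p : ℝ) (T : H →L[ℂ] H) : Prop :=
  ∃ t : ℕ → (H →L[ℂ] H), t 0 = T ∧ (∀ n, t n ∈ B1 N p) ∧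
    ∀ n, t n * (negPow N 1 * negPow N 1) - negPow N 1 * negPow N 1 * t n
      = negPow N 1 * negPow N 1 * t (n + 1) * negPow N 1

lemma negPow_commute (N : H →ₗ.[ℂ] H) (r s : ℝ) : Commute (negPow N r) (negPow N s) := by
  rw [negPow, negPow, CFC.rpow_def, CFC.rpow_def]
  exact cfc_commute_cfc _ _ _

lemma B2Bound_mul_left {N : H →ₗ.[ℂ] H} {p : ℝ} {F : H →L[ℂ] H}
    (hF : ∀ r, Commute F (negPow N r)) : B2Bound N N p (fun _ => ‖F‖) (fun a => F * a) := by
  refine B2Bound.of_hsSq (c₀ := ‖F‖) (c := fun _ => ‖F‖) (norm_nonneg _) (fun _ => norm_nonneg _)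
    (fun _ => ⟨le_rfl, le_rfl⟩) (fun a => norm_mul_le _ _) ?_ ?_
  · intro s _ a
    rw [mul_assoc]
    exact hsSq_mul_left_le _ _
  · intro s _ a
    have hc : star F * negPow N (s / 2) = negPow N (s / 2) * star F := by
      have := congrArg star (hF (s / 2)).eq
      rw [star_mul, star_mul, (negPow_isSelfAdjoint N _).star_eq] at this
      exact this.symm
    rw [star_mul, mul_assoc, hc, ← mul_assoc, ← norm_star F]
    exact hsSq_mul_right_le _ _

lemma B2Bound_mul_right {N : H →ₗ.[ℂ] H} {p : ℝ} {G : H →L[ℂ] H}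
    (hG : ∀ r, Commute G (negPow N r)) : B2Bound N N p (fun _ => ‖G‖) (fun b => b * G) := by
  refine B2Bound.of_hsSq (c₀ := ‖G‖) (c := fun _ => ‖G‖) (norm_nonneg _) (fun _ => norm_nonneg _)
    (fun _ => ⟨le_rfl, le_rfl⟩) (fun a => (norm_mul_le _ _).trans_eq (mul_comm _ _)) ?_ ?_
  · intro s _ a
    rw [mul_assoc, (hG _).eq, ← mul_assoc]
    exact hsSq_mul_right_le _ _
  · intro s _ a
    rw [star_mul, mul_assoc, ← norm_star G]
    exact hsSq_mul_left_le _ _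

/-- Two-sided multiplication by single operators on `B₁`. -/
lemma B1_mul_mul {N N' : H →ₗ.[ℂ] H} {p : ℝ} {C C' : ℕ → ℝ} {F G : H →L[ℂ] H}
    (hC : ∀ n, 0 ≤ C n) (hC' : ∀ n, 0 ≤ C' n)
    (hF : B2Bound N N' p C (fun a => F * a)) (hG : B2Bound N N' p C' (fun b => b * G))
    {T : H →L[ℂ] H} (hT : T ∈ B1 N p) : F * T * G ∈ B1 N' p := by
  obtain ⟨u, hu, hu', hul⟩ := hT
  have key := fun {S} (hS : S ∈ B2sq N p) => Pnorm_mul_mul_le hC hC' hF hG hS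
  refine ⟨fun j => F * u j * G, fun j => (key (hu j)).1, fun n ε hε => ?_,
    (hul.const_mul F).mul_const G⟩
  have hCC : 0 ≤ C n * C' n := mul_nonneg (hC n) (hC' n)
  obtain ⟨m, hm⟩ := hu' n (ε / (C n * C' n + 1)) (by positivity)
  refine ⟨m, fun i hi j hj => ?_⟩
  rw [← sub_mul, ← mul_sub]
  refine ((key (sub_mem (hu i) (hu j))).2 n).trans_lt ?_
  have h1 := mul_le_mul_of_nonneg_left (hm i hi j hj).le hCC
  refine h1.trans_lt ?_
  rw [mul_div_assoc', div_lt_iff₀ (by positivity)]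
  nlinarith

lemma B1_smul {N : H →ₗ.[ℂ] H} {p : ℝ} {T : H →L[ℂ] H} (hT : T ∈ B1 N p) (c : ℂ) :
    c • T ∈ B1 N p := by
  have h := B1_mul_mul (N := N) (p := p) (F := c • (1 : H →L[ℂ] H)) (G := 1)
    (fun _ => norm_nonneg _) (fun _ => norm_nonneg _)
    (B2Bound_mul_left fun r => (Commute.one_left _).smul_left c)
    (B2Bound_mul_right fun r => Commute.one_left _) hT
  simpa using h

lemma sylvesterSeries_mem_B1 {N : H →ₗ.[ℂ] H} {p : ℝ} (hK1 : negPow N 1 ≤ 1)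
    {A : H →L[ℂ] H} (hA : A ∈ B1 N p) : sylvesterSeries (negPow N 1) A ∈ B1 N p := by
  have hK : 0 ≤ negPow N 1 := CFC.rpow_nonneg
  have hsum := summable_series_norm hK hK1
  refine B1_tsum_mul_mul (C := fun k _ => ‖(4 * ((k : ℝ) + 1)) • seriesLeft (negPow N 1) k‖)
    (C' := fun k _ => ‖seriesRight (negPow N 1) k‖) (fun _ _ => norm_nonneg _)
    (fun _ _ => norm_nonneg _) (fun k => B2Bound_mul_left fun r => ?_)
    (fun k => B2Bound_mul_right fun r => ?_) (fun _ => hsum) hsum hA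
  · exact ((negPow_commute N 1 r).cfc_real _).smul_left _
  · exact (negPow_commute N 1 r).cfc_real _

variable {N : H →ₗ.[ℂ] H} {p : ℝ}

/-- Regularity passes from `T` to `δ(T)`. With `x` and `y` standing for left and right
multiplication by `(1 + N)^(1/2)`, this is
`x - y = (1/2) (x² - y²) y⁻¹ - (1/2) ((x² - y²) y⁻¹)² y (x + y)⁻²`. -/
lemma IsRegular.exists_delta (hB : 0 ≤ resolvent N) (hi : Function.Injective (resolvent N))
    (hK1 : negPow N 1 ≤ 1) {T : H →L[ℂ] H} (hT : IsRegular N p T) :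
    ∃ S, IsRegular N p S ∧
      T * negPow N 1 = negPow N 1 * T + negPow N 1 * S * negPow N 1 := by
  obtain ⟨t, ht0, htB, ht⟩ := hT
  set K := negPow N 1 with hKdef
  have hK : 0 ≤ K := CFC.rpow_nonneg
  have hKi : Function.Injective K := negPow_injective hB hi zero_le_one
  let X : ℕ → (H →L[ℂ] H) := fun n => sylvesterSeries K (t (n + 2))
  have hX : ∀ n, K * (K * X n + X n * K) + (K * X n + X n * K) * K = K * K * t (n + 2) * K :=
    fun n => sylvesterSeries_eq hK hK1 _
  let s : ℕ → (H →L[ℂ] H) := fun n => (1 / 2 : ℂ) • (t (n + 1) - X n)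
  have hs2 : ∀ n, s n + s n = t (n + 1) - X n := fun n => by
    simp only [s]
    rw [← add_smul]
    norm_num
  -- the series are themselves related by commutators
  have hXrel : ∀ n, X n * (K * K) - K * K * X n = K * K * X (n + 1) * K := by
    intro n
    refine anticommutator_injective hK hKi (anticommutator_injective hK hKi ?_)
    have e1 : K * (K * (X n * (K * K) - K * K * X n) + (X n * (K * K) - K * K * X n) * K)
        + (K * (X n * (K * K) - K * K * X n) + (X n * (K * K) - K * K * X n) * K) * K
        = (K * (K * X n + X n * K) + (K * X n + X n * K) * K) * (K * K)
          - K * K * (K * (K * X n + X n * K) + (K * X n + X n * K) * K) := by noncomm_ring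
    have e2 : K * (K * (K * K * X (n + 1) * K) + (K * K * X (n + 1) * K) * K)
        + (K * (K * K * X (n + 1) * K) + (K * K * X (n + 1) * K) * K) * K
        = K * K * (K * (K * X (n + 1) + X (n + 1) * K) + (K * X (n + 1) + X (n + 1) * K) * K) * K := by
      noncomm_ring
    have e3 : K * K * t (n + 2) * K * (K * K) - K * K * (K * K * t (n + 2) * K)
        = K * K * (t (n + 2) * (K * K) - K * K * t (n + 2)) * K := by noncomm_ring
    rw [e1, e2, hX, hX, e3, ht]
  have hsrel : ∀ n, s n * (K * K) - K * K * s n = K * K * s (n + 1) * K := by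
    intro n
    have e : s n * (K * K) - K * K * s n = (1 / 2 : ℂ) •
        ((t (n + 1) * (K * K) - K * K * t (n + 1)) - (X n * (K * K) - K * K * X n)) := by
      simp only [s, smul_mul_assoc, mul_smul_comm, ← smul_sub]
      congr 1
      noncomm_ring
    rw [e, ht, hXrel]
    simp only [s, smul_mul_assoc, mul_smul_comm]
    congr 1
    noncomm_ring
  refine ⟨s 0, ⟨s, rfl, fun n => ?_, hsrel⟩, ?_⟩
  · have h1 : s n = (1 / 2 : ℂ) • t (n + 1) + (-(1 / 2) : ℂ) • X n := by
      simp only [s]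
      rw [smul_sub, neg_smul, sub_eq_add_neg]
    rw [h1]
    exact B1_add (B1_smul (htB _) _) (B1_smul (sylvesterSeries_mem_B1 hK1 (htB _)) _)
  · -- first `K s₀ + s₀ K = K t₁`
    have hcomm : t 1 * K - K * t 1 = K * X 0 + X 0 * K := by
      refine anticommutator_injective hK hKi ?_
      rw [hX 0, ← ht 1]
      noncomm_ring
    have hsum : K * s 0 + s 0 * K = K * t 1 := by
      have h2 : (K * s 0 + s 0 * K) + (K * s 0 + s 0 * K) = K * t 1 + K * t 1 := by
        have e : (K * s 0 + s 0 * K) + (K * s 0 + s 0 * K)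
            = K * (s 0 + s 0) + (s 0 + s 0) * K := by noncomm_ring
        rw [e, hs2]
        have e' : K * (t (0 + 1) - X 0) + (t (0 + 1) - X 0) * K
            = K * t 1 + t 1 * K - (K * X 0 + X 0 * K) := by
          rw [zero_add]; noncomm_ring
        rw [e', ← hcomm]
        noncomm_ring
      rw [← two_smul ℂ, ← two_smul ℂ (K * t 1)] at h2
      exact smul_right_injective _ two_ne_zero h2
    have hmain : T * K - K * T = K * s 0 * K := by
      refine anticommutator_injective hK hKi ?_
      have e1 : K * (T * K - K * T) + (T * K - K * T) * K = t 0 * (K * K) - K * K * t 0 := by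
        rw [ht0]; noncomm_ring
      have e2 : K * (K * s 0 * K) + K * s 0 * K * K = K * (K * s 0 + s 0 * K) * K := by
        noncomm_ring
      rw [e1, e2, hsum, ht]
      noncomm_ring
    rw [← hmain]
    abel

lemma IsRegular.mem_B1inf (hB : 0 ≤ resolvent N) (hi : Function.Injective (resolvent N))
    (hK1 : negPow N 1 ≤ 1) {T : H →L[ℂ] H} (hT : IsRegular N p T) : T ∈ B1inf N p := by
  have hdelta : ∀ l, ∃ S, IsRegular N p S ∧ IsDeltaPow N l T S := by
    intro l
    induction l with
    | zero => exact ⟨T, hT, rfl⟩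
    | succ l ih =>
      obtain ⟨S, hS, hSd⟩ := ih
      obtain ⟨S', hS', hrel⟩ := hS.exists_delta hB hi hK1
      refine ⟨S', hS', S, hSd, ?_⟩
      rintro ⟨x, hx⟩
      obtain ⟨u, rfl⟩ := mem_posPow_domain.1 hx
      have h1 : S (negPow N 1 u) = negPow N 1 (S u + S' (negPow N 1 u)) := by
        have := DFunLike.congr_fun hrel u
        simp only [mul_apply_eq_comp, add_apply] at this
        rw [this, map_add]
      have h2 : S (negPow N 1 u) ∈ (posPow N 1).domain := mem_posPow_domain.2 ⟨_, h1.symm⟩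
      refine ⟨h2, ?_⟩
      rw [posPow_negPow hB hi zero_le_one]
      have h3 : posPow N 1 ⟨S (negPow N 1 u), h2⟩ = S u + S' (negPow N 1 u) := by
        simp only [h1]
        exact posPow_negPow hB hi zero_le_one _ _
      rw [h3]
      simp
  have hsob : ∀ l : ℕ, ∀ T : H →L[ℂ] H, IsRegular N p T →
      ∀ u, ∃ v, negPow N l v = T (negPow N l u) := by
    intro l
    induction l with
    | zero =>
      intro T _ u
      refine ⟨T u, ?_⟩
      simp [negPow_zero hB]
    | succ l ih =>
      intro T hT u
      obtain ⟨S, hS, hrel⟩ := hT.exists_delta hB hi hK1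
      have e : negPow N ((l + 1 : ℕ) : ℝ) = negPow N 1 * negPow N l := by
        push_cast
        rw [add_comm, negPow_add N zero_le_one l.cast_nonneg]
      have ec : negPow N 1 * negPow N l = negPow N l * negPow N 1 := (negPow_commute N 1 l).eq
      obtain ⟨v₁, h₁⟩ := ih T hT u
      obtain ⟨v₂, h₂⟩ := ih S hS (negPow N 1 u)
      refine ⟨v₁ + v₂, ?_⟩
      rw [e, mul_apply_eq_comp, map_add, h₁, h₂, mul_apply_eq_comp]
      have h3 := DFunLike.congr_fun hrel (negPow N l u)
      have h4 := DFunLike.congr_fun ec u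
      simp only [mul_apply_eq_comp, add_apply] at h3 h4
      rw [h3, h4, map_add]
  refine Set.mem_iInter.2 fun k l _ => ⟨fun x hx => ?_, ?_⟩
  · obtain ⟨u, rfl⟩ := mem_sobolev_iff.1 hx
    exact mem_sobolev_iff.2 (hsob l T hT u)
  · obtain ⟨S, ⟨t, ht0, htB, -⟩, hS⟩ := hdelta l
    exact ⟨S, ht0 ▸ htB 0, hS⟩

end Regularity

section Graphs

variable {H : Type*} [NormedAddCommGroup H] [InnerProductSpace ℂ H]

/-! ### Graphs of unbounded operators -/

lemma mem_graph_mk {T : H →ₗ.[ℂ] H} {x : H} (h : x ∈ T.domain) : (x, T ⟨x, h⟩) ∈ T.graph :=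
  T.mem_graph ⟨x, h⟩

lemma exists_eq_of_mem_graph {T : H →ₗ.[ℂ] H} {x y : H} (h : (x, y) ∈ T.graph) :
    ∃ hx : x ∈ T.domain, T ⟨x, hx⟩ = y := by
  obtain ⟨⟨x', hx'⟩, h1, h2⟩ := (LinearPMap.mem_graph_iff T).1 h
  simp only at h1 h2
  subst h1
  exact ⟨hx', h2⟩

lemma graph_unique {T : H →ₗ.[ℂ] H} {x y y' : H} (h : (x, y) ∈ T.graph) (h' : (x, y') ∈ T.graph) :
    y = y' :=
  T.mem_graph_snd_inj h h' rfl

lemma mem_graph_opMul {S T : H →ₗ.[ℂ] H} {x z : H} :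
    (x, z) ∈ (opMul S T).graph ↔ ∃ y, (x, y) ∈ T.graph ∧ (y, z) ∈ S.graph := by
  constructor
  · intro h
    obtain ⟨hx, rfl⟩ := exists_eq_of_mem_graph h
    obtain ⟨h1, h2⟩ := hx
    exact ⟨_, mem_graph_mk h1, mem_graph_mk h2⟩
  · rintro ⟨y, h1, h2⟩
    obtain ⟨hx, rfl⟩ := exists_eq_of_mem_graph h1
    obtain ⟨hy, rfl⟩ := exists_eq_of_mem_graph h2
    exact mem_graph_mk (T := opMul S T) ⟨hx, hy⟩

lemma mem_graph_add {S T : H →ₗ.[ℂ] H} {x z : H} :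
    (x, z) ∈ (S + T).graph ↔ ∃ a b, (x, a) ∈ S.graph ∧ (x, b) ∈ T.graph ∧ a + b = z := by
  constructor
  · intro h
    obtain ⟨hx, rfl⟩ := exists_eq_of_mem_graph h
    exact ⟨_, _, mem_graph_mk hx.1, mem_graph_mk hx.2, rfl⟩
  · rintro ⟨a, b, h1, h2, rfl⟩
    obtain ⟨hx, rfl⟩ := exists_eq_of_mem_graph h1
    obtain ⟨hy, rfl⟩ := exists_eq_of_mem_graph h2
    exact mem_graph_mk (T := S + T) ⟨hx, hy⟩

lemma mem_graph_sub {S T : H →ₗ.[ℂ] H} {x z : H} :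
    (x, z) ∈ (S - T).graph ↔ ∃ a b, (x, a) ∈ S.graph ∧ (x, b) ∈ T.graph ∧ a - b = z := by
  constructor
  · intro h
    obtain ⟨hx, rfl⟩ := exists_eq_of_mem_graph h
    exact ⟨_, _, mem_graph_mk hx.1, mem_graph_mk hx.2, rfl⟩
  · rintro ⟨a, b, h1, h2, rfl⟩
    obtain ⟨hx, rfl⟩ := exists_eq_of_mem_graph h1
    obtain ⟨hy, rfl⟩ := exists_eq_of_mem_graph h2
    exact mem_graph_mk (T := S - T) ⟨hx, hy⟩

lemma mem_graph_smul {T : H →ₗ.[ℂ] H} {c : ℂ} {x z : H} :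
    (x, z) ∈ (c • T).graph ↔ ∃ a, (x, a) ∈ T.graph ∧ c • a = z := by
  constructor
  · intro h
    obtain ⟨hx, rfl⟩ := exists_eq_of_mem_graph h
    exact ⟨_, mem_graph_mk (T := T) hx, rfl⟩
  · rintro ⟨a, h1, rfl⟩
    obtain ⟨hx, rfl⟩ := exists_eq_of_mem_graph h1
    exact mem_graph_mk (T := c • T) hx

lemma mem_graph_ofBdd {T : H →L[ℂ] H} {x y : H} : (x, y) ∈ (ofBdd T).graph ↔ T x = y := by
  constructor
  · intro h
    obtain ⟨_, rfl⟩ := exists_eq_of_mem_graph h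
    rfl
  · rintro rfl
    exact mem_graph_mk (T := ofBdd T) (x := x) trivial

lemma isBddComm_iff {S : H →ₗ.[ℂ] H} {T C : H →L[ℂ] H} :
    IsBddComm S T C ↔ ∀ x y, (x, y) ∈ S.graph → (T x, T y + C x) ∈ S.graph := by
  constructor
  · intro h x y hxy
    obtain ⟨hx, rfl⟩ := exists_eq_of_mem_graph hxy
    obtain ⟨h1, h2⟩ := h ⟨x, hx⟩
    have := mem_graph_mk h1
    rwa [sub_eq_iff_eq_add'.1 h2] at this
  · rintro h ⟨x, hx⟩
    obtain ⟨h1, h2⟩ := exists_eq_of_mem_graph (h _ _ (mem_graph_mk hx))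
    exact ⟨h1, by rw [h2]; simp⟩

/-- A closed condition holds on the graph of a closure if it holds on the graph. -/
lemma closure_graph_induction {T : H →ₗ.[ℂ] H} (hT : T.IsClosable) {P : H × H → Prop}
    (hP : IsClosed {p | P p}) (h : ∀ x y, (x, y) ∈ T.graph → P (x, y)) {x y : H}
    (hxy : (x, y) ∈ T.closure.graph) : P (x, y) := by
  rw [← hT.graph_closure_eq_closure_graph] at hxy
  have h1 : (x, y) ∈ closure (T.graph : Set (H × H)) := hxy
  exact closure_minimal (fun p hp => h p.1 p.2 hp) hP h1

lemma mem_graph_closure {T : H →ₗ.[ℂ] H} {p : H × H} (h : p ∈ T.graph) : p ∈ T.closure.graph :=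
  LinearPMap.le_graph_of_le T.le_closure h

/-! ### Resolvents, symmetric and self-adjoint operators -/

/-- Positivity of an unbounded operator, in terms of its graph. -/
def IsPos (N : H →ₗ.[ℂ] H) : Prop := ∀ x x', (x, x') ∈ N.graph → 0 ≤ (⟪x, x'⟫_ℂ).re

lemma IsResolvent.mem_graph {N : H →ₗ.[ℂ] H} {B : H →L[ℂ] H} (h : IsResolvent N B) (y : H) :
    (B y, y - B y) ∈ N.graph := by
  obtain ⟨h1, h2⟩ := h.1 y
  have := mem_graph_mk h1
  rwa [← eq_sub_iff_add_eq'.2 h2]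

lemma IsResolvent.apply {N : H →ₗ.[ℂ] H} {B : H →L[ℂ] H} (h : IsResolvent N B) {x x' : H}
    (hx : (x, x') ∈ N.graph) : B (x + x') = x := by
  obtain ⟨h1, rfl⟩ := exists_eq_of_mem_graph hx
  exact h.2 ⟨x, h1⟩

lemma norm_le_of_isPos {N : H →ₗ.[ℂ] H} (hp : IsPos N) {x x' : H} (h : (x, x') ∈ N.graph) :
    ‖x‖ ≤ ‖x + x'‖ := by
  have h1 := hp _ _ h
  have h2 : ‖x + x'‖ ^ 2 = ‖x‖ ^ 2 + 2 * (⟪x, x'⟫_ℂ).re + ‖x'‖ ^ 2 := norm_add_sq (𝕜 := ℂ) x x'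
  exact le_of_sq_le_sq (by nlinarith [sq_nonneg ‖x'‖]) (norm_nonneg _)

/-- Symmetry of an unbounded operator, in terms of its graph. -/
def IsSymm (T : H →ₗ.[ℂ] H) : Prop :=
  ∀ x x' y y', (x, x') ∈ T.graph → (y, y') ∈ T.graph → ⟪x', y⟫_ℂ = ⟪x, y'⟫_ℂ

lemma IsResolvent.resolvent_eq {N : H →ₗ.[ℂ] H} {B : H →L[ℂ] H} (h : IsResolvent N B) :
    resolvent N = B := by
  have hex : ∃ B, IsResolvent N B := ⟨B, h⟩
  have h' : IsResolvent N (resolvent N) := by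
    rw [resolvent, dif_pos hex]
    exact hex.choose_spec
  ext y
  have h1 := h'.apply (h.mem_graph y)
  rwa [add_sub_cancel] at h1

lemma IsResolvent.injective {N : H →ₗ.[ℂ] H} {B : H →L[ℂ] H} (h : IsResolvent N B) :
    Function.Injective B := by
  rw [injective_iff_map_eq_zero]
  intro y hy
  have h1 := h.mem_graph y
  rw [hy, sub_zero] at h1
  exact N.graph_fst_eq_zero_snd h1 rfl

lemma IsResolvent.nonneg {N : H →ₗ.[ℂ] H} {B : H →L[ℂ] H} (h : IsResolvent N B) (hs : IsSymm N)
    (hp : IsPos N) : 0 ≤ B := by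
  rw [ContinuousLinearMap.nonneg_iff_isPositive, ContinuousLinearMap.isPositive_def]
  constructor
  · intro y z
    have h1 := hs _ _ _ _ (h.mem_graph y) (h.mem_graph z)
    rw [inner_sub_left, inner_sub_right] at h1
    simp only [ContinuousLinearMap.coe_coe]
    linear_combination -h1
  · intro y
    have h1 := hp _ _ (h.mem_graph y)
    rw [inner_sub_right, Complex.sub_re] at h1
    have h2 : 0 ≤ (⟪B y, B y⟫_ℂ).re := inner_self_nonneg (𝕜 := ℂ)
    rw [ContinuousLinearMap.reApplyInnerSelf_apply]
    simp only [RCLike.re_to_complex]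
    linarith

variable [CompleteSpace H]

lemma inner_of_mem_adjoint {T : H →ₗ.[ℂ] H} (hT : Dense (T.domain : Set H)) {x x' y y' : H}
    (h : (x, x') ∈ T.adjoint.graph) (h' : (y, y') ∈ T.graph) : ⟪x', y⟫_ℂ = ⟪x, y'⟫_ℂ := by
  obtain ⟨hx, rfl⟩ := exists_eq_of_mem_graph h
  obtain ⟨hy, rfl⟩ := exists_eq_of_mem_graph h'
  exact LinearPMap.adjoint_isFormalAdjoint hT ⟨x, hx⟩ ⟨y, hy⟩

lemma inner_of_mem_adjoint' {T : H →ₗ.[ℂ] H} (hT : Dense (T.domain : Set H)) {x x' y y' : H}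
    (h : (x, x') ∈ T.adjoint.graph) (h' : (y, y') ∈ T.graph) : ⟪y', x⟫_ℂ = ⟪y, x'⟫_ℂ := by
  rw [← inner_conj_symm, ← inner_of_mem_adjoint hT h h', inner_conj_symm]

lemma mem_adjoint_of_inner {T : H →ₗ.[ℂ] H} (hT : Dense (T.domain : Set H)) {x x' : H}
    (h : ∀ y y', (y, y') ∈ T.graph → ⟪x', y⟫_ℂ = ⟪x, y'⟫_ℂ) : (x, x') ∈ T.adjoint.graph := by
  have hx : x ∈ T.adjoint.domain := LinearPMap.mem_adjoint_domain_of_exists x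
    ⟨x', fun y => h _ _ (T.mem_graph y)⟩
  have := mem_graph_mk hx
  rwa [LinearPMap.adjoint_apply_eq hT ⟨x, hx⟩ (x₀ := x') fun y => h _ _ (T.mem_graph y)] at this

lemma IsSymm.of_isSelfAdjoint {T : H →ₗ.[ℂ] H} (h : IsSelfAdjoint T) : IsSymm T := by
  intro x x' y y' hx hy
  have hd := h.dense_domain
  rw [← LinearPMap.isSelfAdjoint_def.1 h] at hx
  exact inner_of_mem_adjoint hd hx hy

lemma IsSymm.isClosable {T : H →ₗ.[ℂ] H} (hT : IsSymm T) (hd : Dense (T.domain : Set H)) :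
    T.IsClosable := by
  have h : T ≤ T.adjoint := LinearPMap.IsFormalAdjoint.le_adjoint hd fun x y =>
    hT _ _ _ _ (T.mem_graph x) (T.mem_graph y)
  exact (LinearPMap.adjoint_isClosed hd).isClosable.leIsClosable h

lemma IsSymm.closure {T : H →ₗ.[ℂ] H} (hT : IsSymm T) (hd : Dense (T.domain : Set H)) :
    IsSymm T.closure := by
  have hc := hT.isClosable hd
  have h1 : ∀ x x', (x, x') ∈ T.graph → ∀ y y', (y, y') ∈ T.closure.graph →
      ⟪x', y⟫_ℂ = ⟪x, y'⟫_ℂ := by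
    intro x x' hx y y' hy
    refine closure_graph_induction (P := fun p => ⟪x', p.1⟫_ℂ = ⟪x, p.2⟫_ℂ) hc
      (isClosed_eq (by fun_prop) (by fun_prop)) (fun y y' h => hT _ _ _ _ hx h) hy
  intro x x' y y' hx hy
  exact closure_graph_induction (P := fun p => ⟪p.2, y⟫_ℂ = ⟪p.1, y'⟫_ℂ) hc
    (isClosed_eq (by fun_prop) (by fun_prop)) (fun x x' h => h1 x x' h y y' hy) hx

/-- A symmetric operator `T` such that `1 + T²` is onto is self-adjoint. -/
lemma IsSymm.isSelfAdjoint_of_surjective {T : H →ₗ.[ℂ] H} (hT : IsSymm T)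
    (hd : Dense (T.domain : Set H))
    (h : ∀ y, ∃ x x' x'', (x, x') ∈ T.graph ∧ (x', x'') ∈ T.graph ∧ x + x'' = y) :
    IsSelfAdjoint T := by
  rw [LinearPMap.isSelfAdjoint_def]
  refine LinearPMap.eq_of_eq_graph (le_antisymm ?_ ?_)
  · rintro ⟨x, x'⟩ hx
    -- With `z = (1 + T²)⁻¹ (T* x + i x)`, the vector `u = (T - i) z` satisfies `(T + i) u = (T* + i) x`.
    -- It equals `x`, since `d = x - u` is in the kernel of `T* + i` and `T - i` is onto.
    obtain ⟨z, z', z'', h1, h2, h3⟩ := h (x' + Complex.I • x)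
    have hu : (z' - Complex.I • z, z'' - Complex.I • z') ∈ T.graph :=
      T.graph.sub_mem h2 (T.graph.smul_mem Complex.I h1)
    have hd0 : x - (z' - Complex.I • z) = 0 := by
      obtain ⟨d, hdd⟩ : ∃ d, d = x - (z' - Complex.I • z) := ⟨_, rfl⟩
      rw [← hdd]
      obtain ⟨q, q', q'', k1, k2, k3⟩ := h d
      have hq : (q' + Complex.I • q, q'' + Complex.I • q') ∈ T.graph :=
        T.graph.add_mem k2 (T.graph.smul_mem Complex.I k1)
      have e1 := inner_of_mem_adjoint hd hx hq
      have e2 := hT _ _ _ _ hu hq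
      have e3 : x' - (z'' - Complex.I • z') = -(Complex.I • d) := by
        have : x' = z + z'' - Complex.I • x := by rw [h3]; abel
        rw [this, hdd, smul_sub, smul_sub, smul_smul, Complex.I_mul_I]
        module
      have e4 : ⟪-(Complex.I • d), q' + Complex.I • q⟫_ℂ = ⟪d, q'' + Complex.I • q'⟫_ℂ := by
        rw [← e3, hdd, inner_sub_left x', inner_sub_left x, e1, e2]
      have e5 : ⟪d, d⟫_ℂ = 0 := by
        have e6 : d = (q'' + Complex.I • q') - Complex.I • (q' + Complex.I • q) := by
          rw [← k3, smul_add, smul_smul, Complex.I_mul_I]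
          module
        have e7 : ⟪d, d⟫_ℂ = ⟪d, (q'' + Complex.I • q') - Complex.I • (q' + Complex.I • q)⟫_ℂ :=
          congrArg (fun v => ⟪d, v⟫_ℂ) e6
        rw [e7, inner_sub_right, ← e4, inner_neg_left, inner_smul_left, inner_smul_right,
          Complex.conj_I]
        ring
      exact inner_self_eq_zero.1 e5
    have e : x = z' - Complex.I • z := sub_eq_zero.1 hd0
    have e' : x' = z'' - Complex.I • z' := by
      have h4 : x' = z + z'' - Complex.I • x := by rw [h3]; abel
      rw [h4, e, smul_sub, smul_smul, Complex.I_mul_I]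
      module
    rw [e, e']
    exact hu
  · rintro ⟨x, x'⟩ hx
    exact mem_adjoint_of_inner hd fun y y' hy => hT _ _ _ _ hx hy

lemma IsResolvent.le_one {N : H →ₗ.[ℂ] H} {B : H →L[ℂ] H} (h : IsResolvent N B) (hs : IsSymm N)
    (hp : IsPos N) : B ≤ 1 := by
  have hB := h.nonneg hs hp
  have hsB : IsSelfAdjoint B := IsSelfAdjoint.of_nonneg hB
  rw [ContinuousLinearMap.le_def, ContinuousLinearMap.isPositive_def]
  refine ⟨((IsSelfAdjoint.one _).sub hsB).isSymmetric, fun y => ?_⟩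
  have h1 := hp _ _ (h.mem_graph y)
  have h2 : 0 ≤ (⟪y - B y, y - B y⟫_ℂ).re := inner_self_nonneg (𝕜 := ℂ)
  have h3 : (⟪y - B y, B y⟫_ℂ).re = (⟪B y, y - B y⟫_ℂ).re := inner_re_symm (𝕜 := ℂ) _ _
  rw [ContinuousLinearMap.reApplyInnerSelf_apply]
  simp only [RCLike.re_to_complex, sub_apply, one_apply_eq_self]
  rw [inner_sub_right, Complex.sub_re, h3] at h2
  linarith

/-- A positive self-adjoint operator has a resolvent: `1 + N` is bounded below, and the orthogonal
complement of its range is trivial. -/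
lemma exists_isResolvent {N : H →ₗ.[ℂ] H} (hN : IsSelfAdjoint N) (hp : IsPos N) :
    ∃ B, IsResolvent N B := by
  have hd := hN.dense_domain
  have hcl : IsClosed (N.graph : Set (H × H)) := hN.isClosed
  let f : N.domain →ₗ[ℂ] H := N.domain.subtype + N.toFun
  have hf : ∀ x : N.domain, f x = (x : H) + N x := fun x => rfl
  have hfn : ∀ x : N.domain, ‖(x : H)‖ ≤ ‖f x‖ := fun x => norm_le_of_isPos hp (N.mem_graph x)
  have hclosed : IsClosed ((LinearMap.range f : Submodule ℂ H) : Set H) := by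
    rw [← isSeqClosed_iff_isClosed]
    intro u y hu huy
    choose x hx using hu
    have hc : CauchySeq fun n => (x n : H) := by
      rw [Metric.cauchySeq_iff]
      intro ε hε
      obtain ⟨m, hm⟩ := Metric.cauchySeq_iff.1 huy.cauchySeq ε hε
      refine ⟨m, fun i hi j hj => lt_of_le_of_lt ?_ (hm i hi j hj)⟩
      rw [dist_eq_norm, dist_eq_norm, ← hx i, ← hx j, ← map_sub]
      exact hfn (x i - x j)
    obtain ⟨z, hz⟩ := cauchySeq_tendsto_of_complete hc
    have h2 : Filter.Tendsto (fun n => ((x n : H), N (x n))) Filter.atTop (𝓝 (z, y - z)) := by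
      refine Filter.Tendsto.prodMk_nhds hz ?_
      refine (huy.sub hz).congr fun n => ?_
      rw [← hx n, hf]
      abel
    have h3 : (z, y - z) ∈ N.graph :=
      hcl.mem_of_tendsto h2 (Filter.Eventually.of_forall fun n => N.mem_graph (x n))
    obtain ⟨hzd, hz'⟩ := exists_eq_of_mem_graph h3
    exact ⟨⟨z, hzd⟩, by rw [hf, hz']; simp⟩
  have hsurj : LinearMap.range f = ⊤ := by
    have : CompleteSpace (LinearMap.range f) := hclosed.completeSpace_coe
    rw [← Submodule.orthogonal_eq_bot_iff, Submodule.eq_bot_iff]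
    intro y hy
    have h1 : ∀ x x', (x, x') ∈ N.graph → ⟪-y, x⟫_ℂ = ⟪y, x'⟫_ℂ := by
      intro x x' hx
      obtain ⟨hxd, rfl⟩ := exists_eq_of_mem_graph hx
      have h2 := (Submodule.mem_orthogonal' _ _).1 hy (f ⟨x, hxd⟩) ⟨_, rfl⟩
      rw [hf, inner_add_right] at h2
      rw [inner_neg_left]
      exact neg_eq_of_add_eq_zero_right h2
    have h2 := mem_adjoint_of_inner hd h1
    rw [LinearPMap.isSelfAdjoint_def.1 hN] at h2
    have h3 := hp _ _ h2
    have h4 : (⟪y, y⟫_ℂ).re = ‖y‖ ^ 2 := inner_self_eq_norm_sq (𝕜 := ℂ) y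
    rw [inner_neg_right, Complex.neg_re, h4] at h3
    have : ‖y‖ ^ 2 = 0 := le_antisymm (by linarith) (sq_nonneg _)
    simpa using this
  have hinj : Function.Injective f := by
    rw [injective_iff_map_eq_zero]
    intro x hx
    have := hfn x
    rw [hx, norm_zero] at this
    exact Subtype.ext (norm_le_zero_iff.1 this)
  let e := LinearEquiv.ofBijective f ⟨hinj, LinearMap.range_eq_top.1 hsurj⟩
  have he : ∀ y, ((e.symm y : N.domain) : H) + N (e.symm y) = y := fun y => by
    rw [← hf]; exact e.apply_symm_apply y
  let B : H →L[ℂ] H := (N.domain.subtype ∘ₗ e.symm.toLinearMap).mkContinuous 1 fun y => by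
    rw [one_mul]
    have := hfn (e.symm y)
    rw [hf, he] at this
    exact this
  refine ⟨B, fun y => ⟨(e.symm y).2, he y⟩, fun x => ?_⟩
  change ((e.symm (f x) : N.domain) : H) = x
  congr 1
  exact e.symm_apply_apply x

end Graphs

section WickOperator

variable {H : Type*} [NormedAddCommGroup H] [InnerProductSpace ℂ H] [CompleteSpace H]
  {D : H →ₗ.[ℂ] H}

/-! ### The operators `⟨D⟩²`, `R_D` and `D_E` -/

lemma mem_graph_absSq₀ {x z : H} : (x, z) ∈ (absSq₀ D).graph ↔
    ∃ a b c d, (x, a) ∈ D.adjoint.graph ∧ (a, b) ∈ D.graph ∧ (x, c) ∈ D.graph ∧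
      (c, d) ∈ D.adjoint.graph ∧ (1 / 2 : ℂ) • (b + d) = z := by
  rw [absSq₀, mem_graph_smul]
  constructor
  · rintro ⟨s, hs, rfl⟩
    obtain ⟨b, d, h1, h2, rfl⟩ := mem_graph_add.1 hs
    obtain ⟨a, h3, h4⟩ := mem_graph_opMul.1 h1
    obtain ⟨c, h5, h6⟩ := mem_graph_opMul.1 h2
    exact ⟨a, b, c, d, h3, h4, h5, h6, rfl⟩
  · rintro ⟨a, b, c, d, h3, h4, h5, h6, rfl⟩
    exact ⟨b + d, mem_graph_add.2 ⟨b, d, mem_graph_opMul.2 ⟨a, h3, h4⟩,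
      mem_graph_opMul.2 ⟨c, h5, h6⟩, rfl⟩, rfl⟩

lemma mem_graph_remainder {x r : H} : (x, r) ∈ (remainder D).graph ↔
    ∃ c b a d, (x, c) ∈ D.graph ∧ (c, b) ∈ D.graph ∧ (x, a) ∈ D.adjoint.graph ∧
      (a, d) ∈ D.adjoint.graph ∧ (Complex.I / 2) • (b - d) = r := by
  rw [remainder, mem_graph_smul]
  constructor
  · rintro ⟨s, hs, rfl⟩
    obtain ⟨b, d, h1, h2, rfl⟩ := mem_graph_sub.1 hs
    obtain ⟨c, h3, h4⟩ := mem_graph_opMul.1 h1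
    obtain ⟨a, h5, h6⟩ := mem_graph_opMul.1 h2
    exact ⟨c, b, a, d, h3, h4, h5, h6, rfl⟩
  · rintro ⟨c, b, a, d, h3, h4, h5, h6, rfl⟩
    exact ⟨b - d, mem_graph_sub.2 ⟨b, d, mem_graph_opMul.2 ⟨c, h3, h4⟩,
      mem_graph_opMul.2 ⟨a, h5, h6⟩, rfl⟩, rfl⟩

/-- The Wick rotation on its initial domain `dom D ∩ dom D*`. -/
noncomputable def wick₀ (D : H →ₗ.[ℂ] H) : H →ₗ.[ℂ] H :=
  (1 / 2 : ℂ) • (D + D.adjoint) + (Complex.I / 2) • (D - D.adjoint)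

lemma mem_graph_wick₀ {x w : H} : (x, w) ∈ (wick₀ D).graph ↔
    ∃ c a, (x, c) ∈ D.graph ∧ (x, a) ∈ D.adjoint.graph ∧
      (1 / 2 : ℂ) • (c + a) + (Complex.I / 2) • (c - a) = w := by
  rw [wick₀, mem_graph_add]
  constructor
  · rintro ⟨s, t, hs, ht, rfl⟩
    obtain ⟨s', hs', rfl⟩ := mem_graph_smul.1 hs
    obtain ⟨t', ht', rfl⟩ := mem_graph_smul.1 ht
    obtain ⟨c, a, h1, h2, rfl⟩ := mem_graph_add.1 hs'
    obtain ⟨c', a', h3, h4, rfl⟩ := mem_graph_sub.1 ht'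
    obtain rfl := graph_unique h1 h3
    obtain rfl := graph_unique h2 h4
    exact ⟨c, a, h1, h2, rfl⟩
  · rintro ⟨c, a, h1, h2, rfl⟩
    exact ⟨_, _, mem_graph_smul.2 ⟨_, mem_graph_add.2 ⟨c, a, h1, h2, rfl⟩, rfl⟩,
      mem_graph_smul.2 ⟨_, mem_graph_sub.2 ⟨c, a, h1, h2, rfl⟩, rfl⟩, rfl⟩

lemma wick₀_dense (hD₀ : Dense ((absSq₀ D).domain : Set H)) : Dense ((wick₀ D).domain : Set H) := by
  refine hD₀.mono fun x hx => ?_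
  obtain ⟨a, b, c, d, h1, h2, h3, h4, -⟩ := mem_graph_absSq₀.1 (mem_graph_mk hx)
  exact (exists_eq_of_mem_graph (mem_graph_wick₀.2 ⟨c, a, h3, h1, rfl⟩)).1

lemma wick_dense (hD₀ : Dense ((absSq₀ D).domain : Set H)) : Dense ((wick D).domain : Set H) :=
  (wick₀_dense hD₀).mono (LinearPMap.le_closure (wick₀ D)).1

section FormIdentities

variable (hD : Dense (D.domain : Set H))
include hD

/-- The quadratic form of `⟨D⟩²`, on the initial domain. -/
lemma inner_absSq₀ {x z c a y u v : H} (hz : (x, z) ∈ (absSq₀ D).graph) (hc : (x, c) ∈ D.graph)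
    (ha : (x, a) ∈ D.adjoint.graph) (hu : (y, u) ∈ D.graph) (hv : (y, v) ∈ D.adjoint.graph) :
    ⟪z, y⟫_ℂ = 1 / 2 * (⟪c, u⟫_ℂ + ⟪a, v⟫_ℂ) := by
  obtain ⟨a', b, c', d, h1, h2, h3, h4, rfl⟩ := mem_graph_absSq₀.1 hz
  obtain rfl := graph_unique ha h1
  obtain rfl := graph_unique hc h3
  rw [inner_smul_left, inner_add_left, inner_of_mem_adjoint' hD hv h2,
    inner_of_mem_adjoint hD h4 hu]
  simp only [map_div₀, map_one, Complex.conj_ofNat]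
  ring

lemma absSq₀_isSymm : IsSymm (absSq₀ D) := by
  intro x z y z' hx hy
  obtain ⟨a, b, c, d, h1, h2, h3, h4, -⟩ := mem_graph_absSq₀.1 hx
  obtain ⟨a', b', c', d', k1, k2, k3, k4, -⟩ := mem_graph_absSq₀.1 hy
  rw [← inner_conj_symm x z', inner_absSq₀ hD hx h3 h1 k3 k1, inner_absSq₀ hD hy k3 k1 h3 h1]
  simp only [map_div₀, map_one, map_mul, map_add, Complex.conj_ofNat, inner_conj_symm]

lemma wick₀_isSymm : IsSymm (wick₀ D) := by
  intro x w y w' hx hy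
  obtain ⟨c, a, h1, h2, rfl⟩ := mem_graph_wick₀.1 hx
  obtain ⟨u, v, k1, k2, rfl⟩ := mem_graph_wick₀.1 hy
  simp only [inner_add_left, inner_add_right, inner_sub_left, inner_sub_right, inner_smul_left,
    inner_smul_right, inner_of_mem_adjoint' hD k2 h1, inner_of_mem_adjoint hD h2 k1]
  simp only [map_div₀, map_one, Complex.conj_I, Complex.conj_ofNat]
  ring

variable (hD₀ : Dense ((absSq₀ D).domain : Set H))
include hD₀

lemma wick_isSymm : IsSymm (wick D) :=
  (wick₀_isSymm hD).closure (wick₀_dense hD₀)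

/-- A closed condition holds on the graph of `D_E` if it holds on the initial domain. -/
lemma wick_closed_induction {P : H × H → Prop} (hP : IsClosed {p | P p})
    (h : ∀ y u v, (y, u) ∈ D.graph → (y, v) ∈ D.adjoint.graph →
      P (y, (1 / 2 : ℂ) • (u + v) + (Complex.I / 2) • (u - v)))
    {x w : H} (hw : (x, w) ∈ (wick D).graph) : P (x, w) := by
  refine closure_graph_induction ((wick₀_isSymm hD).isClosable (wick₀_dense hD₀)) hP
    (fun y y' hy => ?_) hw
  obtain ⟨u, v, h1, h2, rfl⟩ := mem_graph_wick₀.1 hy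
  exact h y u v h1 h2

/-- `dom ⟨D⟩² ⊆ dom D ∩ dom D*`, and the quadratic form of `⟨D⟩²`: the graph norm of `⟨D⟩²` dominates
those of `D` and `D*` on the initial domain. -/
lemma exists_inner_absSq (hDc : D.IsClosed) {x z : H} (hz : (x, z) ∈ (absSq D).graph) :
    ∃ c a, (x, c) ∈ D.graph ∧ (x, a) ∈ D.adjoint.graph ∧
      ∀ y u v, (y, u) ∈ D.graph → (y, v) ∈ D.adjoint.graph →
        ⟪z, y⟫_ℂ = 1 / 2 * (⟪c, u⟫_ℂ + ⟪a, v⟫_ℂ) := by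
  have hcl := (absSq₀_isSymm hD).isClosable hD₀
  have hDac : D.adjoint.IsClosed := LinearPMap.adjoint_isClosed hD
  have h1 : (x, z) ∈ closure ((absSq₀ D).graph : Set (H × H)) := by
    have := hz
    rw [absSq, ← hcl.graph_closure_eq_closure_graph] at this
    exact this
  obtain ⟨p, hp, hpt⟩ := mem_closure_iff_seq_limit.1 h1
  have hex : ∀ n, ∃ c a, ((p n).1, c) ∈ D.graph ∧ ((p n).1, a) ∈ D.adjoint.graph := by
    intro n
    obtain ⟨a, b, c, d, h1, h2, h3, h4, -⟩ := (mem_graph_absSq₀ (x := (p n).1) (z := (p n).2)).1 (hp n)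
    exact ⟨c, a, h3, h1⟩
  choose c a hc ha using hex
  have hx : Filter.Tendsto (fun n => (p n).1) Filter.atTop (𝓝 x) :=
    (continuous_fst.tendsto _).comp hpt
  have hzt : Filter.Tendsto (fun n => (p n).2) Filter.atTop (𝓝 z) :=
    (continuous_snd.tendsto _).comp hpt
  -- the form identity turns graph convergence into convergence of `D` and `D*`
  have hest : ∀ i j, ‖c i - c j‖ ^ 2 + ‖a i - a j‖ ^ 2 ≤ 2 * ‖p i - p j‖ ^ 2 := by
    intro i j
    have g1 : ((p i).1 - (p j).1, (p i).2 - (p j).2) ∈ (absSq₀ D).graph :=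
      (absSq₀ D).graph.sub_mem (hp i) (hp j)
    have g2 : ((p i).1 - (p j).1, c i - c j) ∈ D.graph := D.graph.sub_mem (hc i) (hc j)
    have g3 : ((p i).1 - (p j).1, a i - a j) ∈ D.adjoint.graph :=
      D.adjoint.graph.sub_mem (ha i) (ha j)
    have e := congrArg Complex.re (inner_absSq₀ hD g1 g2 g3 g2 g3)
    have e1 : ∀ w : H, (⟪w, w⟫_ℂ).re = ‖w‖ ^ 2 := fun w => inner_self_eq_norm_sq (𝕜 := ℂ) w
    have e2 : (1 / 2 * (⟪c i - c j, c i - c j⟫_ℂ + ⟪a i - a j, a i - a j⟫_ℂ) : ℂ).re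
        = 1 / 2 * (‖c i - c j‖ ^ 2 + ‖a i - a j‖ ^ 2) := by
      rw [← e1, ← e1, show (1 / 2 : ℂ) = ((1 / 2 : ℝ) : ℂ) by norm_num, Complex.re_ofReal_mul,
        Complex.add_re]
    rw [e2] at e
    have e3 : (⟪(p i).2 - (p j).2, (p i).1 - (p j).1⟫_ℂ).re ≤ ‖p i - p j‖ * ‖p i - p j‖ := by
      refine (Complex.re_le_norm _).trans ((norm_inner_le_norm _ _).trans ?_)
      exact mul_le_mul (norm_snd_le (p i - p j)) (norm_fst_le (p i - p j)) (norm_nonneg _)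
        (norm_nonneg _)
    nlinarith
  have hcauchy : ∀ q : ℕ → H, (∀ i j, ‖q i - q j‖ ^ 2 ≤ 2 * ‖p i - p j‖ ^ 2) → CauchySeq q := by
    intro q hq
    rw [Metric.cauchySeq_iff]
    intro ε hε
    obtain ⟨m, hm⟩ := Metric.cauchySeq_iff.1 hpt.cauchySeq (ε / 2) (half_pos hε)
    refine ⟨m, fun i hi j hj => ?_⟩
    have h2 := hm i hi j hj
    rw [dist_eq_norm] at h2 ⊢
    refine lt_of_pow_lt_pow_left₀ 2 hε.le ((hq i j).trans_lt ?_)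
    nlinarith [norm_nonneg (p i - p j)]
  obtain ⟨c', hc'⟩ := cauchySeq_tendsto_of_complete (hcauchy c fun i j => by
    have := hest i j; nlinarith [sq_nonneg ‖a i - a j‖])
  obtain ⟨a', ha'⟩ := cauchySeq_tendsto_of_complete (hcauchy a fun i j => by
    have := hest i j; nlinarith [sq_nonneg ‖c i - c j‖])
  refine ⟨c', a', ?_, ?_, fun y u v hu hv => ?_⟩
  · exact IsClosed.mem_of_tendsto (s := (D.graph : Set (H × H))) hDc (hx.prodMk_nhds hc')
      (Filter.Eventually.of_forall hc)
  · exact IsClosed.mem_of_tendsto (s := (D.adjoint.graph : Set (H × H))) hDac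
      (hx.prodMk_nhds ha') (Filter.Eventually.of_forall ha)
  · have t1 : Filter.Tendsto (fun n => ⟪(p n).2, y⟫_ℂ) Filter.atTop (𝓝 ⟪z, y⟫_ℂ) :=
      hzt.inner tendsto_const_nhds
    have t2 : Filter.Tendsto (fun n => 1 / 2 * (⟪c n, u⟫_ℂ + ⟪a n, v⟫_ℂ)) Filter.atTop
        (𝓝 (1 / 2 * (⟪c', u⟫_ℂ + ⟪a', v⟫_ℂ))) :=
      ((hc'.inner tendsto_const_nhds).add (ha'.inner tendsto_const_nhds)).const_mul _
    refine tendsto_nhds_unique t1 (t2.congr fun n => ?_)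
    exact (inner_absSq₀ hD (x := (p n).1) (z := (p n).2) (hp n) (hc n) (ha n) hu hv).symm

lemma absSq_re_inner (hDc : D.IsClosed) {x z c a : H} (hz : (x, z) ∈ (absSq D).graph)
    (hc : (x, c) ∈ D.graph) (ha : (x, a) ∈ D.adjoint.graph) :
    (⟪x, z⟫_ℂ).re = (‖c‖ ^ 2 + ‖a‖ ^ 2) / 2 := by
  obtain ⟨c', a', hc', ha', h⟩ := exists_inner_absSq hD hD₀ hDc hz
  obtain rfl := graph_unique hc hc'
  obtain rfl := graph_unique ha ha'
  have e := congrArg Complex.re (h _ _ _ hc ha)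
  have e1 : ∀ w : H, (⟪w, w⟫_ℂ).re = ‖w‖ ^ 2 := fun w => inner_self_eq_norm_sq (𝕜 := ℂ) w
  rw [show (1 / 2 : ℂ) = ((1 / 2 : ℝ) : ℂ) by norm_num, Complex.re_ofReal_mul,
    Complex.add_re, e1, e1] at e
  have e2 : (⟪x, z⟫_ℂ).re = (⟪z, x⟫_ℂ).re := inner_re_symm (𝕜 := ℂ) _ _
  rw [e2, e]
  ring

lemma absSq_isPos (hDc : D.IsClosed) : IsPos (absSq D) := by
  intro x z hz
  obtain ⟨c, a, hc, ha, -⟩ := exists_inner_absSq hD hD₀ hDc hz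
  rw [absSq_re_inner hD hD₀ hDc hz hc ha]
  positivity

/-- The form of `R_D` is dominated by that of `⟨D⟩²`. -/
lemma norm_inner_remainder_le (hDc : D.IsClosed) {x z y z' r : H} (hz : (x, z) ∈ (absSq D).graph)
    (hz' : (y, z') ∈ (absSq D).graph) (hr : (y, r) ∈ (remainder D).graph) :
    ‖⟪x, r⟫_ℂ‖ ^ 2 ≤ (⟪x, z⟫_ℂ).re * (⟪y, z'⟫_ℂ).re := by
  obtain ⟨c, a, hc, ha, -⟩ := exists_inner_absSq hD hD₀ hDc hz
  obtain ⟨u, b, v, d, h1, h2, h3, h4, rfl⟩ := mem_graph_remainder.1 hr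
  rw [absSq_re_inner hD hD₀ hDc hz hc ha, absSq_re_inner hD hD₀ hDc hz' h1 h3, inner_smul_right,
    inner_sub_right, ← inner_of_mem_adjoint hD ha h2, ← inner_of_mem_adjoint' hD h4 hc]
  have e1 : ‖Complex.I / 2 * (⟪a, u⟫_ℂ - ⟪c, v⟫_ℂ)‖ ≤ 1 / 2 * (‖a‖ * ‖u‖ + ‖c‖ * ‖v‖) := by
    rw [norm_mul]
    have : ‖(Complex.I / 2 : ℂ)‖ = 1 / 2 := by simp
    rw [this]
    refine mul_le_mul_of_nonneg_left ((norm_sub_le _ _).trans ?_) (by norm_num)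
    exact add_le_add (norm_inner_le_norm _ _) (norm_inner_le_norm _ _)
  refine (pow_le_pow_left₀ (norm_nonneg _) e1 2).trans ?_
  nlinarith [sq_nonneg (‖a‖ * ‖v‖ - ‖c‖ * ‖u‖)]

/-- `D_E² = ⟨D⟩² + R_D` on `dom ⟨D⟩² ∩ dom R_D`, if `D_E` is self-adjoint. -/
lemma wick_sq (hDc : D.IsClosed) (hW : IsSelfAdjoint (wick D)) {x z r : H}
    (hz : (x, z) ∈ (absSq D).graph) (hr : (x, r) ∈ (remainder D).graph) :
    (x, z + r) ∈ (opMul (wick D) (wick D)).graph := by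
  obtain ⟨c, a, hc, ha, hform⟩ := exists_inner_absSq hD hD₀ hDc hz
  obtain ⟨c', b, a', d, h1, h2, h3, h4, rfl⟩ := mem_graph_remainder.1 hr
  obtain rfl := graph_unique hc h1
  obtain rfl := graph_unique ha h3
  -- `z + r` is weakly `D_E w`, because the forms of `⟨D⟩² + R_D` and of `D_E²` agree on `dom D ∩ dom D*`.
  set w := (1 / 2 : ℂ) • (c + a) + (Complex.I / 2) • (c - a) with hw
  have hxw : (x, w) ∈ (wick D).graph :=
    mem_graph_closure (T := wick₀ D) (mem_graph_wick₀.2 ⟨c, a, hc, ha, rfl⟩)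
  refine mem_graph_opMul.2 ⟨w, hxw, ?_⟩
  rw [← LinearPMap.isSelfAdjoint_def.1 hW]
  refine mem_adjoint_of_inner (wick_dense hD₀) fun y y' hy => ?_
  refine wick_closed_induction hD hD₀
    (P := fun p => ⟪z + (Complex.I / 2) • (b - d), p.1⟫_ℂ = ⟪w, p.2⟫_ℂ)
    (isClosed_eq (by fun_prop) (by fun_prop)) (fun y u v hu hv => ?_) hy
  simp only [hw, inner_add_left, inner_add_right, inner_sub_left, inner_sub_right, inner_smul_left,
    inner_smul_right, hform y u v hu hv, inner_of_mem_adjoint' hD hv h2,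
    inner_of_mem_adjoint hD h4 hu]
  simp only [map_div₀, map_one, Complex.conj_I, Complex.conj_ofNat]
  ring_nf
  simp only [Complex.I_sq]
  ring

lemma wick_isBddComm {T C C' : H →L[ℂ] H} (h : IsBddComm D T C) (h' : IsBddComm D.adjoint T C') :
    IsBddComm (wick D) T ((1 / 2 : ℂ) • (C + C') + (Complex.I / 2) • (C - C')) := by
  rw [isBddComm_iff] at h h' ⊢
  intro x w hw
  have hcl : IsClosed ((wick D).graph : Set (H × H)) :=
    ((wick₀_isSymm hD).isClosable (wick₀_dense hD₀)).closure_isClosed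
  refine wick_closed_induction hD hD₀ (P := fun p => (T p.1, T p.2 +
    ((1 / 2 : ℂ) • (C + C') + (Complex.I / 2) • (C - C')) p.1) ∈ (wick D).graph)
    (hcl.preimage (f := fun p : H × H => (T p.1, T p.2 +
    ((1 / 2 : ℂ) • (C + C') + (Complex.I / 2) • (C - C')) p.1)) (by fun_prop))
    (fun y u v hu hv => ?_) hw
  refine mem_graph_closure (T := wick₀ D) (mem_graph_wick₀.2 ⟨_, _, h _ _ hu, h' _ _ hv, ?_⟩)
  simp only [map_add, map_smul, map_sub, add_apply, smul_apply, sub_apply]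
  module

end FormIdentities

end WickOperator

section RangeComparison

variable {H : Type*} [NormedAddCommGroup H] [InnerProductSpace ℂ H]

/-! ### Comparing the ranges of the powers of two resolvents -/

variable {B B' X R S : H →L[ℂ] H}

lemma mul_left_cancel_of_injective {A C E : H →L[ℂ] H} (hA : Function.Injective A)
    (h : A * C = A * E) : C = E := by
  ext x
  have := congrArg (fun F : H →L[ℂ] H => F x) h
  simp only [mul_apply_eq_comp] at this
  exact hA this

/-- If `[R, B] = B S B` and `S` preserves the ranges of the powers of `B`, then conjugation by `B ^ j`
changes `R` only by a term `E B` of lower order. -/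
lemma exists_pow_commutator (hR : R * B = B * (R + S * B))
    (hS : ∀ j : ℕ, ∃ S', S * B ^ j = B ^ j * S') (j : ℕ) :
    ∃ E : H →L[ℂ] H, R * B ^ j = B ^ j * (R + E * B) := by
  induction j with
  | zero => exact ⟨0, by simp⟩
  | succ j ih =>
    obtain ⟨E, hE⟩ := ih
    obtain ⟨S', hS'⟩ := hS j
    refine ⟨E + S', ?_⟩
    calc R * B ^ (j + 1) = (R * B) * B ^ j := by rw [pow_succ', mul_assoc]
      _ = B * (R * B ^ j) + B * (S * B ^ j) * B := by
        rw [hR, mul_assoc, add_mul, mul_add, mul_assoc S, ← pow_succ', pow_succ]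
        simp only [mul_assoc]
      _ = B ^ (j + 1) * (R + (E + S') * B) := by
        rw [hE, hS', pow_succ']
        simp only [mul_assoc, mul_add, add_mul, add_assoc]

variable [CompleteSpace H]

/-- The inverse `c` of `1 + m B`. If `B = (1 + N)⁻¹`, then `B c = (1 + m + N)⁻¹`. -/
lemma exists_shifted_inverse (hB : 0 ≤ B) {m : ℝ} (hm : 0 < m) :
    ∃ c : H →L[ℂ] H, c * (1 + (m : ℂ) • B) = 1 ∧ (1 + (m : ℂ) • B) * c = 1 ∧ B * c = c * B ∧
      ‖c‖ ≤ 1 ∧ m * ‖B * c‖ ≤ 1 := by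
  have hle : (1 : H →L[ℂ] H) ≤ 1 + (m : ℂ) • B := by
    rw [← sub_nonneg, add_sub_cancel_left, ContinuousLinearMap.nonneg_iff_isPositive]
    rw [ContinuousLinearMap.nonneg_iff_isPositive] at hB
    exact hB.smul_of_nonneg (by exact_mod_cast hm.le)
  obtain ⟨w, hw⟩ : IsUnit (1 + (m : ℂ) • B) := CStarAlgebra.isUnit_of_le 1 hle isStrictlyPositive_one
  have h1 : (↑w⁻¹ : H →L[ℂ] H) * (1 + (m : ℂ) • B) = 1 := by rw [← hw, Units.inv_mul]
  have h2 : (1 + (m : ℂ) • B) * (↑w⁻¹ : H →L[ℂ] H) = 1 := by rw [← hw, Units.mul_inv]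
  have hcomm : B * (↑w⁻¹ : H →L[ℂ] H) = ↑w⁻¹ * B := by
    have h3 : Commute B (w : H →L[ℂ] H) := by
      rw [hw]
      exact (Commute.one_right B).add_right ((Commute.refl B).smul_right _)
    exact h3.units_inv_right
  have hest : ∀ x : H, ‖(1 + (m : ℂ) • B) x‖ ^ 2 =
      ‖x‖ ^ 2 + 2 * (m * (⟪x, B x⟫_ℂ).re) + (m * ‖B x‖) ^ 2 := by
    intro x
    have e := norm_add_sq (𝕜 := ℂ) x ((m : ℂ) • B x)
    rw [inner_smul_right, norm_smul, Complex.norm_real, Real.norm_of_nonneg hm.le] at e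
    rw [add_apply, one_apply_eq_self, smul_apply, e]
    simp
  have hpos : ∀ x, 0 ≤ (⟪x, B x⟫_ℂ).re := fun x => re_inner_nonneg hB x
  have h2x : ∀ y, (1 + (m : ℂ) • B) ((↑w⁻¹ : H →L[ℂ] H) y) = y := fun y => by
    rw [← mul_apply_eq_comp, h2, one_apply_eq_self]
  refine ⟨↑w⁻¹, h1, h2, hcomm, ?_, ?_⟩
  · refine ContinuousLinearMap.opNorm_le_bound _ zero_le_one fun y => ?_
    have e := hest ((↑w⁻¹ : H →L[ℂ] H) y)
    rw [h2x] at e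
    rw [one_mul]
    refine le_of_sq_le_sq ?_ (norm_nonneg _)
    nlinarith [mul_nonneg hm.le (hpos ((↑w⁻¹ : H →L[ℂ] H) y)),
      sq_nonneg (m * ‖B ((↑w⁻¹ : H →L[ℂ] H) y)‖)]
  · rw [← le_div_iff₀' hm]
    refine ContinuousLinearMap.opNorm_le_bound _ (by positivity) fun y => ?_
    have e := hest ((↑w⁻¹ : H →L[ℂ] H) y)
    rw [h2x] at e
    rw [mul_apply_eq_comp, div_mul_eq_mul_div, one_mul, le_div_iff₀' hm]
    refine le_of_sq_le_sq ?_ (norm_nonneg _)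
    nlinarith [mul_nonneg hm.le (hpos ((↑w⁻¹ : H →L[ℂ] H) y)),
      sq_nonneg (‖(↑w⁻¹ : H →L[ℂ] H) y‖)]

/-- One step of elliptic regularity for the resolvent `B'` of a perturbation of the operator with
resolvent `B`. The commutators of the perturbation with `B ^ j` become small after a shift of the
spectral parameter, and the resolvent identity moves the shift back. -/
lemma exists_resolvent_factor (hB : 0 ≤ B) (hB' : 0 ≤ B') (hi : Function.Injective B)
    (hi' : Function.Injective B') (hX : B' = B * X) (hZ : B = B' * (1 + R))
    (hR : R * B = B * (R + S * B)) (hS : ∀ j : ℕ, ∃ S', S * B ^ j = B ^ j * S') (j : ℕ) :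
    ∃ Y : H →L[ℂ] H, B' * B ^ j = B ^ (j + 1) * Y := by
  induction j with
  | zero => exact ⟨X, by simpa using hX⟩
  | succ j ih =>
    obtain ⟨Y, hY⟩ := ih
    obtain ⟨E, hE⟩ := exists_pow_commutator hR hS (j + 1)
    -- `m` is so large that `‖E‖ ‖B c‖ ‖P‖ < 1` below, where `‖B c‖ ≤ 1 / m` and `‖P‖ ≤ ‖X‖ + 1`.
    set m : ℝ := (‖X‖ + 1) * ‖E‖ + 1 with hm
    have hm0 : 0 < m := by positivity
    obtain ⟨c, hc1, hc2, hcB, hcn, hbn⟩ := exists_shifted_inverse hB hm0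
    obtain ⟨c', hc1', hc2', hcB', hcn', hbn'⟩ := exists_shifted_inverse hB' hm0
    -- `Q = 1 + R c` relates the shifted resolvents `B c` and `B' c'`; its inverse is `P`.
    have hQ : B' * c' * (1 + R * c) = B * c := by
      have h1 : B' * ((1 + (m : ℂ) • B) + R) = (1 + (m : ℂ) • B') * B := by
        have : B' * ((1 + (m : ℂ) • B) + R) = B' * (1 + R) + (m : ℂ) • (B' * B) := by
          simp only [mul_add, mul_smul_comm]; abel
        rw [this, ← hZ, add_mul, one_mul, smul_mul_assoc]
      calc B' * c' * (1 + R * c) = c' * (B' * ((1 + (m : ℂ) • B) * c + R * c)) := by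
            rw [hc2, hcB', mul_assoc]
        _ = c' * (B' * ((1 + (m : ℂ) • B) + R)) * c := by rw [← add_mul]; simp only [mul_assoc]
        _ = c' * (1 + (m : ℂ) • B') * B * c := by rw [h1]; simp only [mul_assoc]
        _ = B * c := by rw [hc1', one_mul]
    have hP : B * c * (X * c' + (m : ℂ) • (B' * c')) = B' * c' := by
      have h1 : B * X + (m : ℂ) • (B * B') = (1 + (m : ℂ) • B) * B' := by
        rw [← hX, add_mul, one_mul, smul_mul_assoc]
      calc B * c * (X * c' + (m : ℂ) • (B' * c'))
          = c * (B * X + (m : ℂ) • (B * B')) * c' := by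
            rw [hcB]
            simp only [mul_add, add_mul, mul_smul_comm, smul_mul_assoc, mul_assoc]
        _ = c * (1 + (m : ℂ) • B) * B' * c' := by rw [h1]; simp only [mul_assoc]
        _ = B' * c' := by rw [hc1, one_mul]
    have hinjb : Function.Injective (B * c) := by
      intro x y hxy
      have : ∀ z, (1 + (m : ℂ) • B) (c z) = z := fun z => by
        rw [← mul_apply_eq_comp, hc2, one_apply_eq_self]
      rw [mul_apply_eq_comp, mul_apply_eq_comp] at hxy
      rw [← this x, hi hxy, this y]
    have hPQ : (X * c' + (m : ℂ) • (B' * c')) * (1 + R * c) = 1 := by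
      refine mul_left_cancel_of_injective hinjb ?_
      rw [← mul_assoc, hP, hQ, mul_one]
    have hinjb' : Function.Injective (B' * c') := by
      intro x y hxy
      have : ∀ z, (1 + (m : ℂ) • B') (c' z) = z := fun z => by
        rw [← mul_apply_eq_comp, hc2', one_apply_eq_self]
      rw [mul_apply_eq_comp, mul_apply_eq_comp] at hxy
      rw [← this x, hi' hxy, this y]
    have hQP : (1 + R * c) * (X * c' + (m : ℂ) • (B' * c')) = 1 := by
      refine mul_left_cancel_of_injective hinjb' ?_
      rw [← mul_assoc, hQ, hP, mul_one]
    have hPn : ‖X * c' + (m : ℂ) • (B' * c')‖ ≤ ‖X‖ + 1 := by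
      refine (norm_add_le _ _).trans (add_le_add ?_ ?_)
      · exact (norm_mul_le _ _).trans (mul_le_of_le_one_right (norm_nonneg _) hcn')
      · rw [norm_smul, Complex.norm_real, Real.norm_of_nonneg hm0.le]
        exact hbn'
    set P := X * c' + (m : ℂ) • (B' * c') with hPdef
    -- `Q B^(j+1) = B^(j+1) (Q + E B c)`, and the second factor is invertible.
    have hcp : ∀ k : ℕ, c * B ^ k = B ^ k * c := fun k =>
      ((show Commute c B from hcB.symm).pow_right k).eq
    have hQj : (1 + R * c) * B ^ (j + 1) = B ^ (j + 1) * ((1 + R * c) + E * (B * c)) := by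
      rw [add_mul, one_mul, mul_assoc, hcp, ← mul_assoc, hE]
      simp only [mul_add, add_mul, mul_one, mul_assoc, add_assoc]
    have hsmall : ‖-(E * (B * c) * P)‖ < 1 := by
      rw [norm_neg]
      have h1 : ‖E * (B * c) * P‖ ≤ ‖E‖ * ‖B * c‖ * (‖X‖ + 1) :=
        (norm_mul_le _ _).trans (mul_le_mul (norm_mul_le _ _) hPn (norm_nonneg _) (by positivity))
      have h2 : m * ‖E * (B * c) * P‖ ≤ (‖X‖ + 1) * ‖E‖ := by
        refine (mul_le_mul_of_nonneg_left h1 hm0.le).trans ?_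
        calc m * (‖E‖ * ‖B * c‖ * (‖X‖ + 1)) = ((‖X‖ + 1) * ‖E‖) * (m * ‖B * c‖) := by ring
          _ ≤ ((‖X‖ + 1) * ‖E‖) * 1 := mul_le_mul_of_nonneg_left hbn (by positivity)
          _ = _ := mul_one _
      by_contra hcon
      push Not at hcon
      nlinarith
    obtain ⟨u, hu⟩ := isUnit_one_sub_of_norm_lt_one hsmall
    rw [sub_neg_eq_add] at hu
    have hfac : ((1 + R * c) + E * (B * c)) * (P * ↑u⁻¹) = 1 := by
      have : ((1 + R * c) + E * (B * c)) * P = u := by rw [add_mul, hQP, hu]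
      rw [← mul_assoc, this, Units.mul_inv]
    have hstep : B' * c' * B ^ (j + 1) = B ^ (j + 2) * (c * (P * ↑u⁻¹)) := by
      have h1 : B * c * B ^ (j + 1) = B' * c' * B ^ (j + 1) * ((1 + R * c) + E * (B * c)) := by
        rw [mul_assoc _ (B ^ (j + 1)), ← hQj, ← mul_assoc, hQ]
      have h2 := congrArg (fun F => F * (P * (↑u⁻¹ : H →L[ℂ] H))) h1
      rw [mul_assoc (B' * c' * B ^ (j + 1)), hfac, mul_one] at h2
      rw [← h2, mul_assoc B, hcp, pow_succ' B (j + 1)]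
      simp only [mul_assoc]
    -- the resolvent identity `B' = B' c' + m B' c' B'`
    have hres : B' = B' * c' * (1 + (m : ℂ) • B') := by rw [mul_assoc, hc1', mul_one]
    refine ⟨c * (P * ↑u⁻¹) * (1 + (m : ℂ) • (Y * B)), ?_⟩
    calc B' * B ^ (j + 1) = B' * c' * ((1 + (m : ℂ) • B') * B ^ (j + 1)) := by
          conv_lhs => rw [hres]
          rw [mul_assoc (B' * c')]
      _ = B' * c' * (B ^ (j + 1) * (1 + (m : ℂ) • (Y * B))) := by
          rw [add_mul, one_mul, smul_mul_assoc, pow_succ B j, ← mul_assoc B', hY, mul_add (B ^ j * B),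
            mul_one, mul_smul_comm, ← pow_succ, mul_assoc (B ^ (j + 1)) Y B]
      _ = _ := by rw [← mul_assoc, hstep]; simp only [mul_assoc]

/-- All powers of the two resolvents have the same range. -/
theorem exists_pow_factor (hB : 0 ≤ B) (hB' : 0 ≤ B') (hi : Function.Injective B)
    (hi' : Function.Injective B') (hX : B' = B * X) (hZ : B = B' * (1 + R))
    (hR : R * B = B * (R + S * B)) (hS : ∀ j : ℕ, ∃ S', S * B ^ j = B ^ j * S') :
    (∀ n : ℕ, ∃ Y : H →L[ℂ] H, B' ^ n = B ^ n * Y) ∧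
      ∀ n : ℕ, ∃ Y : H →L[ℂ] H, B ^ n = B' ^ n * Y := by
  constructor
  · intro n
    induction n with
    | zero => exact ⟨1, by simp⟩
    | succ n ih =>
      obtain ⟨Y, hY⟩ := ih
      obtain ⟨Y', hY'⟩ := exists_resolvent_factor hB hB' hi hi' hX hZ hR hS n
      exact ⟨Y' * Y, by rw [pow_succ', hY, ← mul_assoc, hY', mul_assoc]⟩
  · intro n
    induction n with
    | zero => exact ⟨1, by simp⟩
    | succ n ih =>
      obtain ⟨Y, hY⟩ := ih
      obtain ⟨E, hE⟩ := exists_pow_commutator hR hS n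
      refine ⟨Y * (1 + (R + E * B)), ?_⟩
      calc B ^ (n + 1) = B' * ((1 + R) * B ^ n) := by
            rw [pow_succ', ← mul_assoc, ← hZ]
        _ = B' * (B ^ n * (1 + (R + E * B))) := by
            rw [add_mul, hE, one_mul, mul_add (B ^ n) 1, mul_one]
        _ = _ := by rw [hY, pow_succ']; simp only [mul_assoc]

end RangeComparison

section SmoothVectors

variable {H : Type*} [NormedAddCommGroup H] [InnerProductSpace ℂ H]

/-! ### The space of smooth vectors -/

/-- The linear map on an invariant subspace `V` of its domain given by an unbounded operator. -/
def restrictMap (S : H →ₗ.[ℂ] H) (V : Submodule ℂ H)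
    (h : ∀ x ∈ V, ∃ hx : x ∈ S.domain, S ⟨x, hx⟩ ∈ V) : V →ₗ[ℂ] V where
  toFun x := ⟨S ⟨x, (h x x.2).fst⟩, (h x x.2).snd⟩
  map_add' x y := Subtype.ext (S.map_add ⟨x, (h x x.2).fst⟩ ⟨y, (h y y.2).fst⟩)
  map_smul' c x := Subtype.ext (S.map_smul c ⟨x, (h x x.2).fst⟩)

lemma restrictMap_mem_graph {S : H →ₗ.[ℂ] H} {V : Submodule ℂ H}
    (h : ∀ x ∈ V, ∃ hx : x ∈ S.domain, S ⟨x, hx⟩ ∈ V) (x : V) :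
    ((x : H), (restrictMap S V h x : H)) ∈ S.graph :=
  mem_graph_mk (h x x.2).fst

variable [CompleteSpace H] {N : H →ₗ.[ℂ] H}

lemma negPow_two_mul_natCast (hB : 0 ≤ resolvent N) (j : ℕ) :
    negPow N ((2 * j : ℕ) : ℝ) = resolvent N ^ j := by
  rw [negPow, Nat.cast_mul, Nat.cast_ofNat, mul_div_cancel_left₀ _ two_ne_zero,
    CFC.rpow_natCast _ _ hB]

lemma smoothVectors_dense (hB : 0 ≤ resolvent N) (hi : Function.Injective (resolvent N)) :
    Dense (smoothVectors N : Set H) := by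
  refine (dense_iInter_range_pow hB hi).mono fun x hx => mem_smoothVectors_iff.2 fun l => ?_
  obtain ⟨u, rfl⟩ := hx l
  refine ⟨negPow N l u, ?_⟩
  rw [← mul_apply_eq_comp, ← negPow_add N l.cast_nonneg l.cast_nonneg, ← two_mul,
    ← negPow_two_mul_natCast hB]
  push_cast
  rfl

lemma negPow_mem_smoothVectors (r : ℝ) {x : H} (hx : x ∈ smoothVectors N) :
    negPow N r x ∈ smoothVectors N := by
  refine mem_smoothVectors_iff.2 fun l => ?_
  obtain ⟨u, rfl⟩ := mem_smoothVectors_iff.1 hx l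
  exact ⟨negPow N r u, by rw [← mul_apply_eq_comp, (negPow_commute N l r).eq, mul_apply_eq_comp]⟩

lemma exists_negPow_eq (hB : 0 ≤ resolvent N) (hi : Function.Injective (resolvent N)) (n : ℕ)
    {x : H} (hx : x ∈ smoothVectors N) : ∃ u ∈ smoothVectors N, negPow N n u = x := by
  obtain ⟨u, hu⟩ := mem_smoothVectors_iff.1 hx n
  refine ⟨u, mem_smoothVectors_iff.2 fun l => ?_, hu⟩
  obtain ⟨w, hw⟩ := mem_smoothVectors_iff.1 hx (n + l)
  refine ⟨w, negPow_injective hB hi n.cast_nonneg ?_⟩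
  rw [← mul_apply_eq_comp, ← negPow_add N n.cast_nonneg l.cast_nonneg, hu, ← hw]
  push_cast
  rfl

lemma exists_resolvent_eq (hB : 0 ≤ resolvent N) (hi : Function.Injective (resolvent N))
    {x : H} (hx : x ∈ smoothVectors N) : ∃ u ∈ smoothVectors N, resolvent N u = x := by
  have := exists_negPow_eq hB hi 2 hx
  rwa [Nat.cast_ofNat, negPow_two hB] at this

lemma resolvent_mem_smoothVectors (hB : 0 ≤ resolvent N) {x : H} (hx : x ∈ smoothVectors N) :
    resolvent N x ∈ smoothVectors N :=
  negPow_two hB ▸ negPow_mem_smoothVectors 2 hx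

lemma exists_negPow_factor (hB : 0 ≤ resolvent N) (hi : Function.Injective (resolvent N))
    {T : H →L[ℂ] H} {l : ℕ} (hT : ∀ x ∈ sobolev N l, T x ∈ sobolev N l) :
    ∃ T' : H →L[ℂ] H, T * negPow N l = negPow N l * T' :=
  exists_factor_of_range (negPow_injective hB hi l.cast_nonneg) fun x =>
    mem_sobolev_iff.1 (hT _ (mem_sobolev_iff.2 ⟨x, rfl⟩))

lemma map_mem_smoothVectors {T : H →L[ℂ] H} (hT : ∀ l, ∀ x ∈ sobolev N l, T x ∈ sobolev N l)
    {x : H} (hx : x ∈ smoothVectors N) : T x ∈ smoothVectors N := by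
  simp only [smoothVectors, Submodule.mem_iInf] at hx ⊢
  exact fun l => hT l x (hx l)

/-- If the form of `R` is dominated by that of `N`, and `[N, R] = (1 + N) T` with `T ∈ OP⁰(N)`, then
`R (1 + N)⁻¹` extends to a bounded operator `R₁`, and `[R₁, (1 + N)⁻¹] = (1 + N)⁻¹ S (1 + N)⁻¹`
where `S` preserves the range of each power of `(1 + N)⁻¹`.

The form bound makes `G = (1 + N)^(-1/2) R (1 + N)^(-1/2)` bounded, and the commutator condition
makes the range of `(1 + N)⁻¹` invariant under `G`. By interpolation the range of
`(1 + N)^(-1/2)` is invariant as well. -/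
theorem exists_bounded_quotient {R : H →ₗ.[ℂ] H} (hp : IsPos N) (hres : IsResolvent N (resolvent N))
    (hB : 0 ≤ resolvent N) (hi : Function.Injective (resolvent N))
    (hRV : ∀ x ∈ smoothVectors N, ∃ hx : x ∈ R.domain, R ⟨x, hx⟩ ∈ smoothVectors N)
    (hform : ∀ x z y z' r, (x, z) ∈ N.graph → (y, z') ∈ N.graph → (y, r) ∈ R.graph →
      ‖⟪x, r⟫_ℂ‖ ^ 2 ≤ (⟪x, z⟫_ℂ).re * (⟪y, z'⟫_ℂ).re)
    (hcomm : MemOP N 2 (opComm N R)) :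
    ∃ R₁ S : H →L[ℂ] H,
      (∀ v ∈ smoothVectors N, (resolvent N v, R₁ v) ∈ R.graph) ∧
      R₁ * resolvent N = resolvent N * (R₁ + S * resolvent N) ∧
      ∀ j : ℕ, ∃ S', S * resolvent N ^ j = resolvent N ^ j * S' := by
  have hd := smoothVectors_dense hB hi
  have hK2 : negPow N 1 * negPow N 1 = resolvent N := by
    rw [← negPow_add N zero_le_one zero_le_one, one_add_one_eq_two, negPow_two hB]
  have hKs := negPow_isSelfAdjoint N 1
  have hKV : ∀ v ∈ smoothVectors N, negPow N 1 v ∈ smoothVectors N := fun v hv =>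
    negPow_mem_smoothVectors 1 hv
  have hK2' : ∀ x, negPow N 1 (negPow N 1 x) = resolvent N x := fun x => by
    rw [← mul_apply_eq_comp, hK2]
  have hKB : ∀ x, negPow N 1 (resolvent N x) = resolvent N (negPow N 1 x) := fun x => by
    rw [← hK2', ← hK2']
  -- the form bound for `K R K`
  have hbound : ∀ v ∈ smoothVectors N, ∀ r ∈ smoothVectors N, (negPow N 1 v, r) ∈ R.graph →
      ‖negPow N 1 r‖ ≤ ‖v‖ := by
    intro v hv r hr hvr
    have hform1 : ∀ u ∈ smoothVectors N, ∃ z, (negPow N 1 u, z) ∈ N.graph ∧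
        (⟪negPow N 1 u, z⟫_ℂ).re ≤ ‖u‖ ^ 2 := by
      intro u hu
      obtain ⟨w, -, hw⟩ := exists_resolvent_eq hB hi (hKV u hu)
      refine ⟨w - negPow N 1 u, hw ▸ hres.mem_graph w, ?_⟩
      have hu' : negPow N 1 w = u := negPow_injective hB hi zero_le_one (by rw [hK2', hw])
      have e1 : ∀ w : H, (⟪w, w⟫_ℂ).re = ‖w‖ ^ 2 := fun w => inner_self_eq_norm_sq (𝕜 := ℂ) w
      rw [inner_sub_right, Complex.sub_re, e1, inner_map_of_selfAdjoint hKs, hu', e1]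
      nlinarith [sq_nonneg ‖negPow N 1 u‖]
    obtain ⟨z, hz, hz'⟩ := hform1 (negPow N 1 r) (hKV r hr)
    obtain ⟨y, hy, hy'⟩ := hform1 v hv
    have h1 := hform _ _ _ _ _ hz hy hvr
    have e2 : ⟪negPow N 1 (negPow N 1 r), r⟫_ℂ = ((‖negPow N 1 r‖ ^ 2 : ℝ) : ℂ) := by
      rw [inner_map_of_selfAdjoint hKs, inner_self_eq_norm_sq_to_K]
      push_cast
      rfl
    rw [e2, Complex.norm_real, Real.norm_of_nonneg (by positivity)] at h1
    by_contra! hlt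
    have h2 : (⟪negPow N 1 (negPow N 1 r), z⟫_ℂ).re * (⟪negPow N 1 v, y⟫_ℂ).re
        ≤ ‖negPow N 1 r‖ ^ 2 * ‖v‖ ^ 2 :=
      mul_le_mul hz' hy' (hp _ _ hy) (by positivity)
    have h3 : 0 < ‖negPow N 1 r‖ := (norm_nonneg v).trans_lt hlt
    have h4 : ‖v‖ ^ 2 < ‖negPow N 1 r‖ ^ 2 := pow_lt_pow_left₀ hlt (norm_nonneg _) two_ne_zero
    nlinarith [pow_pos h3 2]
  let Rm := restrictMap R (smoothVectors N) hRV
  let Km : smoothVectors N →ₗ[ℂ] smoothVectors N :=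
    ((negPow N 1 : H →L[ℂ] H) : H →ₗ[ℂ] H).restrict hKV
  let g : smoothVectors N →ₗ[ℂ] H := (smoothVectors N).subtype ∘ₗ Km ∘ₗ Rm ∘ₗ Km
  have hdr : DenseRange (smoothVectors N).subtype := by
    rw [DenseRange]
    simpa using hd
  let G : H →L[ℂ] H := g.extendOfNorm (smoothVectors N).subtype
  have hG : ∀ v ∈ smoothVectors N, ∃ r ∈ smoothVectors N, (negPow N 1 v, r) ∈ R.graph ∧
      G v = negPow N 1 r := by
    intro v hv
    refine ⟨Rm (Km ⟨v, hv⟩), (Rm (Km ⟨v, hv⟩)).2, restrictMap_mem_graph hRV (Km ⟨v, hv⟩), ?_⟩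
    exact LinearMap.extendOfNorm_eq (f := g) hdr ⟨1, fun x => by
      rw [one_mul]
      exact hbound x x.2 _ (Rm (Km x)).2 (restrictMap_mem_graph hRV (Km x))⟩ ⟨v, hv⟩
  obtain ⟨T, hT, hTcomm⟩ := hcomm
  -- `T B v = R B v - B R v`
  have hTB : ∀ v ∈ smoothVectors N, ∀ r s, (v, r) ∈ R.graph → (resolvent N v, s) ∈ R.graph →
      T (resolvent N v) = s - resolvent N r := by
    intro v hv r s hr hs
    have hx := resolvent_mem_smoothVectors hB hv
    obtain ⟨h1, h2, h3⟩ := hTcomm _ hx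
    obtain ⟨a, b, ha, hb, hab⟩ := mem_graph_sub.1 (mem_graph_mk h1)
    obtain ⟨s', hs', ha'⟩ := mem_graph_opMul.1 ha
    obtain ⟨w, hw, hb'⟩ := mem_graph_opMul.1 hb
    obtain rfl := graph_unique hs hs'
    have hwv : w = v - resolvent N v := graph_unique hw (hres.mem_graph v)
    have hb2 : (v - resolvent N v, r - s) ∈ R.graph := R.graph.sub_mem hr hs
    rw [hwv] at hb'
    obtain rfl := graph_unique hb' hb2
    obtain ⟨u, hu⟩ := mem_posPow_domain.1 h2
    have h4 : posPow N ((2 : ℕ) : ℝ) ⟨T (resolvent N v), h2⟩ = u := by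
      simp only [← hu]
      exact posPow_negPow hB hi (Nat.cast_nonneg _) _ _
    have h5 : u = a - (r - s) := by rw [← h4, ← h3, ← hab]
    have h6 : resolvent N u = T (resolvent N v) := by
      rw [← hu, Nat.cast_ofNat, negPow_two hB]
    have h7 : resolvent N (s + a) = s := hres.apply ha'
    rw [← h6, h5, ← h7, ← map_sub]
    congr 1
    rw [h7]
    abel
  have hTl : ∀ j : ℕ, ∃ T', T * resolvent N ^ j = resolvent N ^ j * T' := fun j => by
    have := exists_negPow_factor hB hi (hT (2 * j)).1
    rwa [negPow_two_mul_natCast hB] at this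
  obtain ⟨Th, hTh⟩ := exists_negPow_factor hB hi (hT 1).1
  rw [Nat.cast_one] at hTh
  obtain ⟨S, hS⟩ := hTl 1
  rw [pow_one] at hS
  have hGB : G * resolvent N = resolvent N * (G + Th * resolvent N) := by
    refine clm_eq_of_eqOn_dense hd fun v hv => ?_
    obtain ⟨r, hr, hvr, hGv⟩ := hG v hv
    obtain ⟨s, hs, hvs, hGs⟩ := hG _ (resolvent_mem_smoothVectors hB hv)
    rw [hKB] at hvs
    have h1 := hTB _ (hKV v hv) _ _ hvr hvs
    have h2 : T (resolvent N (negPow N 1 v)) = negPow N 1 (Th (resolvent N v)) := by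
      rw [← hKB, ← mul_apply_eq_comp T, hTh, mul_apply_eq_comp]
    simp only [mul_apply_eq_comp, add_apply, map_add]
    rw [hGs, hGv, ← hKB, ← hK2' (Th _), ← map_add, ← h2, h1]
    congr 1
    abel
  obtain ⟨R₁, hR₁⟩ := exists_half_factor hB hGB
  have hR₁' : G * negPow N 1 = negPow N 1 * R₁ := hR₁
  have hgraph : ∀ v ∈ smoothVectors N, (resolvent N v, R₁ v) ∈ R.graph := by
    intro v hv
    obtain ⟨r, hr, hvr, hGv⟩ := hG _ (hKV v hv)
    rw [hK2'] at hvr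
    have h1 : negPow N 1 (R₁ v) = negPow N 1 r := by
      rw [← hGv, ← mul_apply_eq_comp, ← hR₁', mul_apply_eq_comp]
    rwa [negPow_injective hB hi zero_le_one h1]
  refine ⟨R₁, S, hgraph, ?_, fun j => ?_⟩
  · refine clm_eq_of_eqOn_dense hd fun v hv => ?_
    have hBv := resolvent_mem_smoothVectors hB hv
    have h1 := hTB _ hBv _ _ (hgraph v hv) (hgraph _ hBv)
    have h2 : T (resolvent N (resolvent N v)) = resolvent N (S (resolvent N v)) := by
      rw [← mul_apply_eq_comp T, hS, mul_apply_eq_comp]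
    simp only [mul_apply_eq_comp, add_apply, map_add]
    rw [← h2, h1]
    abel
  · obtain ⟨T', hT'⟩ := hTl (j + 1)
    refine ⟨T', mul_left_cancel_of_injective hi ?_⟩
    rw [← mul_assoc, ← hS, mul_assoc, ← pow_succ', hT', pow_succ', mul_assoc]

end SmoothVectors

section WickResolvent

variable {H : Type*} [NormedAddCommGroup H] [InnerProductSpace ℂ H]

/-! ### The resolvent of `D_E²` -/

lemma IsSymm.opMul_self {T : H →ₗ.[ℂ] H} (hT : IsSymm T) : IsSymm (opMul T T) := by
  intro x x' y y' hx hy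
  obtain ⟨u, hxu, hux⟩ := mem_graph_opMul.1 hx
  obtain ⟨v, hyv, hvy⟩ := mem_graph_opMul.1 hy
  rw [hT _ _ _ _ hux hyv, hT _ _ _ _ hxu hvy]

lemma IsSymm.isPos_opMul_self {T : H →ₗ.[ℂ] H} (hT : IsSymm T) : IsPos (opMul T T) := by
  intro x x' hx
  obtain ⟨u, hxu, hux⟩ := mem_graph_opMul.1 hx
  rw [← hT _ _ _ _ hxu hux]
  exact inner_self_nonneg (𝕜 := ℂ)

lemma IsBddRatio.isResolvent {N M : H →ₗ.[ℂ] H} {B : H →L[ℂ] H} (hB : IsResolvent N B)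
    (hM : IsPos M) (h : IsBddRatio N M) : ∃ X : H →L[ℂ] H, IsResolvent M (B * X) := by
  obtain ⟨X, hX⟩ := h
  have key : ∀ y, (B (X y), y - B (X y)) ∈ M.graph := by
    intro y
    obtain ⟨z, hzM, hzN, h1, h2⟩ := hX y
    have e : B (X y) = z := by rw [← h2]; exact hB.2 ⟨z, hzN⟩
    rw [e, ← eq_sub_iff_add_eq'.2 h1]
    exact mem_graph_mk hzM
  refine ⟨X, fun y => ?_, fun x => ?_⟩
  · obtain ⟨h1, h2⟩ := exists_eq_of_mem_graph (key y)
    exact ⟨h1, eq_sub_iff_add_eq'.1 h2⟩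
  · have h1 := M.graph.sub_mem (key ((x : H) + M x)) (M.mem_graph x)
    have h2 := norm_le_of_isPos hM (x := B (X ((x : H) + M x)) - x)
      (x' := (x : H) + M x - B (X ((x : H) + M x)) - M x) h1
    have e : B (X ((x : H) + M x)) - x + ((x : H) + M x - B (X ((x : H) + M x)) - M x) = 0 := by
      abel
    rw [e, norm_zero, norm_le_zero_iff, sub_eq_zero] at h2
    exact h2

variable [CompleteSpace H]

lemma negPow_le_one {N : H →ₗ.[ℂ] H} (hB : resolvent N ≤ 1) : negPow N 1 ≤ 1 := by
  have h := CFC.rpow_le_rpow (p := 1 / 2) (by norm_num) hB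
  rwa [CFC.one_rpow] at h

/-- `(1 + N)⁻¹` and `(1 + M)⁻¹` are positive and injective, and each power `r ≥ 0` of one has the same
range as that of the other. The equality of ranges is expressed by bounded right factors. -/
structure IsComparable (N M : H →ₗ.[ℂ] H) : Prop where
  nonneg : 0 ≤ resolvent N
  injective : Function.Injective (resolvent N)
  nonneg' : 0 ≤ resolvent M
  injective' : Function.Injective (resolvent M)
  exists_factor : ∀ r : ℝ, 0 ≤ r → ∃ Y : H →L[ℂ] H, negPow M r = negPow N r * Y
  exists_factor' : ∀ r : ℝ, 0 ≤ r → ∃ Y : H →L[ℂ] H, negPow N r = negPow M r * Y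

lemma IsComparable.symm {N M : H →ₗ.[ℂ] H} (h : IsComparable N M) : IsComparable M N :=
  ⟨h.nonneg', h.injective', h.nonneg, h.injective, h.exists_factor', h.exists_factor⟩

lemma IsComparable.smoothVectors_le {N M : H →ₗ.[ℂ] H} (h : IsComparable N M) :
    smoothVectors M ≤ smoothVectors N := by
  intro x hx
  refine mem_smoothVectors_iff.2 fun l => ?_
  obtain ⟨u, rfl⟩ := mem_smoothVectors_iff.1 hx l
  obtain ⟨Y, hY⟩ := h.exists_factor l l.cast_nonneg
  exact ⟨Y u, by rw [hY, mul_apply_eq_comp]⟩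

lemma IsComparable.smoothVectors_eq {N M : H →ₗ.[ℂ] H} (h : IsComparable N M) :
    smoothVectors M = smoothVectors N :=
  le_antisymm h.smoothVectors_le h.symm.smoothVectors_le

variable {A : Type*} [NonUnitalRing A] [StarRing A] [Module ℂ A]
  {π : A →⋆ₙₐ[ℂ] (H →L[ℂ] H)} {D : H →ₗ.[ℂ] H}

lemma IsPseudoRiemannianTriple.isResolvent (h : IsPseudoRiemannianTriple π D) :
    IsResolvent (absSq D) (resolvent (absSq D)) := by
  obtain ⟨B, hB⟩ := exists_isResolvent h.absSq_selfAdjoint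
    (absSq_isPos h.dense h.absSq_dense h.closed)
  rwa [hB.resolvent_eq]

lemma IsPseudoRiemannianTriple.wick_isSelfAdjoint (h : IsPseudoRiemannianTriple π D)
    (hratio : IsBddRatio (absSq D) (opMul (wick D) (wick D))) : IsSelfAdjoint (wick D) := by
  refine (wick_isSymm h.dense h.absSq_dense).isSelfAdjoint_of_surjective
    (wick_dense h.absSq_dense) fun y => ?_
  obtain ⟨X, hX⟩ := hratio
  obtain ⟨z, hM, hN, h1, h2⟩ := hX y
  obtain ⟨w, h3, h4⟩ := mem_graph_opMul.1 (mem_graph_mk hM)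
  exact ⟨z, w, _, h3, h4, h1⟩

lemma IsPseudoRiemannianTriple.isResolvent_wick_sq (h : IsPseudoRiemannianTriple π D)
    (hratio : IsBddRatio (absSq D) (opMul (wick D) (wick D))) :
    ∃ X : H →L[ℂ] H, resolvent (opMul (wick D) (wick D)) = resolvent (absSq D) * X ∧
      IsResolvent (opMul (wick D) (wick D)) (resolvent (opMul (wick D) (wick D))) := by
  obtain ⟨X, hX⟩ := hratio.isResolvent h.isResolvent
    (wick_isSymm h.dense h.absSq_dense).isPos_opMul_self
  exact ⟨X, hX.resolvent_eq, by rwa [hX.resolvent_eq]⟩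

/-- The powers of `1 + ⟨D⟩²` and of `1 + D_E²` have the same domains. -/
theorem IsPseudoRiemannianTriple.isComparable (h : IsPseudoRiemannianTriple π D)
    (hratio : IsBddRatio (absSq D) (opMul (wick D) (wick D))) :
    IsComparable (absSq D) (opMul (wick D) (wick D)) := by
  have hpos := absSq_isPos h.dense h.absSq_dense h.closed
  have hres := h.isResolvent
  have hB := hres.nonneg (IsSymm.of_isSelfAdjoint h.absSq_selfAdjoint) hpos
  have hi := hres.injective
  obtain ⟨X, hX, hres'⟩ := h.isResolvent_wick_sq hratio
  have hsymm := wick_isSymm h.dense h.absSq_dense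
  have hB' := hres'.nonneg hsymm.opMul_self hsymm.isPos_opMul_self
  have hi' := hres'.injective
  obtain ⟨R, S, hgraph, hR, hS⟩ := exists_bounded_quotient hpos hres hB hi h.remainder_maps
    (fun x z y z' r => norm_inner_remainder_le h.dense h.absSq_dense h.closed) h.comm_remainder
  have hZ : resolvent (absSq D) = resolvent (opMul (wick D) (wick D)) * (1 + R) := by
    refine clm_eq_of_eqOn_dense (smoothVectors_dense hB hi) fun v hv => ?_
    have h1 := hres'.apply (wick_sq h.dense h.absSq_dense h.closed
      (h.wick_isSelfAdjoint hratio) (hres.mem_graph v) (hgraph v hv))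
    rw [← add_assoc, add_sub_cancel] at h1
    rw [mul_apply_eq_comp, add_apply, one_apply_eq_self, h1]
  obtain ⟨h1, h2⟩ := exists_pow_factor hB hB' hi hi' hX hZ hR hS
  exact ⟨hB, hi, hB', hi', fun r hr => exists_rpow_factor hB hB' h1 (by positivity),
    fun r hr => exists_rpow_factor hB' hB h2 (by positivity)⟩

end WickResolvent

section Transfer

variable {H : Type*} [NormedAddCommGroup H] [InnerProductSpace ℂ H] [CompleteSpace H]
  {N M : H →ₗ.[ℂ] H} {p : ℝ}

/-! ### Transferring integrability and summability between comparable operators -/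

/-- If `(1 + M)^(-n/2) = (1 + N)^(-n/2) X`, then `X` maps the range of each power of `(1 + M)⁻¹` to the
range of the same power of `(1 + N)⁻¹`. -/
lemma IsComparable.commute_factor (h : IsComparable N M) {n : ℕ} {X : H →L[ℂ] H}
    (hX : negPow M n = negPow N n * X) {r : ℝ} (hr : 0 ≤ r) :
    ∃ Y : H →L[ℂ] H, X * negPow M r = negPow N r * Y := by
  obtain ⟨Y, hY⟩ := h.exists_factor (n + r) (by positivity)
  refine ⟨Y, mul_left_cancel_of_injective (negPow_injective h.nonneg h.injective n.cast_nonneg) ?_⟩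
  rw [← mul_assoc, ← hX, ← negPow_add M n.cast_nonneg hr, hY, negPow_add N n.cast_nonneg hr,
    mul_assoc]

lemma IsComparable.exists_B2Bound_right (h : IsComparable N M) (hp : 0 ≤ p) {n : ℕ}
    {X : H →L[ℂ] H} (hX : negPow M n = negPow N n * X) :
    ∃ C : ℕ → ℝ, (∀ k, 0 ≤ C k) ∧ B2Bound N M p C (fun b => b * X) := by
  have h1 : ∀ r : ℝ, ∃ Y : H →L[ℂ] H, 0 ≤ r → negPow M r = negPow N r * Y := fun r => by
    by_cases hr : 0 ≤ r
    · exact (h.exists_factor r hr).imp fun Y hY _ => hY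
    · exact ⟨0, fun h => absurd h hr⟩
  have h2 : ∀ r : ℝ, ∃ Y : H →L[ℂ] H, 0 ≤ r → X * negPow M r = negPow N r * Y := fun r => by
    by_cases hr : 0 ≤ r
    · exact (h.commute_factor hX hr).imp fun Y hY _ => hY
    · exact ⟨0, fun h => absurd h hr⟩
  choose Y hY using h1
  choose Z hZ using h2
  let c : ℝ → ℝ := fun s => ‖Z (s / 2)‖ + ‖X‖ * ‖Y (s / 2)‖
  have hc : ∀ s, 0 ≤ c s := fun s => by positivity
  refine ⟨fun k => ‖X‖ + c (p + 1 / ((k : ℝ) + 1)), fun k => add_nonneg (norm_nonneg _) (hc _),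
    B2Bound.of_hsSq (c₀ := ‖X‖) (c := c) (norm_nonneg _) hc
      (fun k => ⟨le_add_of_nonneg_right (hc _), le_add_of_nonneg_left (norm_nonneg _)⟩)
      (fun a => (norm_mul_le _ _).trans_eq (mul_comm _ _)) (fun s hs a => ?_) fun s hs a => ?_⟩
  · have hs0 : 0 ≤ s / 2 := by linarith
    rw [mul_assoc, hZ _ hs0, ← mul_assoc]
    refine (hsSq_mul_right_le _ _).trans (mul_le_mul_left (ENNReal.ofReal_le_ofReal ?_) _)
    exact pow_le_pow_left₀ (norm_nonneg _) (le_add_of_nonneg_right (by positivity)) 2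
  · have hs0 : 0 ≤ s / 2 := by linarith
    rw [star_mul, hY _ hs0, mul_assoc, ← mul_assoc (star a)]
    refine (hsSq_mul_left_le _ _).trans ((mul_le_mul_right (hsSq_mul_right_le _ _) _).trans ?_)
    rw [← mul_assoc, ← ENNReal.ofReal_mul (by positivity), norm_star, ← mul_pow]
    refine mul_le_mul_left (ENNReal.ofReal_le_ofReal ?_) _
    exact pow_le_pow_left₀ (by positivity) (le_add_of_nonneg_left (norm_nonneg _)) 2

lemma IsComparable.exists_B2Bound_id (h : IsComparable N M) (hp : 0 ≤ p) :
    ∃ C : ℕ → ℝ, (∀ k, 0 ≤ C k) ∧ B2Bound N M p C (fun a => 1 * a) := by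
  have hX : negPow M ((0 : ℕ) : ℝ) = negPow N ((0 : ℕ) : ℝ) * 1 := by
    rw [Nat.cast_zero, negPow_zero h.nonneg, negPow_zero h.nonneg', mul_one]
  simpa using h.exists_B2Bound_right hp hX

lemma IsComparable.mul_mem_B1 (h : IsComparable N M) (hp : 0 ≤ p) {n : ℕ}
    {X : H →L[ℂ] H} (hX : negPow M n = negPow N n * X) {W : H →L[ℂ] H} (hW : W ∈ B1 N p) :
    W * X ∈ B1 M p := by
  obtain ⟨C, hC, hCB⟩ := h.exists_B2Bound_id hp
  obtain ⟨C', hC', hCB'⟩ := h.exists_B2Bound_right hp hX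
  simpa using B1_mul_mul hC hC' hCB hCB' hW

lemma IsComparable.isTraceClass (h : IsComparable N M) {T : H →L[ℂ] H} {s : ℝ} (hs : 0 ≤ s)
    (hT : IsTraceClass (T * negPow N s)) : IsTraceClass (T * negPow M s) := by
  obtain ⟨Y, hY⟩ := h.exists_factor s hs
  rw [hY, ← mul_assoc]
  exact hT.mul_right Y

variable {A : Type*} [NonUnitalRing A] [StarRing A] [Module ℂ A]
  {π : A →⋆ₙₐ[ℂ] (H →L[ℂ] H)}

lemma IsComparable.isFinitelySummable (h : IsComparable N M) (hN : IsFinitelySummable π N) :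
    IsFinitelySummable π M := by
  obtain ⟨s, hs, hT⟩ := hN
  exact ⟨s, hs, fun a => h.isTraceClass hs.le (hT a)⟩

lemma IsComparable.spectralDim_eq (h : IsComparable N M) : spectralDim π M = spectralDim π N := by
  unfold spectralDim
  congr 1
  ext s
  exact ⟨fun hs => ⟨hs.1, fun a => h.symm.isTraceClass hs.1.le (hs.2 a)⟩,
    fun hs => ⟨hs.1, fun a => h.isTraceClass hs.1.le (hs.2 a)⟩⟩

lemma spectralDim_nonneg : 0 ≤ spectralDim π N :=
  Real.sInf_nonneg fun _ hs => hs.1.le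

lemma IsComparable.isCompactOperator (h : IsComparable N M) {T : H →L[ℂ] H}
    (hT : IsCompactOperator (T * negPow N 1)) : IsCompactOperator (T * negPow M 1) := by
  obtain ⟨Y, hY⟩ := h.exists_factor 1 zero_le_one
  rw [hY, ← mul_assoc]
  exact hT.comp_clm Y

/-! ### Chains of commutators with `⟨D⟩² + R_D` -/

variable {D : H →ₗ.[ℂ] H}

/-- The span of the restrictions to `H_∞` of the elements of `S^n`. -/
noncomputable def commSpan (π : A →⋆ₙₐ[ℂ] (H →L[ℂ] H)) (D : H →ₗ.[ℂ] H) (n : ℕ) :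
    Submodule ℂ (Module.End ℂ (smoothVectors (absSq D))) :=
  Submodule.span ℂ {f | ∃ s ∈ commSet π D n,
    ∀ x : smoothVectors (absSq D), ((x : H), (f x : H)) ∈ s.graph}

lemma comm_mem_commSpan {F G : Module.End ℂ (smoothVectors (absSq D))}
    (hF : ∀ x : smoothVectors (absSq D), ((x : H), (F x : H)) ∈ (absSq D).graph)
    (hG : ∀ x : smoothVectors (absSq D), ((x : H), (G x : H)) ∈ (remainder D).graph) {n : ℕ}
    {f : Module.End ℂ (smoothVectors (absSq D))} (hf : f ∈ commSpan π D n) :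
    (F + G) * f - f * (F + G) ∈ commSpan π D (n + 1) := by
  induction hf using Submodule.span_induction with
  | mem f hf =>
    obtain ⟨s, hs, hfs⟩ := hf
    have e : (F + G) * f - f * (F + G) = (F * f - f * F) + (G * f - f * G) := by noncomm_ring
    rw [e]
    refine Submodule.add_mem _ (Submodule.subset_span ?_) (Submodule.subset_span ?_)
    · exact ⟨_, ⟨s, hs, Or.inl rfl⟩, fun x => mem_graph_sub.2 ⟨_, _,
        mem_graph_opMul.2 ⟨_, hfs x, hF _⟩, mem_graph_opMul.2 ⟨_, hF x, hfs _⟩, rfl⟩⟩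
    · exact ⟨_, ⟨s, hs, Or.inr rfl⟩, fun x => mem_graph_sub.2 ⟨_, _,
        mem_graph_opMul.2 ⟨_, hfs x, hG _⟩, mem_graph_opMul.2 ⟨_, hG x, hfs _⟩, rfl⟩⟩
  | zero => simp
  | add f g _ _ hf hg =>
    have e : (F + G) * (f + g) - (f + g) * (F + G) =
        ((F + G) * f - f * (F + G)) + ((F + G) * g - g * (F + G)) := by noncomm_ring
    rw [e]
    exact Submodule.add_mem _ hf hg
  | smul c f _ hf =>
    rw [mul_smul_comm, smul_mul_assoc, ← smul_sub]
    exact Submodule.smul_mem _ c hf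

lemma B1_of_B1inf {T : H →L[ℂ] H} (hT : T ∈ B1inf N p) : T ∈ B1 N p := by
  obtain ⟨S, hS, hTS⟩ := (Set.mem_iInter.1 hT 0 0 le_rfl).2
  rwa [show S = T from hTS] at hS

lemma B1inf_map_smooth {T : H →L[ℂ] H} (hT : T ∈ B1inf N p) {x : H} (hx : x ∈ smoothVectors N) :
    T x ∈ smoothVectors N :=
  map_mem_smoothVectors (fun l => (Set.mem_iInter.1 hT l l le_rfl).1) hx

lemma MemTame.exists_apply (hB : 0 ≤ resolvent N) (hi : Function.Injective (resolvent N)) {n : ℕ}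
    {S : H →ₗ.[ℂ] H} (h : MemTame N p n S) :
    ∃ T ∈ B1inf N p, ∀ u ∈ smoothVectors N, (negPow N n u, T u) ∈ S.graph := by
  obtain ⟨T, hT, hTS⟩ := h
  refine ⟨T, hT, fun u hu => ?_⟩
  obtain ⟨h1, h2, h3⟩ := hTS _ (negPow_mem_smoothVectors n hu)
  rw [posPow_negPow hB hi n.cast_nonneg] at h3
  exact h3 ▸ mem_graph_mk h1

/-- If a restriction of the bounded operator `C` is in `B₁^∞`, as an operator on `H_∞`, then `C` is in
`B₁^∞`, by density of `H_∞`. -/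
lemma MemTame.mem_B1inf (hB : 0 ≤ resolvent N) (hi : Function.Injective (resolvent N))
    {S : H →ₗ.[ℂ] H} (h : MemTame N p 0 S) {C : H →L[ℂ] H}
    (hC : ∀ x y, (x, y) ∈ S.graph → y = C x) :
    C ∈ B1inf N p ∧ ∀ x ∈ smoothVectors N, (x, C x) ∈ S.graph := by
  obtain ⟨T, hT, hTS⟩ := h.exists_apply hB hi
  have h0 : ∀ x ∈ smoothVectors N, (x, T x) ∈ S.graph := fun x hx => by
    have := hTS x hx
    rwa [Nat.cast_zero, negPow_zero hB, one_apply_eq_self] at this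
  have e : T = C := clm_eq_of_eqOn_dense (smoothVectors_dense hB hi) fun x hx => hC _ _ (h0 x hx)
  exact ⟨e ▸ hT, e ▸ h0⟩

/-- Elements of the span of `S^n` lie in `B₁(N, p) (1 + N)^(n/2)`, for `N = ⟨D⟩²`. -/
lemma exists_B1_of_mem_commSpan (hB : 0 ≤ resolvent (absSq D))
    (hi : Function.Injective (resolvent (absSq D)))
    (hs : ∀ n, ∀ s ∈ commSet π D n, MemTame (absSq D) p n s) {n : ℕ}
    {f : Module.End ℂ (smoothVectors (absSq D))} (hf : f ∈ commSpan π D n) :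
    ∃ W ∈ B1 (absSq D) p, ∀ u : smoothVectors (absSq D),
      (f ⟨negPow (absSq D) n u, negPow_mem_smoothVectors n u.2⟩ : H) = W u := by
  induction hf using Submodule.span_induction with
  | mem f hf =>
    obtain ⟨s, hsn, hfs⟩ := hf
    obtain ⟨T, hT, hTs⟩ := (hs n s hsn).exists_apply hB hi
    exact ⟨T, B1_of_B1inf hT, fun u => graph_unique (hfs _) (hTs u u.2)⟩
  | zero =>
    obtain ⟨T, hT, -⟩ := hs 0 _ ⟨0, Or.inl rfl⟩
    exact ⟨0, by simpa using B1_smul (B1_of_B1inf hT) 0, fun u => by simp⟩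
  | add f g _ _ hf hg =>
    obtain ⟨W, hW, hfW⟩ := hf
    obtain ⟨W', hW', hgW⟩ := hg
    exact ⟨W + W', B1_add hW hW', fun u => by
      rw [LinearMap.add_apply, Submodule.coe_add, hfW, hgW, add_apply]⟩
  | smul c f _ hf =>
    obtain ⟨W, hW, hfW⟩ := hf
    exact ⟨c • W, B1_smul hW c, fun u => by
      rw [LinearMap.smul_apply, Submodule.coe_smul, hfW, smul_apply]⟩

/-- A bounded operator given by an element of the span of `S⁰` is regular for `M = ⟨D⟩² + R_D`, because
the iterated commutators with `M` lie in the spans of the `S^n`. -/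
theorem isRegular_of_mem_commSpan (h : IsComparable (absSq D) M) (hp : 0 ≤ p)
    (hres : IsResolvent M (resolvent M))
    (hs : ∀ n, ∀ s ∈ commSet π D n, MemTame (absSq D) p n s)
    {F G : Module.End ℂ (smoothVectors (absSq D))}
    (hF : ∀ x : smoothVectors (absSq D), ((x : H), (F x : H)) ∈ (absSq D).graph)
    (hG : ∀ x : smoothVectors (absSq D), ((x : H), (G x : H)) ∈ (remainder D).graph)
    (hFG : ∀ x : smoothVectors (absSq D), ((x : H), ((F + G) x : H)) ∈ M.graph)
    {f : Module.End ℂ (smoothVectors (absSq D))} (hf : f ∈ commSpan π D 0) {T : H →L[ℂ] H}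
    (hT : ∀ x : smoothVectors (absSq D), (f x : H) = T x) : IsRegular M p T := by
  have hd := smoothVectors_dense h.nonneg h.injective
  have hV : ∀ r, ∀ x ∈ smoothVectors (absSq D), negPow M r x ∈ smoothVectors (absSq D) :=
    fun r x hx => h.smoothVectors_eq ▸ negPow_mem_smoothVectors r (h.smoothVectors_eq.symm ▸ hx)
  let g : ℕ → Module.End ℂ (smoothVectors (absSq D)) := fun n =>
    Nat.rec f (fun _ a => (F + G) * a - a * (F + G)) n
  have hg : ∀ n, g n ∈ commSpan π D n := fun n => by
    induction n with
    | zero => exact hf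
    | succ n ih => exact comm_mem_commSpan hF hG ih
  choose W hW hgW using fun n => exists_B1_of_mem_commSpan h.nonneg h.injective hs (hg n)
  choose X hX using fun n : ℕ => h.exists_factor n n.cast_nonneg
  have hXV : ∀ n, ∀ u ∈ smoothVectors (absSq D), X n u ∈ smoothVectors (absSq D) := by
    intro n u hu
    obtain ⟨v, hv, hvu⟩ := exists_negPow_eq h.nonneg h.injective n (hV n u hu)
    rw [hX, mul_apply_eq_comp] at hvu
    rwa [← negPow_injective h.nonneg h.injective n.cast_nonneg hvu]
  -- `g n = (W n * X n) (1 + M)^(n/2)` on `H_∞`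
  have hgt : ∀ n (u : H) (hu : u ∈ smoothVectors (absSq D)),
      (g n ⟨negPow M n u, hV n u hu⟩ : H) = (W n * X n) u := by
    intro n u hu
    rw [mul_apply_eq_comp, ← hgW n ⟨X n u, hXV n u hu⟩]
    congr 2
    exact Subtype.ext (DFunLike.congr_fun (hX n) u)
  have hK2 : negPow M 1 * negPow M 1 = resolvent M := by
    rw [← negPow_add M zero_le_one zero_le_one, one_add_one_eq_two, negPow_two h.nonneg']
  refine ⟨fun n => W n * X n, ?_, fun n => h.mul_mem_B1 hp (hX n) (hW n), fun n => ?_⟩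
  · refine clm_eq_of_eqOn_dense hd fun u hu => ?_
    rw [← hgt 0 u hu, show g 0 = f from rfl, hT]
    simp [negPow_zero h.nonneg']
  · rw [hK2]
    refine clm_eq_of_eqOn_dense hd fun v hv => ?_
    have hBV : ∀ x ∈ smoothVectors (absSq D), resolvent M x ∈ smoothVectors (absSq D) :=
      fun x hx => negPow_two h.nonneg' ▸ hV 2 x hx
    set w : smoothVectors (absSq D) := ⟨negPow M n v, hV n v hv⟩ with hw
    set x : smoothVectors (absSq D) := ⟨resolvent M w, hBV w w.2⟩ with hx
    have hcomm : ∀ r, negPow M r (resolvent M v) = resolvent M (negPow M r v) := fun r => by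
      rw [← negPow_two h.nonneg', ← mul_apply_eq_comp, (negPow_commute M r 2).eq,
        mul_apply_eq_comp]
    have e1 : (W n * X n) (resolvent M v) = g n x := by
      rw [← hgt n _ (hBV v hv)]
      congr 2
      exact Subtype.ext (hcomm n)
    have e2 : (W n * X n) v = g n w := (hgt n v hv).symm
    have e3 : (W (n + 1) * X (n + 1)) (negPow M 1 v) = g (n + 1) x := by
      rw [← hgt (n + 1) _ (hV 1 v hv)]
      congr 2
      refine Subtype.ext ?_
      change negPow M ((n + 1 : ℕ) : ℝ) (negPow M 1 v) = resolvent M (negPow M n v)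
      rw [Nat.cast_succ, negPow_add M n.cast_nonneg zero_le_one, mul_apply_eq_comp,
        ← mul_apply_eq_comp (negPow M 1), hK2, hcomm]
    have hwx : w = x + (F + G) x := by
      refine Subtype.ext ?_
      have := graph_unique (hFG x) (hres.mem_graph w)
      rw [Submodule.coe_add, this, hx, add_sub_cancel]
    have hinv : ∀ y : smoothVectors (absSq D), resolvent M ((y : H) + ((F + G) y : H)) = y :=
      fun y => hres.apply (hFG y)
    have hg1 : g (n + 1) x = (F + G) (g n x) - g n ((F + G) x) := rfl
    rw [sub_apply, mul_apply_eq_comp (W n * X n), mul_apply_eq_comp (resolvent M),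
      mul_apply_eq_comp (_ * _), mul_apply_eq_comp (resolvent M), e1, e2, e3, hg1,
      ← hinv (g n x), ← map_sub]
    congr 1
    conv_lhs => rw [hwx, map_add]
    rw [Submodule.coe_add, Submodule.coe_sub]
    abel

end Transfer

section WickTriple

variable {H : Type*} [NormedAddCommGroup H] [InnerProductSpace ℂ H]

/-! ### The Wick rotated triple -/

lemma eq_of_mem_graph_opComm {S : H →ₗ.[ℂ] H} {T C : H →L[ℂ] H} (h : IsBddComm S T C) {x y : H}
    (hxy : (x, y) ∈ (opComm S (ofBdd T)).graph) : y = C x := by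
  obtain ⟨a, b, ha, hb, rfl⟩ := mem_graph_sub.1 hxy
  obtain ⟨u, hu, ha⟩ := mem_graph_opMul.1 ha
  obtain ⟨v, hv, hb⟩ := mem_graph_opMul.1 hb
  obtain rfl := mem_graph_ofBdd.1 hu
  obtain rfl := mem_graph_ofBdd.1 hb
  rw [graph_unique ha (isBddComm_iff.1 h _ _ hv), add_sub_cancel_left]

variable [CompleteSpace H] {A : Type*} [NonUnitalRing A] [StarRing A] [Module ℂ A]
  {π : A →⋆ₙₐ[ℂ] (H →L[ℂ] H)} {D : H →ₗ.[ℂ] H}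

/-- Linear combinations of (the bounded extensions of) elements of `S⁰` are smooth for `D_E²`. -/
lemma IsSmoothlySummablePR.mem_B1inf_of_combination (h : IsSmoothlySummablePR π D)
    (hratio : IsBddRatio (absSq D) (opMul (wick D) (wick D))) {ι : Type*} (t : Finset ι)
    {S : ι → (H →ₗ.[ℂ] H)} (hS : ∀ i, S i ∈ commSet π D 0) {C : ι → (H →L[ℂ] H)}
    (hC : ∀ i x y, (x, y) ∈ (S i).graph → y = C i x) (c : ι → ℂ) :
    ∑ i ∈ t, c i • C i ∈ B1inf (opMul (wick D) (wick D)) (spectralDim π (absSq D)) := by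
  have hcmp := h.isTriple.isComparable hratio
  have ht := h.isTriple
  obtain ⟨-, -, hres⟩ := ht.isResolvent_wick_sq hratio
  have hsymm := wick_isSymm ht.dense ht.absSq_dense
  have hle := hres.le_one hsymm.opMul_self hsymm.isPos_opMul_self
  have hN : ∀ x ∈ smoothVectors (absSq D), ∃ hx : x ∈ (absSq D).domain,
      absSq D ⟨x, hx⟩ ∈ smoothVectors (absSq D) := by
    intro x hx
    obtain ⟨u, hu, rfl⟩ := exists_resolvent_eq hcmp.nonneg hcmp.injective hx
    obtain ⟨h1, h2⟩ := exists_eq_of_mem_graph (ht.isResolvent.mem_graph u)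
    exact ⟨h1, h2 ▸ sub_mem hu hx⟩
  have hmem := fun i => (h.smooth 0 _ (hS i)).mem_B1inf hcmp.nonneg hcmp.injective (hC i)
  let f : ι → Module.End ℂ (smoothVectors (absSq D)) := fun i =>
    (C i : H →ₗ[ℂ] H).restrict fun x hx => B1inf_map_smooth (hmem i).1 hx
  have hf : ∑ i ∈ t, c i • f i ∈ commSpan π D 0 :=
    Submodule.sum_mem _ fun i _ => Submodule.smul_mem _ _
      (Submodule.subset_span ⟨S i, hS i, fun x => (hmem i).2 x x.2⟩)
  have hF := restrictMap_mem_graph hN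
  have hG := restrictMap_mem_graph ht.remainder_maps
  refine (isRegular_of_mem_commSpan hcmp spectralDim_nonneg hres h.smooth hF hG (fun x => ?_) hf
    fun x => ?_).mem_B1inf hcmp.nonneg' hcmp.injective' (negPow_le_one hle)
  · exact wick_sq ht.dense ht.absSq_dense ht.closed (ht.wick_isSelfAdjoint hratio) (hF x) (hG x)
  · simp only [LinearMap.sum_apply, Submodule.coe_sum, sum_apply, LinearMap.smul_apply,
      Submodule.coe_smul, smul_apply]
    rfl

end WickTriple

end WickRotation

theorem theorem5p6 {H : Type*} [NormedAddCommGroup H] [InnerProductSpace ℂ H] [CompleteSpace H]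
    {A : Type*} [NonUnitalRing A] [StarRing A] [Module ℂ A] [IsScalarTower ℂ A A]
    [SMulCommClass ℂ A A] [StarModule ℂ A]
    (π : A →⋆ₙₐ[ℂ] (H →L[ℂ] H)) (D : H →ₗ.[ℂ] H)
    (hsmooth : WickRotation.IsSmoothlySummablePR π D)
    (hratio : WickRotation.IsBddRatio (WickRotation.absSq D)
      (WickRotation.opMul (WickRotation.wick D) (WickRotation.wick D))) :
    WickRotation.IsSmoothlySummable π (WickRotation.wick D) ∧
      WickRotation.spectralDim π
          (WickRotation.opMul (WickRotation.wick D) (WickRotation.wick D)) =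
        WickRotation.spectralDim π (WickRotation.absSq D) := by
  have ht := hsmooth.isTriple
  have hcmp := ht.isComparable hratio
  have hdim := hcmp.spectralDim_eq (π := π)
  have hcomm : ∀ a, ∃ C C', WickRotation.IsBddComm D (π a) C ∧
      WickRotation.IsBddComm D.adjoint (π a) C' := fun a => by
    obtain ⟨C, hC⟩ := ht.comm_bdd a
    obtain ⟨C', hC'⟩ := ht.comm_adjoint_bdd a
    exact ⟨C, C', hC, hC'⟩
  refine ⟨⟨⟨ht.wick_isSelfAdjoint hratio, fun a => ?_, fun a => hcmp.isCompactOperator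
    (ht.compact a)⟩, hcmp.isFinitelySummable hsmooth.finitelySummable, fun a => ?_, fun a => ?_⟩,
    hdim⟩
  · obtain ⟨C, C', hC, hC'⟩ := hcomm a
    exact ⟨_, WickRotation.wick_isBddComm ht.dense ht.absSq_dense hC hC'⟩
  · rw [hdim]
    have := hsmooth.mem_B1inf_of_combination hratio (ι := Unit) Finset.univ
      (S := fun _ => WickRotation.ofBdd (π a)) (fun _ => ⟨a, Or.inl rfl⟩) (C := fun _ => π a)
      (fun _ x y hxy => (WickRotation.mem_graph_ofBdd.1 hxy).symm) fun _ => 1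
    simpa using this
  · obtain ⟨C, C', hC, hC'⟩ := hcomm a
    refine ⟨_, ?_, WickRotation.wick_isBddComm ht.dense ht.absSq_dense hC hC'⟩
    rw [hdim]
    have := hsmooth.mem_B1inf_of_combination hratio (ι := Bool) Finset.univ
      (S := fun i => bif i then WickRotation.opComm D (WickRotation.ofBdd (π a))
        else WickRotation.opComm D.adjoint (WickRotation.ofBdd (π a)))
      (Bool.rec ⟨a, Or.inr (Or.inr rfl)⟩ ⟨a, Or.inr (Or.inl rfl)⟩)
      (C := fun i => bif i then C else C')
      (Bool.rec (fun x y hxy => WickRotation.eq_of_mem_graph_opComm hC' hxy)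
        fun x y hxy => WickRotation.eq_of_mem_graph_opComm hC hxy)
      fun i => bif i then 1 / 2 + Complex.I / 2 else 1 / 2 - Complex.I / 2
    rw [Fintype.sum_bool] at this
    convert this using 1
    simp only [cond_true, cond_false]
    module
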